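/- Let $p\ge 1$, $m\ge 1$ and $n$ be integers with $2m<n$, let $\Theta=(\theta_{uv})$ be a positive definite $p\times p$ covariance matrix, and let $\mathbf X_1,\dots,\mathbf X_n$ be i.i.d. with law $P=\mathcal N_p(0,\Theta)$. Let $$f(\Theta)=a_0+\sum_{r=1}^m\ \sum_{1\le u_i\le v_i\le p,\ i\in[r]} a_{u_1v_1,\dots,u_rv_r}\,\theta_{u_1v_1}\cdots\theta_{u_rv_r}$$ be a real polynomial of degree at most $m$ in the entries of $\Theta$, and assume $f(\Theta)=0$. Put $$\breve h(\mathbf x_1,\dots,\mathbf x_m)=a_0+\sum_{r=1}^m\ \sum_{1\le u_i\le v_i\le p,\ i\in[r]} a_{u_1v_1,\dots,u_rv_r}\prod_{i=1}^r x_{i,u_i}x_{i,v_i},\qquad h(\mathbf x_1,\dots,\mathbf x_m)=\frac1{m!}\sum_{\pi\in\mathcal S_m}\breve h(\mathbf x_{\pi_1},\dots,\mathbf x_{\pi_m}),$$ $$U_n=\binom nm^{-1}\sum_{1\le i_1<\dots<i_m\le n}h(\mathbf X_{i_1},\dots,\mathbf X_{i_m}),\qquad g(\mathbf x)=\mathbb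 E[h(\mathbf x,\mathbf X_2,\dots,\mathbf X_m)],$$ $\sigma_g^2=\operatorname{var}[g(\mathbf X_1)]$ and $\sigma_h^2=\operatorname{var}[h(\mathbf X_1,\dots,\mathbf X_m)]$, and assume $\sigma_g>0$. For $1\le r\le m$ let $$\pi_r(h)(\mathbf x_1,\dots,\mathbf x_r)=(\delta_{\mathbf x_1}-P)\times\cdots\times(\delta_{\mathbf x_r}-P)\times P^{m-r}\,h,\qquad U_n^{(r)}=\binom nr^{-1}\sum_{1\le i_1<\dots<i_r\le n}\pi_r(h)(\mathbf X_{i_1},\dots,\mathbf X_{i_r}),$$ where $Q_1\times\cdots\times Q_m\,h$ denotes the integral of $h$ against the product of the (signed) measures $Q_i$. Then there are absolute constants $C_1,C_2>0$ (depending on none of $p,m,n,f,\Theta,x$) such that for every $x\in\mathbb R$ $$\left|P\!\left(\frac{\sqrt n}{m\sigma_g}U_n\le x\right)-\Phi(x)\right|\le C_1\frac{\mathbb E|g(\mathbf X_1)|^3}{\sqrt n\,\sigma_g^3}+P\!\left(\left|\frac{\sqrt n}{m\sigma_g}\sum_{r=2}^m\binom mr U_n^{(r)}\right|>\frac{|x|+1}{3}\right)+C_2e^{-|x|/6}\,\frac{(\sqrt2+2)(m-1)\sigma_h}{\sqrt{m(n-m+1)}\,\sigma_g},$$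 where $\Phi$ is the standard normal distribution function. -/

import Mathlib

open MeasureTheory ProbabilityTheory

noncomputable section

namespace GaussUStat

/-- Pairs `(u, v)` of coordinates with `u ≤ v`. -/
abbrev UpperPair (p : ℕ) : Type := {q : Fin p × Fin p // q.1 ≤ q.2}

/-- A real polynomial in the entries `θ_{uv}`, `u ≤ v`, of a symmetric `p × p` matrix, written as
`a₀ + ∑_{r=1}^m ∑_{(u₁,v₁),…,(u_r,v_r)} a_{u₁v₁,…,u_rv_r} θ_{u₁v₁} ⋯ θ_{u_rv_r}`.
The index `r : Fin m` stands for the terms of degree `r + 1`. -/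
structure CovPoly (p m : ℕ) where
  /-- the constant term -/
  a₀ : ℝ
  /-- the coefficients of the products of `r + 1` entries -/
  a : (r : Fin m) → (Fin (r.val + 1) → UpperPair p) → ℝ

/-- The value `f(Θ)`. -/
def CovPoly.eval {p m : ℕ} (f : CovPoly p m) (Θ : Matrix (Fin p) (Fin p) ℝ) : ℝ :=
  f.a₀ + ∑ r : Fin m, ∑ w : Fin (r.val + 1) → UpperPair p,
    f.a r w * ∏ i, Θ (w i).val.1 (w i).val.2

/-- `θ̂_{uv}(x) = x_u x_v`. -/
def thetaHat {p : ℕ} (q : UpperPair p) (x : EuclideanSpace ℝ (Fin p)) : ℝ :=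
  x q.val.1 * x q.val.2

/-- The unsymmetrized kernel: in each product, `θ_{u_i v_i}` is replaced by
`θ̂_{u_i v_i}(x_i)`. -/
def CovPoly.preKernel {p m : ℕ} (f : CovPoly p m)
    (x : Fin m → EuclideanSpace ℝ (Fin p)) : ℝ :=
  f.a₀ + ∑ r : Fin m, ∑ w : Fin (r.val + 1) → UpperPair p,
    f.a r w * ∏ i, thetaHat (w i) (x (Fin.castLE r.isLt i))

/-- The symmetric kernel `h`. -/
def CovPoly.kernel {p m : ℕ} (f : CovPoly p m)
    (x : Fin m → EuclideanSpace ℝ (Fin p)) : ℝ :=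
  ((m.factorial : ℝ))⁻¹ * ∑ π : Equiv.Perm (Fin m), f.preKernel (fun i => x (π i))

open Classical in
/-- The index set `I_{n,r}` of tuples `i₁ < ⋯ < i_r`. -/
def indexSet (n r : ℕ) : Finset (Fin r → Fin n) :=
  Finset.univ.filter fun i => StrictMono i

/-- The complete U-statistic of the data `X₁, …, X_n` with a kernel `k` in `r` arguments. -/
def uStat {E Ω : Type*} {n r : ℕ} (k : (Fin r → E) → ℝ) (X : Fin n → Ω → E) (ω : Ω) : ℝ :=
  ((n.choose r : ℝ))⁻¹ * ∑ i ∈ indexSet n r, k (fun j => X (i j) ω)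

section Kernel

variable {E : Type*} [MeasurableSpace E] {m : ℕ}

/-- The projection kernel `g(x) = 𝔼[h(x, X₂, …, X_m)]` for `X_i` i.i.d. with law `P`
(the first of the `m` integration variables is not used). -/
def projKernel (P : Measure E) (h : (Fin m → E) → ℝ) (x : E) : ℝ :=
  ∫ y, h (fun i => if i.val = 0 then x else y i) ∂(Measure.pi fun _ : Fin m => P)

/-- `Q₁ × ⋯ × Q_m Ψ` where `Q_i = δ_{x_i}` for `i ∈ A ⊆ [r]` and `Q_i = P` otherwise. -/
def mixedMean (P : Measure E) (Ψ : (Fin m → E) → ℝ) {r : ℕ} (A : Finset (Fin r))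
    (x : Fin r → E) : ℝ :=
  ∫ y, Ψ (fun i => if hi : i.val < r then (if ⟨i.val, hi⟩ ∈ A then x ⟨i.val, hi⟩ else y i)
    else y i) ∂(Measure.pi fun _ : Fin m => P)

/-- The Hoeffding projection
`π_r(Ψ)(x₁, …, x_r) = (δ_{x₁} - P) × ⋯ × (δ_{x_r} - P) × P^{m-r} Ψ`, the product of signed
measures being expanded by multilinearity. -/
def hoeffdingProj (P : Measure E) (Ψ : (Fin m → E) → ℝ) (r : ℕ) (x : Fin r → E) : ℝ :=
  ∑ A : Finset (Fin r), (-1 : ℝ) ^ (r - A.card) * mixedMean P Ψ A x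

/-- The standard deviation `σ_g` of `g(X)`. -/
def sigmaG (P : Measure E) (h : (Fin m → E) → ℝ) : ℝ :=
  Real.sqrt (variance (projKernel P h) P)

/-- The standard deviation `σ_h` of `h(X₁, …, X_m)`. -/
def sigmaH (P : Measure E) (h : (Fin m → E) → ℝ) : ℝ :=
  Real.sqrt (variance h (Measure.pi fun _ : Fin m => P))

/-- `𝔼|g|³`. -/
def absThirdMomentG (P : Measure E) (h : (Fin m → E) → ℝ) : ℝ :=
  ∫ x, |projKernel P h x| ^ 3 ∂P

/-- The remainder `∑_{r=2}^m (m choose r) U_n^{(r)}` of the Hoeffding decomposition, where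
`U_n^{(r)}` is the U-statistic with kernel `π_r(h)`. -/
def hoeffdingRemainder {Ω : Type*} {n : ℕ} (P : Measure E) (h : (Fin m → E) → ℝ)
    (X : Fin n → Ω → E) (ω : Ω) : ℝ :=
  ∑ r ∈ Finset.Icc 2 m, (m.choose r : ℝ) * uStat (hoeffdingProj P h r) X ω

end Kernel

end GaussUStat

end

/-! The Hoeffding decomposition writes `√n / (m σ_g) U_n` as `W + Δ`. Here `W = ∑ ξ_t` with `ξ_t =
g(X_t) / (√n σ_g)` is a standardized sum of i.i.d. variables, and `Δ` collects the rescaled terms of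
order at least two. The events `W + Δ ≤ x` and `W ≤ x` differ only where `|W - x| ≤ |Δ|`. The error
is therefore at most the classical Berry–Esseen error of `W` plus the probability of that event,
whose part with `|Δ| > (|x| + 1) / 3` stays in the bound (`IsStdSum.nonlinear_berry_esseen`).

The rest is the randomized concentration inequality `IsStdSum.tilted_concentration`. Let `S` be the
sum of the summands truncated at one, so that `𝔼 e^S ≤ e²`. Test `W` against `e^{S/2}` times a
linear function of `S` clipped at levels governed by `|Δ|`. By Cauchy–Schwarz the expectation is
`O(‖Δ‖₂ + δ)`. Expanded summand by summand, it is at least about half of `𝔼 e^{S/2}` on the event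
`|S - x| ≤ |Δ|`, once `Δ` is replaced in the `t`-th term by a `Δ_t` independent of `X_t`; this costs
`∑ ‖ξ_t‖₂ ‖Δ - Δ_t‖₂`. For `x ≥ 0` and `|Δ| ≤ (x + 1) / 3` the event forces `W ≥ (2x - 1) / 3`, so
removing the tilt leaves the factor `e^{-x/3}`.

With constant `Δ` the same inequality is a uniform concentration bound, which feeds Stein's method
for `W` itself (`IsStdSum.berry_esseen`). Throughout, `δ` dominates the Lyapunov ratio, here equal
to `𝔼|g|³ / (√n σ_g³)`.

The `L²` norms come from orthogonality. The kernel is a sum of products of functions of single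
observations, and its Hoeffding projections are sums of products of centred functions, so terms
belonging to different sets of observations are orthogonal. Both `𝔼 Δ²` and `∑ 𝔼 (Δ - Δ_t)²` become
weighted sums of projection variances in which a set `A` counts at most `|A|` times; `mul_weight_le`
compares these with `σ_h²`. Normality enters only through finite moments and the unbiasedness `𝔼 h =
f(Θ) = 0`. -/

namespace BerryEsseen

/-! ### Truncation at level one -/

/-- Truncation of a real number at level one. -/
noncomputable def trunc (s : ℝ) : ℝ := if |s| ≤ 1 then s else 0

lemma trunc_of_le {s : ℝ} (h : |s| ≤ 1) : trunc s = s := if_pos h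

lemma trunc_of_lt {s : ℝ} (h : 1 < |s|) : trunc s = 0 := if_neg (not_le.2 h)

lemma trunc_eq_self_or (s : ℝ) : trunc s = s ∨ trunc s = 0 := by
  unfold trunc; split_ifs <;> simp

lemma abs_trunc_le_one (s : ℝ) : |trunc s| ≤ 1 := by
  unfold trunc; split_ifs with h <;> simp [h]

lemma abs_trunc_le (s : ℝ) : |trunc s| ≤ |s| := by
  rcases trunc_eq_self_or s with h | h <;> simp [h]

lemma trunc_neg (s : ℝ) : trunc (-s) = -trunc s := by
  unfold trunc; rw [abs_neg]; split_ifs <;> simp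

@[fun_prop]
lemma measurable_trunc : Measurable trunc :=
  Measurable.ite (measurableSet_le (by fun_prop) (by fun_prop)) measurable_id measurable_const

/-- The linear term on the right is the untruncated `s`, so it vanishes in the mean of a centred
variable. For `|s| > 1` the left side is one and `|s| ≤ s²` suffices. -/
lemma exp_trunc_le (s : ℝ) : Real.exp (trunc s) ≤ 1 + s + 2 * s ^ 2 := by
  rcases le_or_gt |s| 1 with h | h
  · rw [trunc_of_le h]
    have := (abs_le.1 (Real.abs_exp_sub_one_sub_id_le h)).2
    nlinarith [sq_nonneg s]
  · rw [trunc_of_lt h, Real.exp_zero]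
    have h1 : |s| ≤ s ^ 2 := by rw [← sq_abs]; nlinarith
    nlinarith [neg_abs_le s]

lemma abs_mul_exp_trunc_sub_one_le (s : ℝ) : |s * (Real.exp (trunc s) - 1)| ≤ 2 * s ^ 2 := by
  have h := Real.abs_exp_sub_one_le (abs_trunc_le_one s)
  rw [abs_mul, ← sq_abs]
  nlinarith [abs_nonneg s, abs_trunc_le s]

lemma exp_trunc_le_three (s : ℝ) : Real.exp (trunc s) ≤ 3 :=
  (Real.exp_le_exp.2 ((le_abs_self _).trans (abs_trunc_le_one s))).trans
    (by linarith [Real.exp_one_lt_d9])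

/-! ### The tilted clipped linear function -/

/-- The test function `exp (w / 2) * (w - x + d + δ)`, the linear factor being clipped to
`[0, 2 d + 2 δ]`. -/
noncomputable def tiltClip (x δ d w : ℝ) : ℝ :=
  Real.exp (w / 2) * min (max (w - x + d + δ) 0) (2 * d + 2 * δ)

lemma continuous_tiltClip (x δ : ℝ) : Continuous fun q : ℝ × ℝ => tiltClip x δ q.1 q.2 := by
  unfold tiltClip; fun_prop

lemma tiltClip_nonneg {x δ d w : ℝ} (hδ : 0 ≤ δ) (hd : 0 ≤ d) : 0 ≤ tiltClip x δ d w := by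
  unfold tiltClip
  have : 0 ≤ min (max (w - x + d + δ) 0) (2 * d + 2 * δ) :=
    le_min (le_max_right _ _) (by positivity)
  positivity

lemma tiltClip_le (x δ d w : ℝ) : tiltClip x δ d w ≤ Real.exp (w / 2) * (2 * d + 2 * δ) :=
  mul_le_mul_of_nonneg_left (min_le_right _ _) (Real.exp_pos _).le

lemma tiltClip_mono {x δ d : ℝ} (hδ : 0 ≤ δ) (hd : 0 ≤ d) : Monotone (tiltClip x δ d) := by
  intro w w' h
  have h0 : 0 ≤ min (max (w - x + d + δ) 0) (2 * d + 2 * δ) :=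
    le_min (le_max_right _ _) (by positivity)
  unfold tiltClip
  refine mul_le_mul (Real.exp_le_exp.2 (by linarith)) ?_ h0 (Real.exp_pos _).le
  gcongr

/-- The linear part moves with `d` at rate one and the upper clipping level at rate two, and
clipping does not increase distances. This prices the replacement of `Δ` by `Δ'`. -/
lemma abs_tiltClip_sub_le (x δ d d' w : ℝ) :
    |tiltClip x δ d w - tiltClip x δ d' w| ≤ Real.exp (w / 2) * (2 * |d - d'|) := by
  unfold tiltClip
  rw [← mul_sub, abs_mul, abs_of_pos (Real.exp_pos _)]
  refine mul_le_mul_of_nonneg_left ?_ (Real.exp_pos _).le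
  refine (abs_min_sub_min_le_max _ _ _ _).trans (max_le ?_ ?_)
  · refine (abs_max_sub_max_le_max _ _ _ _).trans (max_le ?_ ?_)
    · rw [show w - x + d + δ - (w - x + d' + δ) = d - d' by ring]
      linarith [abs_nonneg (d - d')]
    · simp
  · rw [show 2 * d + 2 * δ - (2 * d' + 2 * δ) = 2 * (d - d') by ring, abs_mul, abs_two]

/-- For `|w - x| ≤ d` the linear factor lies in `[δ, 2d + δ]`, at distance at least `δ` from both
clipping levels. A step of length `s` thus changes it by at least `min s δ`. -/
lemma tiltClip_sub_ge_of_nonneg {x δ d w s : ℝ} (hδ : 0 ≤ δ) (hw : |w - x| ≤ d) (hs : 0 ≤ s) :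
    Real.exp (w / 2) * min s δ ≤ tiltClip x δ d w - tiltClip x δ d (w - s) := by
  obtain ⟨h1, h2⟩ := abs_le.1 hw
  have e1 : min (max (w - x + d + δ) 0) (2 * d + 2 * δ) = w - x + d + δ := by
    rw [max_eq_left (by linarith), min_eq_left (by linarith)]
  have e2 : min (max (w - s - x + d + δ) 0) (2 * d + 2 * δ) ≤ w - x + d + δ - min s δ :=
    (min_le_left _ _).trans (max_le (by linarith [min_le_left s δ])
      (by linarith [min_le_right s δ]))
  have e3 : 0 ≤ min (max (w - s - x + d + δ) 0) (2 * d + 2 * δ) :=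
    le_min (le_max_right _ _) (by linarith)
  unfold tiltClip
  rw [e1]
  have e4 : Real.exp ((w - s) / 2) ≤ Real.exp (w / 2) := Real.exp_le_exp.2 (by linarith)
  have e5 := mul_le_mul e4 e2 e3 (Real.exp_pos _).le
  linarith

lemma tiltClip_sub_ge_of_nonpos {x δ d w s : ℝ} (hδ : 0 ≤ δ) (hw : |w - x| ≤ d) (hs : 0 ≤ s) :
    Real.exp (w / 2) * min s δ ≤ tiltClip x δ d (w + s) - tiltClip x δ d w := by
  obtain ⟨h1, h2⟩ := abs_le.1 hw
  have e1 : min (max (w - x + d + δ) 0) (2 * d + 2 * δ) = w - x + d + δ := by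
    rw [max_eq_left (by linarith), min_eq_left (by linarith)]
  have hm : 0 ≤ min s δ := le_min hs hδ
  have e2 : w - x + d + δ + min s δ ≤ min (max (w + s - x + d + δ) 0) (2 * d + 2 * δ) :=
    le_min ((by linarith [min_le_left s δ] : _ ≤ w + s - x + d + δ).trans (le_max_left _ _))
      (by linarith [min_le_right s δ])
  unfold tiltClip
  rw [e1]
  have e4 : Real.exp (w / 2) ≤ Real.exp ((w + s) / 2) := Real.exp_le_exp.2 (by linarith)
  have e5 := mul_le_mul e4 e2 (by linarith) (Real.exp_pos _).le
  linarith

/-- By monotonicity the increment has the sign of `s`, so terms outside the concentration event can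
be dropped. For `|s| > 1` the truncated step is zero and so is the increment. -/
lemma mul_tiltClip_sub_nonneg {x δ d : ℝ} (hδ : 0 ≤ δ) (hd : 0 ≤ d) (w s : ℝ) :
    0 ≤ s * (tiltClip x δ d w - tiltClip x δ d (w - trunc s)) := by
  rcases trunc_eq_self_or s with h | h <;> rw [h]
  · rcases le_total 0 s with hs | hs
    · exact mul_nonneg hs (sub_nonneg.2 (tiltClip_mono hδ hd (by linarith)))
    · exact mul_nonneg_of_nonpos_of_nonpos hs
        (sub_nonpos.2 (tiltClip_mono hδ hd (by linarith)))
  · simp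

lemma mul_tiltClip_sub_ge {x δ d w : ℝ} (hδ : 0 ≤ δ) (hw : |w - x| ≤ d) (s : ℝ) :
    Real.exp (w / 2) * (|trunc s| * min |trunc s| δ)
      ≤ s * (tiltClip x δ d w - tiltClip x δ d (w - trunc s)) := by
  rcases trunc_eq_self_or s with h | h <;> rw [h]
  · rcases le_total 0 s with hs | hs
    · have := tiltClip_sub_ge_of_nonneg hδ hw hs
      rw [abs_of_nonneg hs]; nlinarith
    · have := tiltClip_sub_ge_of_nonpos hδ hw (neg_nonneg.2 hs)
      rw [abs_of_nonpos hs, sub_eq_add_neg w s]; nlinarith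
  · simp

/-! ### Auxiliary integral inequalities -/

section Aux

variable {Ω : Type*} [MeasurableSpace Ω] {μ : Measure Ω}

/-- The Cauchy–Schwarz inequality for real functions. -/
lemma integral_abs_mul_le_sqrt {f g : Ω → ℝ} (hf : MemLp f 2 μ) (hg : MemLp g 2 μ) :
    ∫ ω, |f ω * g ω| ∂μ ≤ √(∫ ω, f ω ^ 2 ∂μ) * √(∫ ω, g ω ^ 2 ∂μ) := by
  have h := integral_mul_le_Lp_mul_Lq_of_nonneg (μ := μ) (f := fun ω => |f ω|)
    (g := fun ω => |g ω|) Real.HolderConjugate.two_two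
    (Filter.Eventually.of_forall fun _ => abs_nonneg _)
    (Filter.Eventually.of_forall fun _ => abs_nonneg _)
    (by rw [ENNReal.ofReal_ofNat]; exact hf.abs) (by rw [ENNReal.ofReal_ofNat]; exact hg.abs)
  simpa [abs_mul, Real.sqrt_eq_rpow] using h

lemma integrable_fun_mul {f g : Ω → ℝ} (hf : MemLp f 2 μ) (hg : MemLp g 2 μ) :
    Integrable (fun ω => f ω * g ω) μ := hf.integrable_mul hg

lemma integral_abs_le_sqrt [IsProbabilityMeasure μ] {f : Ω → ℝ} (hf : MemLp f 2 μ) :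
    ∫ ω, |f ω| ∂μ ≤ √(∫ ω, f ω ^ 2 ∂μ) := by
  simpa using integral_abs_mul_le_sqrt hf (memLp_const (1 : ℝ))

end Aux

/-! ### Standardized sums -/

/-- The sum of the truncated summands. -/
noncomputable def truncSum {Ω ι : Type*} [Fintype ι] (ξ : ι → Ω → ℝ) (ω : Ω) : ℝ :=
  ∑ i, trunc (ξ i ω)

lemma truncSum_le_card {Ω ι : Type*} [Fintype ι] (ξ : ι → Ω → ℝ) (ω : Ω) :
    truncSum ξ ω ≤ Fintype.card ι := by
  refine (Finset.sum_le_card_nsmul _ _ 1 fun i _ =>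
    (le_abs_self _).trans (abs_trunc_le_one (ξ i ω))).trans ?_
  simp

variable {Ω ι : Type*} [MeasurableSpace Ω] [Fintype ι] {μ : Measure Ω} {ξ : ι → Ω → ℝ}

/-- Independent centred summands with finite third moments whose variances add up to one. -/
structure IsStdSum (ξ : ι → Ω → ℝ) (μ : Measure Ω) : Prop where
  meas : ∀ i, Measurable (ξ i)
  indep : iIndepFun ξ μ
  memLp : ∀ i, MemLp (ξ i) 3 μ
  mean : ∀ i, ∫ ω, ξ i ω ∂μ = 0
  var : ∑ i, ∫ ω, ξ i ω ^ 2 ∂μ = 1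

/-- The Lyapunov ratio `∑ 𝔼|ξ_i|³`. -/
noncomputable def lyapunov (ξ : ι → Ω → ℝ) (μ : Measure Ω) : ℝ := ∑ i, ∫ ω, |ξ i ω| ^ 3 ∂μ

lemma lyapunov_neg (ξ : ι → Ω → ℝ) (μ : Measure Ω) :
    lyapunov (fun i ω => -ξ i ω) μ = lyapunov ξ μ := by
  simp [lyapunov]

namespace IsStdSum

lemma neg (h : IsStdSum ξ μ) : IsStdSum (fun i ω => -ξ i ω) μ where
  meas i := (h.meas i).neg
  indep := h.indep.comp (fun _ x => -x) fun _ => measurable_neg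
  memLp i := (h.memLp i).neg
  mean i := by rw [integral_neg, h.mean, neg_zero]
  var := by simpa using h.var

lemma isProbabilityMeasure (h : IsStdSum ξ μ) : IsProbabilityMeasure μ :=
  h.indep.isProbabilityMeasure

lemma memLp_two (h : IsStdSum ξ μ) (i : ι) : MemLp (ξ i) 2 μ := by
  have := h.isProbabilityMeasure
  exact (h.memLp i).mono_exponent (by norm_num)

lemma integrable (h : IsStdSum ξ μ) (i : ι) : Integrable (ξ i) μ := by
  have := h.isProbabilityMeasure
  exact (h.memLp_two i).integrable (by norm_num)

lemma integrable_sq (h : IsStdSum ξ μ) (i : ι) : Integrable (fun ω => ξ i ω ^ 2) μ :=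
  (h.memLp_two i).integrable_sq

lemma integrable_cube (h : IsStdSum ξ μ) (i : ι) : Integrable (fun ω => |ξ i ω| ^ 3) μ := by
  simpa using (h.memLp i).integrable_norm_pow (by norm_num : (3 : ℕ) ≠ 0)

/-- Expectation of a product of functions of the individual summands, each controlled up to the
factor `exp (2 𝔼 ξ_k²)`. -/
lemma abs_integral_prod_le (h : IsStdSum ξ μ) {u : ι → ℝ → ℝ} (hu : ∀ k, Measurable (u k))
    {a : ι → ℝ} (hua : ∀ k, |∫ ω, u k (ξ k ω) ∂μ| ≤ a k * Real.exp (2 * ∫ ω, ξ k ω ^ 2 ∂μ)) :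
    |∫ ω, ∏ k, u k (ξ k ω) ∂μ| ≤ (∏ k, a k) * Real.exp 2 := by
  rw [h.indep.integral_fun_prod_comp (fun i => (h.meas i).aemeasurable)
    (fun i => (hu i).aestronglyMeasurable), Finset.abs_prod]
  refine (Finset.prod_le_prod (fun _ _ => abs_nonneg _) fun k _ => hua k).trans_eq ?_
  rw [Finset.prod_mul_distrib, ← Real.exp_sum, ← Finset.mul_sum, h.var, mul_one]

/-- Centring leaves `1 + 2 𝔼 ξ_i²`. The exponential upper bound is chosen because it multiplies to
`exp 2` over all summands, the variances adding up to one. -/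
lemma integral_exp_trunc_le (h : IsStdSum ξ μ) (i : ι) :
    |∫ ω, Real.exp (trunc (ξ i ω)) ∂μ| ≤ Real.exp (2 * ∫ ω, ξ i ω ^ 2 ∂μ) := by
  have := h.isProbabilityMeasure
  have i1 : Integrable (fun ω => 1 + ξ i ω) μ := (integrable_const 1).add (h.integrable i)
  have i2 : Integrable (fun ω => 2 * ξ i ω ^ 2) μ := (h.integrable_sq i).const_mul 2
  rw [abs_of_nonneg (integral_nonneg fun _ => (Real.exp_pos _).le)]
  calc ∫ ω, Real.exp (trunc (ξ i ω)) ∂μ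
      ≤ ∫ ω, (1 + ξ i ω + 2 * ξ i ω ^ 2) ∂μ :=
        integral_mono_of_nonneg (Filter.Eventually.of_forall fun _ => (Real.exp_pos _).le)
          (i1.add i2) (Filter.Eventually.of_forall fun ω => exp_trunc_le _)
    _ = 2 * (∫ ω, ξ i ω ^ 2 ∂μ) + 1 := by
        rw [integral_add i1 i2, integral_add (integrable_const 1) (h.integrable i), h.mean,
          integral_const_mul]
        simp [add_comm]
    _ ≤ _ := Real.add_one_le_exp _

/-- Since `𝔼 ξ_i = 0`, the exponential may be replaced by its deviation from one, which gains a
second order in `ξ_i`. -/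
lemma abs_integral_mul_exp_trunc_le (h : IsStdSum ξ μ) (i : ι) :
    |∫ ω, ξ i ω * Real.exp (trunc (ξ i ω)) ∂μ| ≤ 2 * ∫ ω, ξ i ω ^ 2 ∂μ := by
  have hb : Integrable (fun ω => ξ i ω * (Real.exp (trunc (ξ i ω)) - 1)) μ := by
    refine ((h.integrable_sq i).const_mul 2).mono' ?_ (Filter.Eventually.of_forall fun ω => ?_)
    · exact (by have := h.meas i; fun_prop : Measurable _).aestronglyMeasurable
    · exact abs_mul_exp_trunc_sub_one_le _
  have e : ∫ ω, ξ i ω * Real.exp (trunc (ξ i ω)) ∂μ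
      = ∫ ω, ξ i ω * (Real.exp (trunc (ξ i ω)) - 1) ∂μ := by
    have : (fun ω => ξ i ω * Real.exp (trunc (ξ i ω)))
        = fun ω => ξ i ω * (Real.exp (trunc (ξ i ω)) - 1) + ξ i ω := by ext; ring
    rw [this, integral_add hb (h.integrable i), h.mean, add_zero]
  rw [e]
  refine (abs_integral_le_integral_abs).trans ?_
  rw [← integral_const_mul]
  exact integral_mono hb.abs ((h.integrable_sq i).const_mul 2)
    fun ω => abs_mul_exp_trunc_sub_one_le _

lemma integral_sq_mul_exp_trunc_le (h : IsStdSum ξ μ) (i : ι) :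
    |∫ ω, ξ i ω ^ 2 * Real.exp (trunc (ξ i ω)) ∂μ| ≤ 3 * ∫ ω, ξ i ω ^ 2 ∂μ := by
  rw [abs_of_nonneg (integral_nonneg fun _ => by positivity), ← integral_const_mul]
  refine integral_mono_of_nonneg (Filter.Eventually.of_forall fun _ => by positivity)
    ((h.integrable_sq i).const_mul 3) (Filter.Eventually.of_forall fun ω => ?_)
  have := exp_trunc_le_three (ξ i ω)
  simp only
  nlinarith [sq_nonneg (ξ i ω)]

lemma measurable_truncSum (h : IsStdSum ξ μ) : Measurable (truncSum ξ) := by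
  have := h.meas; unfold truncSum; fun_prop

lemma integral_exp_truncSum_le (h : IsStdSum ξ μ) :
    ∫ ω, Real.exp (truncSum ξ ω) ∂μ ≤ Real.exp 2 := by
  have := h.abs_integral_prod_le (u := fun _ s => Real.exp (trunc s)) (a := 1)
    (fun _ => by fun_prop) (fun k => by simpa using h.integral_exp_trunc_le k)
  simp only [truncSum, Real.exp_sum]
  simpa using (le_abs_self _).trans this

lemma integral_exp_truncSum_sub_le (h : IsStdSum ξ μ) (i : ι) :
    ∫ ω, Real.exp (truncSum ξ ω - trunc (ξ i ω)) ∂μ ≤ Real.exp 2 := by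
  classical
  have := h.isProbabilityMeasure
  have := h.abs_integral_prod_le (u := fun k s => if k = i then 1 else Real.exp (trunc s))
    (a := 1)
    (fun k => by split_ifs <;> fun_prop) (fun k => by
      by_cases hk : k = i
      · simp only [hk, if_true, integral_const, probReal_univ, Pi.one_apply, one_mul]
        simpa using Real.one_le_exp (by positivity)
      · simpa [hk] using h.integral_exp_trunc_le k)
  have e : ∀ ω, Real.exp (truncSum ξ ω - trunc (ξ i ω))
      = ∏ k, if k = i then 1 else Real.exp (trunc (ξ k ω)) := by
    intro ω
    rw [truncSum, ← Finset.add_sum_erase _ _ (Finset.mem_univ i), add_sub_cancel_left,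
      Real.exp_sum, ← Finset.mul_prod_erase _ _ (Finset.mem_univ i), if_pos rfl, one_mul]
    exact Finset.prod_congr rfl fun k hk => by rw [if_neg (Finset.ne_of_mem_erase hk)]
  simp only [e]
  simpa using (le_abs_self _).trans this

lemma abs_integral_mul_mul_exp_truncSum_le (h : IsStdSum ξ μ) {i j : ι} (hij : i ≠ j) :
    |∫ ω, ξ i ω * ξ j ω * Real.exp (truncSum ξ ω) ∂μ|
      ≤ 4 * (∫ ω, ξ i ω ^ 2 ∂μ) * (∫ ω, ξ j ω ^ 2 ∂μ) * Real.exp 2 := by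
  classical
  have hs : ∀ k, 1 ≤ Real.exp (2 * ∫ ω, ξ k ω ^ 2 ∂μ) := fun k => Real.one_le_exp (by positivity)
  have key := h.abs_integral_prod_le
    (u := fun k s => (if k = i then s else 1) * (if k = j then s else 1) * Real.exp (trunc s))
    (a := fun k => (if k = i then 2 * ∫ ω, ξ k ω ^ 2 ∂μ else 1)
      * (if k = j then 2 * ∫ ω, ξ k ω ^ 2 ∂μ else 1))
    (fun k => by split_ifs <;> fun_prop) (fun k => by
      have hk := hs k
      have hn : 0 ≤ ∫ ω, ξ k ω ^ 2 ∂μ := by positivity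
      by_cases hi : k = i
      · subst hi
        simp only [if_true, hij, if_false, mul_one]
        nlinarith [h.abs_integral_mul_exp_trunc_le k]
      · by_cases hj : k = j
        · subst hj
          simp only [if_true, hi, if_false, one_mul]
          nlinarith [h.abs_integral_mul_exp_trunc_le k]
        · simpa [hi, hj] using h.integral_exp_trunc_le k)
  simp only [Finset.prod_mul_distrib, Finset.prod_ite_eq', Finset.mem_univ, if_true,
    ← Real.exp_sum] at key
  simp only [truncSum]
  convert key using 1
  ring

lemma abs_integral_sq_mul_exp_truncSum_le (h : IsStdSum ξ μ) (i : ι) :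
    |∫ ω, ξ i ω * ξ i ω * Real.exp (truncSum ξ ω) ∂μ|
      ≤ 3 * (∫ ω, ξ i ω ^ 2 ∂μ) * Real.exp 2 := by
  classical
  have hs : ∀ k, 1 ≤ Real.exp (2 * ∫ ω, ξ k ω ^ 2 ∂μ) := fun k => Real.one_le_exp (by positivity)
  have key := h.abs_integral_prod_le
    (u := fun k s => (if k = i then s ^ 2 else 1) * Real.exp (trunc s))
    (a := fun k => if k = i then 3 * ∫ ω, ξ k ω ^ 2 ∂μ else 1)
    (fun k => by split_ifs <;> fun_prop) (fun k => by
      have hk := hs k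
      have hn : 0 ≤ ∫ ω, ξ k ω ^ 2 ∂μ := by positivity
      by_cases hi : k = i
      · subst hi
        simp only [if_true]
        nlinarith [h.integral_sq_mul_exp_trunc_le k]
      · simpa [hi] using h.integral_exp_trunc_le k)
  simp only [Finset.prod_mul_distrib, Finset.prod_ite_eq', Finset.mem_univ, if_true,
    ← Real.exp_sum] at key
  simp only [truncSum]
  convert key using 5
  ring

/-- The square is expanded. Diagonal terms give `3 𝔼 ξ_i²`. Off the diagonal each centred factor
contributes its own variance, giving `4 𝔼 ξ_i² 𝔼 ξ_j²`, so the double sum does not grow with the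
number of summands. The total is `3 + 4 = 7`. -/
lemma integral_sum_sq_mul_exp_truncSum_le (h : IsStdSum ξ μ) :
    ∫ ω, (∑ i, ξ i ω) ^ 2 * Real.exp (truncSum ξ ω) ∂μ ≤ 7 * Real.exp 2 := by
  classical
  have hint : ∀ i j, Integrable (fun ω => ξ i ω * ξ j ω * Real.exp (truncSum ξ ω)) μ := by
    intro i j
    refine ((h.memLp_two i).integrable_mul (h.memLp_two j)).mul_bdd
      (c := Real.exp (Fintype.card ι)) ?_ (Filter.Eventually.of_forall fun ω => ?_)
    · exact (h.measurable_truncSum.exp).aestronglyMeasurable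
    · rw [Real.norm_of_nonneg (Real.exp_pos _).le]
      exact Real.exp_le_exp.2 (truncSum_le_card ξ ω)
  have hs0 : ∀ i, 0 ≤ ∫ ω, ξ i ω ^ 2 ∂μ := fun i => by positivity
  have e : ∀ ω, (∑ i, ξ i ω) ^ 2 * Real.exp (truncSum ξ ω)
      = ∑ i, ∑ j, ξ i ω * ξ j ω * Real.exp (truncSum ξ ω) := by
    intro ω; simp only [sq, Finset.sum_mul, Finset.mul_sum]; exact Finset.sum_comm
  simp only [e]
  rw [integral_finsetSum _ fun i _ => integrable_finsetSum _ fun j _ => hint i j]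
  simp only [integral_finsetSum _ fun j _ => hint _ j]
  calc ∑ i, ∑ j, ∫ ω, ξ i ω * ξ j ω * Real.exp (truncSum ξ ω) ∂μ
      ≤ ∑ i, ∑ j, ((if i = j then 3 * (∫ ω, ξ i ω ^ 2 ∂μ) * Real.exp 2 else 0)
        + 4 * (∫ ω, ξ i ω ^ 2 ∂μ) * (∫ ω, ξ j ω ^ 2 ∂μ) * Real.exp 2) := by
        refine Finset.sum_le_sum fun i _ => Finset.sum_le_sum fun j _ => ?_
        by_cases hij : i = j
        · subst hij
          have := (le_abs_self _).trans (h.abs_integral_sq_mul_exp_truncSum_le i)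
          have h2 := hs0 i
          rw [if_pos rfl]
          have : 0 ≤ 4 * (∫ ω, ξ i ω ^ 2 ∂μ) * (∫ ω, ξ i ω ^ 2 ∂μ) * Real.exp 2 := by positivity
          linarith
        · rw [if_neg hij, zero_add]
          exact (le_abs_self _).trans (h.abs_integral_mul_mul_exp_truncSum_le hij)
    _ = 7 * Real.exp 2 := by
        simp only [Finset.sum_add_distrib, Finset.sum_ite_eq, Finset.mem_univ, if_true,
          ← Finset.sum_mul, ← Finset.mul_sum, h.var]
        ring

end IsStdSum

end BerryEsseen

namespace BerryEsseen

/-! ### The randomized concentration inequality -/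

/-- With `a = |s|`: for `δ ≤ a ≤ 1` the claim follows from `a (a - 2δ)² ≥ 0`, and for `a > 1` the
truncation is zero but `a² ≤ a³`. -/
lemma abs_mul_min_ge {δ : ℝ} (hδ : 0 < δ) (s : ℝ) :
    s ^ 2 - |s| ^ 3 - |s| ^ 3 / (4 * δ) ≤ |trunc s| * min |trunc s| δ := by
  rw [← sq_abs]
  set a := |s| with ha
  have ha0 : 0 ≤ a := abs_nonneg s
  have hq : 0 ≤ a ^ 3 / (4 * δ) := by positivity
  rcases le_or_gt a 1 with h | h
  · rw [trunc_of_le h, ← ha]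
    rcases le_total a δ with h1 | h1
    · rw [min_eq_left h1]
      nlinarith [pow_nonneg ha0 3]
    · rw [min_eq_right h1]
      have : a ^ 2 - a * δ ≤ a ^ 3 / (4 * δ) := by
        rw [le_div_iff₀ (by positivity)]
        nlinarith [mul_nonneg ha0 (sq_nonneg (a - 2 * δ))]
      nlinarith [pow_nonneg ha0 3]
  · rw [trunc_of_lt h]
    have : a ^ 2 ≤ a ^ 3 := pow_le_pow_right₀ h.le (by norm_num)
    simp only [abs_zero, zero_mul]
    linarith

variable {Ω ι : Type*} [MeasurableSpace Ω] [Fintype ι] {μ : Measure Ω} {ξ : ι → Ω → ℝ}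

/-- A proxy for the conditional variance, `∑ |ξ̄_i| min(|ξ̄_i|, δ)`. -/
noncomputable def smallSum {Ω ι : Type*} [Fintype ι] (ξ : ι → Ω → ℝ) (δ : ℝ) (ω : Ω) : ℝ :=
  ∑ i, |trunc (ξ i ω)| * min |trunc (ξ i ω)| δ

lemma memLp_tiltClip [IsFiniteMeasure μ] {S Δ : Ω → ℝ} {c x δ : ℝ} (hδ : 0 ≤ δ)
    (mS : Measurable S) (hS : ∀ ω, S ω ≤ c) (mΔ : Measurable Δ) (hΔ : MemLp Δ 2 μ) :
    MemLp (fun ω => tiltClip x δ |Δ ω| (S ω)) 2 μ := by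
  refine (((hΔ.abs.const_mul 2).add (memLp_const (2 * δ))).const_mul (Real.exp (c / 2))).mono'
    ?_ (Filter.Eventually.of_forall fun ω => ?_)
  · exact ((continuous_tiltClip x δ).measurable.comp
      ((mΔ.abs).prodMk mS)).aestronglyMeasurable
  · rw [Real.norm_of_nonneg (tiltClip_nonneg hδ (abs_nonneg _))]
    refine (tiltClip_le _ _ _ _).trans ?_
    have : Real.exp (S ω / 2) ≤ Real.exp (c / 2) := Real.exp_le_exp.2 (by linarith [hS ω])
    have h0 : 0 ≤ 2 * |Δ ω| + 2 * δ := by positivity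
    exact mul_le_mul_of_nonneg_right this h0

namespace IsStdSum

lemma measurable_smallSum (h : IsStdSum ξ μ) (δ : ℝ) : Measurable (smallSum ξ δ) := by
  have := h.meas; unfold smallSum; fun_prop

lemma memLp_smallTerm (h : IsStdSum ξ μ) {δ : ℝ} (hδ : 0 < δ) (i : ι) :
    MemLp (fun ω => |trunc (ξ i ω)| * min |trunc (ξ i ω)| δ) 2 μ := by
  refine ((h.memLp_two i).abs.const_mul δ).mono' ?_ (Filter.Eventually.of_forall fun ω => ?_)
  · exact (by have := h.meas i; fun_prop : Measurable _).aestronglyMeasurable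
  · have h0 : 0 ≤ min |trunc (ξ i ω)| δ := le_min (abs_nonneg _) hδ.le
    rw [Real.norm_of_nonneg (by positivity), mul_comm]
    exact mul_le_mul (min_le_right _ _) (abs_trunc_le _) (abs_nonneg _) hδ.le

/-- Summing the pointwise bound, the total variance one loses at most `(1 + 1 / (4δ)) δ = δ + 1/4 ≤
1/2`. -/
lemma half_le_integral_smallSum (h : IsStdSum ξ μ) {δ : ℝ} (hδ0 : 0 < δ)
    (hδ : lyapunov ξ μ ≤ δ) (hδ4 : δ ≤ 1 / 4) : 1 / 2 ≤ ∫ ω, smallSum ξ δ ω ∂μ := by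
  have := h.isProbabilityMeasure
  unfold smallSum
  rw [integral_finsetSum _ fun i _ => (h.memLp_smallTerm hδ0 i).integrable (by norm_num)]
  have hle : ∀ i, (∫ ω, ξ i ω ^ 2 ∂μ) - (1 + 1 / (4 * δ)) * ∫ ω, |ξ i ω| ^ 3 ∂μ
      ≤ ∫ ω, |trunc (ξ i ω)| * min |trunc (ξ i ω)| δ ∂μ := by
    intro i
    rw [← integral_const_mul, ← integral_sub (h.integrable_sq i)
      ((h.integrable_cube i).const_mul _)]
    refine integral_mono ((h.integrable_sq i).sub ((h.integrable_cube i).const_mul _))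
      ((h.memLp_smallTerm hδ0 i).integrable (by norm_num)) fun ω => ?_
    refine le_trans (le_of_eq ?_) (abs_mul_min_ge hδ0 (ξ i ω))
    simp only; ring
  have hs := Finset.sum_le_sum fun i (_ : i ∈ Finset.univ) => hle i
  rw [Finset.sum_sub_distrib, h.var, ← Finset.mul_sum] at hs
  refine le_trans ?_ hs
  have h1 : (1 + 1 / (4 * δ)) * lyapunov ξ μ ≤ (1 + 1 / (4 * δ)) * δ := by gcongr
  have h2 : (1 + 1 / (4 * δ)) * δ = δ + 1 / 4 := by field_simp
  unfold lyapunov at h1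
  linarith

/-- Each independent term is at most `δ |ξ_i|`. The cap `δ` in one of its two factors is there to
make the fluctuations of the sum of order `δ`. -/
lemma integral_smallSum_sub_sq_le (h : IsStdSum ξ μ) {δ : ℝ} (hδ : 0 < δ) :
    ∫ ω, (smallSum ξ δ ω - ∫ ω', smallSum ξ δ ω' ∂μ) ^ 2 ∂μ ≤ δ ^ 2 := by
  have := h.isProbabilityMeasure
  have e : smallSum ξ δ = ∑ i, fun ω => |trunc (ξ i ω)| * min |trunc (ξ i ω)| δ := by
    ext ω; simp [smallSum]
  rw [← variance_eq_integral (h.measurable_smallSum δ).aemeasurable, e,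
    IndepFun.variance_sum fun i _ => h.memLp_smallTerm hδ i]
  · have hle : ∀ i, Var[fun ω => |trunc (ξ i ω)| * min |trunc (ξ i ω)| δ; μ]
        ≤ δ ^ 2 * ∫ ω, ξ i ω ^ 2 ∂μ := by
      intro i
      refine (variance_le_expectation_sq
        (h.memLp_smallTerm hδ i).aestronglyMeasurable).trans ?_
      rw [← integral_const_mul]
      refine integral_mono (h.memLp_smallTerm hδ i).integrable_sq
        ((h.integrable_sq i).const_mul _) fun ω => ?_
      simp only [Pi.pow_apply]
      rw [mul_pow, sq_abs, mul_comm (δ ^ 2)]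
      exact mul_le_mul (sq_le_sq.2 (abs_trunc_le _))
        (pow_le_pow_left₀ (le_min (abs_nonneg _) hδ.le) (min_le_right _ _) 2)
        (by positivity) (sq_nonneg _)
    refine (Finset.sum_le_sum fun i _ => hle i).trans_eq ?_
    rw [← Finset.mul_sum, h.var, mul_one]
  · intro i _ j _ hij
    exact (h.indep.indepFun hij).comp (φ := fun s => |trunc s| * min |trunc s| δ)
      (ψ := fun s => |trunc s| * min |trunc s| δ) (by fun_prop) (by fun_prop)

/-- The exponentially tilted randomized concentration inequality for the truncated sum. -/
theorem tilted_concentration (h : IsStdSum ξ μ) {δ : ℝ} (hδ0 : 0 < δ)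
    (hδ : lyapunov ξ μ ≤ δ) (hδ4 : δ ≤ 1 / 4) {Δ : Ω → ℝ} {Δ' : ι → Ω → ℝ}
    (mΔ : Measurable Δ) (mΔ' : ∀ i, Measurable (Δ' i)) (hΔ : MemLp Δ 2 μ)
    (hΔ' : ∀ i, MemLp (Δ' i) 2 μ)
    (hind : ∀ i, IndepFun (ξ i) (fun ω => (truncSum ξ ω - trunc (ξ i ω), Δ' i ω)) μ) (x : ℝ) :
    ∫ ω, {ω | |truncSum ξ ω - x| ≤ |Δ ω|}.indicator
        (fun ω => Real.exp (truncSum ξ ω / 2)) ω ∂μ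
      ≤ 14 * Real.exp 1 * (√(∫ ω, Δ ω ^ 2 ∂μ)
        + ∑ i, √(∫ ω, ξ i ω ^ 2 ∂μ) * √(∫ ω, (Δ ω - Δ' i ω) ^ 2 ∂μ) + δ) := by
  have := h.isProbabilityMeasure
  set S := truncSum ξ with hS
  set Y := smallSum ξ δ with hY
  set EY := ∫ ω, Y ω ∂μ with hEY
  set A : Set Ω := {ω | |S ω - x| ≤ |Δ ω|} with hA
  set I : Ω → ℝ := A.indicator fun ω => Real.exp (S ω / 2) with hI
  obtain ⟨N, bS⟩ : ∃ N : ℝ, ∀ ω, S ω ≤ N := ⟨_, truncSum_le_card ξ⟩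
  have mS : Measurable S := h.measurable_truncSum
  have mY : Measurable Y := h.measurable_smallSum δ
  have mA : MeasurableSet A := measurableSet_le (by fun_prop) (by fun_prop)
  have mI : Measurable I := (mS.div_const 2).exp.indicator mA
  have bSi : ∀ i ω, S ω - trunc (ξ i ω) ≤ N + 1 := fun i ω => by
    linarith [bS ω, (abs_le.1 (abs_trunc_le_one (ξ i ω))).1]
  have mSi : ∀ i, Measurable fun ω => S ω - trunc (ξ i ω) := fun i => by
    have := h.meas i; fun_prop
  have I0 : ∀ ω, 0 ≤ I ω := fun ω => Set.indicator_nonneg (fun _ _ => (Real.exp_pos _).le) ω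
  have Ile : ∀ ω, I ω ≤ Real.exp (S ω / 2) := fun ω =>
    Set.indicator_le_self' (fun _ _ => (Real.exp_pos _).le) ω
  have E2 : ∀ T : Ω → ℝ, ∀ c, Measurable T → (∀ ω, T ω ≤ c) →
      MemLp (fun ω => Real.exp (T ω / 2)) 2 μ := by
    intro T c mT hT
    refine MemLp.of_bound (by fun_prop : Measurable _).aestronglyMeasurable (Real.exp (c / 2))
      (Filter.Eventually.of_forall fun ω => ?_)
    rw [Real.norm_of_nonneg (Real.exp_pos _).le]
    exact Real.exp_le_exp.2 (by linarith [hT ω])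
  have LS := E2 S N mS bS
  have sqE : ∀ t : ℝ, Real.exp (t / 2) ^ 2 = Real.exp t := fun t => by
    rw [← Real.exp_nat_mul]; congr 1; push_cast; ring
  have LI : MemLp I 2 μ := LS.mono' mI.aestronglyMeasurable
    (Filter.Eventually.of_forall fun ω => by rw [Real.norm_of_nonneg (I0 ω)]; exact Ile ω)
  have LY : MemLp Y 2 μ := by
    have := memLp_finsetSum Finset.univ fun i (_ : i ∈ Finset.univ) => h.memLp_smallTerm hδ0 i
    exact this
  have LYc : MemLp (fun ω => Y ω - EY) 2 μ := LY.sub (memLp_const EY)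
  have Lf : MemLp (fun ω => tiltClip x δ |Δ ω| (S ω)) 2 μ := memLp_tiltClip hδ0.le mS bS mΔ hΔ
  have Lfi : ∀ i, MemLp (fun ω => tiltClip x δ |Δ ω| (S ω - trunc (ξ i ω))) 2 μ := fun i =>
    memLp_tiltClip hδ0.le (mSi i) (bSi i) mΔ hΔ
  have Lgi : ∀ i, MemLp (fun ω => tiltClip x δ |Δ' i ω| (S ω - trunc (ξ i ω))) 2 μ := fun i =>
    memLp_tiltClip hδ0.le (mSi i) (bSi i) (mΔ' i) (hΔ' i)
  -- Replacing `Y` by its mean costs at most `𝔼 e^{S/2} |Y - EY| ≤ e δ`, by Cauchy–Schwarz and `𝔼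
  -- e^S ≤ e²`.
  have step1 : EY * ∫ ω, I ω ∂μ ≤ ∫ ω, I ω * Y ω ∂μ + Real.exp 1 * δ := by
    have e : ∀ ω, EY * I ω = I ω * Y ω - I ω * (Y ω - EY) := fun ω => by ring
    rw [← integral_const_mul]
    simp only [e]
    rw [integral_sub (integrable_fun_mul LI LY) (integrable_fun_mul LI LYc)]
    have h1 : -∫ ω, I ω * (Y ω - EY) ∂μ ≤ ∫ ω, |Real.exp (S ω / 2) * (Y ω - EY)| ∂μ := by
      rw [← integral_neg]
      refine integral_mono (integrable_fun_mul LI LYc).neg (integrable_fun_mul LS LYc).abs fun ω => ?_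
      refine (neg_le_abs _).trans ?_
      rw [abs_mul, abs_mul, abs_of_nonneg (I0 ω), abs_of_pos (Real.exp_pos _)]
      exact mul_le_mul_of_nonneg_right (Ile ω) (abs_nonneg _)
    have h2 := integral_abs_mul_le_sqrt LS LYc
    have h3 : √(∫ ω, Real.exp (S ω / 2) ^ 2 ∂μ) ≤ Real.exp 1 := by
      simp only [sqE]
      rw [Real.sqrt_le_left (Real.exp_pos _).le, ← Real.exp_nat_mul]
      simpa using h.integral_exp_truncSum_le
    have h4 : √(∫ ω, (Y ω - EY) ^ 2 ∂μ) ≤ δ := by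
      rw [Real.sqrt_le_left hδ0.le]
      exact h.integral_smallSum_sub_sq_le hδ0
    have h5 := mul_le_mul h3 h4 (Real.sqrt_nonneg _) (Real.exp_pos _).le
    linarith
  have ptw : ∀ ω, I ω * Y ω ≤ ∑ i, ξ i ω *
      (tiltClip x δ |Δ ω| (S ω) - tiltClip x δ |Δ ω| (S ω - trunc (ξ i ω))) := by
    intro ω
    by_cases hω : ω ∈ A
    · rw [hI, Set.indicator_of_mem hω, hY, smallSum, Finset.mul_sum]
      exact Finset.sum_le_sum fun i _ => mul_tiltClip_sub_ge hδ0.le hω _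
    · rw [hI, Set.indicator_of_notMem hω, zero_mul]
      exact Finset.sum_nonneg fun i _ => mul_tiltClip_sub_nonneg hδ0.le (abs_nonneg _) _ _
  -- Here `ξ_i` is independent of the test function built from `Δ' i` and `S - trunc ξ_i`, and it is
  -- centred.
  have zero : ∀ i, ∫ ω, ξ i ω * tiltClip x δ |Δ' i ω| (S ω - trunc (ξ i ω)) ∂μ = 0 := by
    intro i
    have hi := (hind i).comp (φ := id) (ψ := fun q : ℝ × ℝ => tiltClip x δ |q.2| q.1)
      measurable_id ((continuous_tiltClip x δ).measurable.comp
        (measurable_snd.abs.prodMk measurable_fst))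
    have := hi.integral_fun_mul_eq_mul_integral (h.integrable i).aestronglyMeasurable
      (Lgi i).aestronglyMeasurable
    simp only [Function.comp_def, id] at this
    rw [this, h.mean, zero_mul]
  -- Subtracting the vanishing integral leaves the difference of the test functions at `Δ` and `Δ'
  -- i`. In the Cauchy–Schwarz bound `ξ_i²` and `e^{S - trunc ξ_i}` are independent, so their means
  -- factor.
  have swap : ∀ i, -∫ ω, ξ i ω * tiltClip x δ |Δ ω| (S ω - trunc (ξ i ω)) ∂μ
      ≤ 2 * Real.exp 1 * (√(∫ ω, ξ i ω ^ 2 ∂μ) * √(∫ ω, (Δ ω - Δ' i ω) ^ 2 ∂μ)) := by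
    intro i
    have LΔ : MemLp (fun ω => Δ ω - Δ' i ω) 2 μ := hΔ.sub (hΔ' i)
    have hi := (hind i).comp (φ := fun s => s ^ 2) (ψ := fun q : ℝ × ℝ => Real.exp q.1)
      (by fun_prop) (by fun_prop)
    have bexp : ∀ ω, Real.exp ((S ω - trunc (ξ i ω)) / 2) ≤ Real.exp ((N + 1) / 2) := fun ω =>
      Real.exp_le_exp.2 (by linarith [bSi i ω])
    have Lp : MemLp (fun ω => ξ i ω * Real.exp ((S ω - trunc (ξ i ω)) / 2)) 2 μ := by
      refine ((h.memLp_two i).const_mul (Real.exp ((N + 1) / 2))).mono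
        (by have := h.meas i; fun_prop : Measurable _).aestronglyMeasurable
        (Filter.Eventually.of_forall fun ω => ?_)
      rw [norm_mul, norm_mul, Real.norm_of_nonneg (Real.exp_pos _).le,
        Real.norm_of_nonneg (Real.exp_pos _).le, mul_comm]
      exact mul_le_mul_of_nonneg_right (bexp ω) (norm_nonneg _)
    have hsq : √(∫ ω, (ξ i ω * Real.exp ((S ω - trunc (ξ i ω)) / 2)) ^ 2 ∂μ)
        ≤ √(∫ ω, ξ i ω ^ 2 ∂μ) * Real.exp 1 := by
      simp only [mul_pow, sqE]
      have := hi.integral_fun_mul_eq_mul_integral (h.integrable_sq i).aestronglyMeasurable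
        (by exact (mSi i).exp.aestronglyMeasurable)
      simp only [Function.comp_def] at this
      rw [this, Real.sqrt_mul (by positivity)]
      refine mul_le_mul_of_nonneg_left ?_ (Real.sqrt_nonneg _)
      rw [Real.sqrt_le_left (Real.exp_pos _).le, ← Real.exp_nat_mul]
      simpa using h.integral_exp_truncSum_sub_le i
    calc -∫ ω, ξ i ω * tiltClip x δ |Δ ω| (S ω - trunc (ξ i ω)) ∂μ
        = ∫ ω, ξ i ω * (tiltClip x δ |Δ' i ω| (S ω - trunc (ξ i ω))
            - tiltClip x δ |Δ ω| (S ω - trunc (ξ i ω))) ∂μ := by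
          simp only [mul_sub]
          rw [integral_sub (integrable_fun_mul (h.memLp_two i) (Lgi i))
            (integrable_fun_mul (h.memLp_two i) (Lfi i)), zero, zero_sub]
      _ ≤ ∫ ω, 2 * |ξ i ω * Real.exp ((S ω - trunc (ξ i ω)) / 2) * (Δ ω - Δ' i ω)| ∂μ := by
          refine integral_mono (integrable_fun_mul (h.memLp_two i) ((Lgi i).sub (Lfi i)))
            ((integrable_fun_mul Lp LΔ).abs.const_mul 2) fun ω => ?_
          refine (le_abs_self _).trans ?_
          have h1 := abs_tiltClip_sub_le x δ |Δ' i ω| |Δ ω| (S ω - trunc (ξ i ω))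
          have h2 : |(|Δ' i ω| - |Δ ω|)| ≤ |Δ ω - Δ' i ω| := by
            rw [abs_sub_comm (Δ ω)]; exact abs_abs_sub_abs_le_abs_sub _ _
          simp only [abs_mul, abs_of_pos (Real.exp_pos _)]
          have h3 : Real.exp ((S ω - trunc (ξ i ω)) / 2) * (2 * |(|Δ' i ω| - |Δ ω|)|)
              ≤ Real.exp ((S ω - trunc (ξ i ω)) / 2) * (2 * |Δ ω - Δ' i ω|) := by gcongr
          have h4 := mul_le_mul_of_nonneg_left (h1.trans h3) (abs_nonneg (ξ i ω))
          linarith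
      _ ≤ 2 * ((√(∫ ω, ξ i ω ^ 2 ∂μ) * Real.exp 1) * √(∫ ω, (Δ ω - Δ' i ω) ^ 2 ∂μ)) := by
          rw [integral_const_mul]
          refine mul_le_mul_of_nonneg_left ?_ zero_le_two
          exact (integral_abs_mul_le_sqrt Lp LΔ).trans
            (mul_le_mul_of_nonneg_right hsq (Real.sqrt_nonneg _))
      _ = _ := by ring
  have LW : MemLp (fun ω => ∑ i, ξ i ω) 2 μ :=
    memLp_finsetSum Finset.univ fun i _ => h.memLp_two i
  have main : ∫ ω, (∑ i, ξ i ω) * tiltClip x δ |Δ ω| (S ω) ∂μ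
      ≤ 6 * Real.exp 1 * (√(∫ ω, Δ ω ^ 2 ∂μ) + δ) := by
    have mW : Measurable fun ω => ∑ i, ξ i ω := Finset.measurable_fun_sum _ fun i _ => h.meas i
    have LWS : MemLp (fun ω => (∑ i, ξ i ω) * Real.exp (S ω / 2)) 2 μ := by
      refine (LW.const_mul (Real.exp (N / 2))).mono
        (by fun_prop : Measurable _).aestronglyMeasurable
        (Filter.Eventually.of_forall fun ω => ?_)
      rw [norm_mul, norm_mul, Real.norm_of_nonneg (Real.exp_pos _).le,
        Real.norm_of_nonneg (Real.exp_pos _).le, mul_comm]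
      exact mul_le_mul_of_nonneg_right (Real.exp_le_exp.2 (by linarith [bS ω])) (norm_nonneg _)
    -- The second moment is at most `7 e² ≤ (3e)²`.
    have hsq : √(∫ ω, ((∑ i, ξ i ω) * Real.exp (S ω / 2)) ^ 2 ∂μ) ≤ 3 * Real.exp 1 := by
      simp only [mul_pow, sqE]
      rw [Real.sqrt_le_left (by positivity)]
      refine h.integral_sum_sq_mul_exp_truncSum_le.trans ?_
      rw [mul_pow, ← Real.exp_nat_mul]
      norm_num [Real.exp_pos]
    have iL := integrable_fun_mul LWS hΔ
    have i1 : Integrable (fun ω => (∑ i, ξ i ω) * Real.exp (S ω / 2)) μ :=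
      LWS.integrable (by norm_num)
    calc ∫ ω, (∑ i, ξ i ω) * tiltClip x δ |Δ ω| (S ω) ∂μ
        ≤ ∫ ω, (2 * |(∑ i, ξ i ω) * Real.exp (S ω / 2) * Δ ω|
            + 2 * δ * |(∑ i, ξ i ω) * Real.exp (S ω / 2)|) ∂μ := by
          refine integral_mono (integrable_fun_mul LW Lf)
            ((iL.abs.const_mul 2).add (i1.abs.const_mul (2 * δ))) fun ω => ?_
          refine (le_abs_self _).trans ?_
          simp only [abs_mul, abs_of_pos (Real.exp_pos _)]
          rw [abs_of_nonneg (tiltClip_nonneg hδ0.le (abs_nonneg _))]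
          have := mul_le_mul_of_nonneg_left (tiltClip_le x δ |Δ ω| (S ω))
            (abs_nonneg (∑ i, ξ i ω))
          linarith
      _ ≤ 2 * (3 * Real.exp 1 * √(∫ ω, Δ ω ^ 2 ∂μ)) + 2 * δ * (3 * Real.exp 1) := by
          rw [integral_add (iL.abs.const_mul 2) (i1.abs.const_mul (2 * δ)), integral_const_mul,
            integral_const_mul]
          gcongr
          · exact (integral_abs_mul_le_sqrt LWS hΔ).trans
              (mul_le_mul_of_nonneg_right hsq (Real.sqrt_nonneg _))
          · exact (integral_abs_le_sqrt LWS).trans hsq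
      _ = _ := by ring
  have step2 : ∫ ω, I ω * Y ω ∂μ ≤ 6 * Real.exp 1 * (√(∫ ω, Δ ω ^ 2 ∂μ) + δ)
      + 2 * Real.exp 1 * ∑ i, √(∫ ω, ξ i ω ^ 2 ∂μ) * √(∫ ω, (Δ ω - Δ' i ω) ^ 2 ∂μ) := by
    have ii : ∀ i, Integrable (fun ω => ξ i ω *
        (tiltClip x δ |Δ ω| (S ω) - tiltClip x δ |Δ ω| (S ω - trunc (ξ i ω)))) μ := fun i =>
      integrable_fun_mul (h.memLp_two i) (Lf.sub (Lfi i))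
    have e : ∑ i, ∫ ω, ξ i ω * tiltClip x δ |Δ ω| (S ω) ∂μ
        = ∫ ω, (∑ i, ξ i ω) * tiltClip x δ |Δ ω| (S ω) ∂μ := by
      rw [← integral_finsetSum _ fun i _ => integrable_fun_mul (h.memLp_two i) Lf]
      simp only [Finset.sum_mul]
    calc ∫ ω, I ω * Y ω ∂μ ≤ ∫ ω, ∑ i, ξ i ω *
        (tiltClip x δ |Δ ω| (S ω) - tiltClip x δ |Δ ω| (S ω - trunc (ξ i ω))) ∂μ :=
          integral_mono (integrable_fun_mul LI LY) (integrable_finsetSum _ fun i _ => ii i) ptw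
      _ = ∑ i, (∫ ω, ξ i ω * tiltClip x δ |Δ ω| (S ω) ∂μ
            + -∫ ω, ξ i ω * tiltClip x δ |Δ ω| (S ω - trunc (ξ i ω)) ∂μ) := by
          rw [integral_finsetSum _ fun i _ => ii i]
          refine Finset.sum_congr rfl fun i _ => ?_
          simp only [mul_sub]
          rw [integral_sub (integrable_fun_mul (h.memLp_two i) Lf)
            (integrable_fun_mul (h.memLp_two i) (Lfi i)), sub_eq_add_neg]
      _ ≤ _ := by
          rw [Finset.sum_add_distrib, e, Finset.mul_sum]
          exact add_le_add main (Finset.sum_le_sum fun i _ => swap i)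
  -- Dividing by `EY ≥ 1/2` doubles the constants: `12` at `‖Δ‖₂`, `4` at the sum, and `2 (6 + 1) =
  -- 14` at `δ`, each with the factor `e`.
  have hEY2 := h.half_le_integral_smallSum hδ0 hδ hδ4
  have hI0 : 0 ≤ ∫ ω, I ω ∂μ := integral_nonneg I0
  have h6 : 1 / 2 * ∫ ω, I ω ∂μ ≤ EY * ∫ ω, I ω ∂μ := mul_le_mul_of_nonneg_right hEY2 hI0
  have h7 : 0 ≤ Real.exp 1 * √(∫ ω, Δ ω ^ 2 ∂μ) := by positivity
  have h8 : 0 ≤ Real.exp 1 *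
      ∑ i, √(∫ ω, ξ i ω ^ 2 ∂μ) * √(∫ ω, (Δ ω - Δ' i ω) ^ 2 ∂μ) := by positivity
  linarith

end IsStdSum

end BerryEsseen

namespace BerryEsseen

/-! ### Non-uniform and uniform concentration of the untruncated sum. -/

lemma measureReal_le_integral {Ω : Type*} [MeasurableSpace Ω] {μ : Measure Ω}
    [IsFiniteMeasure μ] {A : Set Ω} {f : Ω → ℝ}
    (mA : MeasurableSet A) (hf : Integrable f μ) (f0 : ∀ ω, 0 ≤ f ω) (fA : ∀ ω ∈ A, 1 ≤ f ω) :
    μ.real A ≤ ∫ ω, f ω ∂μ := by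
  rw [← integral_indicator_one mA]
  refine integral_mono ((integrable_const 1).indicator mA) hf fun ω => ?_
  by_cases h : ω ∈ A
  · simpa [h] using fA ω h
  · simpa [h] using f0 ω

lemma truncSum_neg {Ω ι : Type*} [Fintype ι] (ξ : ι → Ω → ℝ) (ω : Ω) :
    truncSum (fun i ω => -ξ i ω) ω = -truncSum ξ ω := by
  simp [truncSum, trunc_neg]

variable {Ω ι : Type*} [MeasurableSpace Ω] [Fintype ι] {μ : Measure Ω} {ξ : ι → Ω → ℝ}

namespace IsStdSum

lemma measurable_sum (h : IsStdSum ξ μ) : Measurable fun ω => ∑ i, ξ i ω :=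
  Finset.measurable_fun_sum _ fun i _ => h.meas i

lemma lyapunov_eq_integral (h : IsStdSum ξ μ) :
    ∫ ω, ∑ i, |ξ i ω| ^ 3 ∂μ = lyapunov ξ μ := by
  rw [integral_finsetSum _ fun i _ => h.integrable_cube i, lyapunov]

/-- The non-uniform randomized concentration inequality, effective for positive `x`. -/
lemma one_sided_concentration (h : IsStdSum ξ μ) {δ : ℝ} (hδ0 : 0 < δ)
    (hδ : lyapunov ξ μ ≤ δ) (hδ4 : δ ≤ 1 / 4) {Δ : Ω → ℝ} {Δ' : ι → Ω → ℝ}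
    (mΔ : Measurable Δ) (mΔ' : ∀ i, Measurable (Δ' i)) (hΔ : MemLp Δ 2 μ)
    (hΔ' : ∀ i, MemLp (Δ' i) 2 μ)
    (hind : ∀ i, IndepFun (ξ i) (fun ω => (truncSum ξ ω - trunc (ξ i ω), Δ' i ω)) μ)
    (x : ℝ) :
    μ.real {ω | |∑ i, ξ i ω - x| ≤ |Δ ω| ∧ |Δ ω| ≤ (x + 1) / 3}
      ≤ δ + 14 * Real.exp 2 * Real.exp (-x / 3) * (√(∫ ω, Δ ω ^ 2 ∂μ)
        + ∑ i, √(∫ ω, ξ i ω ^ 2 ∂μ) * √(∫ ω, (Δ ω - Δ' i ω) ^ 2 ∂μ) + δ) := by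
  have := h.isProbabilityMeasure
  have mW := h.measurable_sum
  have mS := h.measurable_truncSum
  set I : Ω → ℝ := {ω | |truncSum ξ ω - x| ≤ |Δ ω|}.indicator
    (fun ω => Real.exp (truncSum ξ ω / 2)) with hI
  have I0 : ∀ ω, 0 ≤ I ω := fun ω => Set.indicator_nonneg (fun _ _ => (Real.exp_pos _).le) ω
  have iI : Integrable I μ := by
    refine Integrable.of_bound (C := Real.exp (Fintype.card ι / 2))
      ((mS.div_const 2).exp.indicator
        (measurableSet_le (by fun_prop) (by fun_prop))).aestronglyMeasurable
      (Filter.Eventually.of_forall fun ω => ?_)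
    rw [Real.norm_of_nonneg (I0 ω)]
    exact (Set.indicator_le_self' (fun _ _ => (Real.exp_pos _).le) ω).trans
      (Real.exp_le_exp.2 (by linarith [truncSum_le_card ξ ω]))
  have ic : Integrable (fun ω => ∑ i, |ξ i ω| ^ 3) μ :=
    integrable_finsetSum _ fun i _ => h.integrable_cube i
  have key := h.tilted_concentration hδ0 hδ hδ4 mΔ mΔ' hΔ hΔ' hind x
  -- The indicator of the event is dominated in two cases. If some `|ξ_i| > 1`, the cubes already
  -- sum to at least one. Otherwise the truncated sum is the sum itself and the tilted indicator
  -- takes over.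
  refine (measureReal_le_integral (f := fun ω => ∑ i, |ξ i ω| ^ 3
    + Real.exp (1 + -x / 3) * I ω) ?_ (ic.add (iI.const_mul _)) ?_ ?_).trans ?_
  · have m1 : MeasurableSet {ω | |∑ i, ξ i ω - x| ≤ |Δ ω|} :=
      measurableSet_le (by fun_prop) (by fun_prop)
    have m2 : MeasurableSet {ω | |Δ ω| ≤ (x + 1) / 3} :=
      measurableSet_le (by fun_prop) (by fun_prop)
    exact m1.inter m2
  · intro ω
    have := I0 ω
    positivity
  · rintro ω ⟨h1, h2⟩
    by_cases hb : ∀ i, |ξ i ω| ≤ 1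
    · have e : truncSum ξ ω = ∑ i, ξ i ω :=
        Finset.sum_congr rfl fun i _ => trunc_of_le (hb i)
      have hmem : ω ∈ {ω | |truncSum ξ ω - x| ≤ |Δ ω|} := by
        simpa [e] using h1
      rw [hI, Set.indicator_of_mem hmem, ← Real.exp_add]
      -- On the event `W ≥ x - (x + 1) / 3`, so the exponent is at least `1 - 1/6`.
      have h3 : 0 ≤ 1 + -x / 3 + truncSum ξ ω / 2 := by
        rw [e]; linarith [(abs_le.1 h1).1]
      have h4 : 0 ≤ ∑ i, |ξ i ω| ^ 3 := by positivity
      linarith [Real.one_le_exp h3]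
    · push Not at hb
      obtain ⟨i, hi⟩ := hb
      have h3 : |ξ i ω| ^ 3 ≤ ∑ i, |ξ i ω| ^ 3 :=
        Finset.single_le_sum (f := fun i => |ξ i ω| ^ 3) (fun _ _ => by positivity)
          (Finset.mem_univ i)
      have h4 : 1 ≤ |ξ i ω| ^ 3 := one_le_pow₀ hi.le
      have h5 : 0 ≤ Real.exp (1 + -x / 3) * I ω := mul_nonneg (Real.exp_pos _).le (I0 ω)
      linarith
  · rw [integral_add ic (iI.const_mul _), integral_const_mul, h.lyapunov_eq_integral]
    have e : Real.exp (1 + -x / 3) * (14 * Real.exp 1) = 14 * Real.exp 2 * Real.exp (-x / 3) := by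
      rw [show (2 : ℝ) = 1 + 1 by norm_num, Real.exp_add 1 1, Real.exp_add]; ring
    rw [← e, mul_assoc (Real.exp (1 + -x / 3))]
    exact add_le_add hδ (mul_le_mul_of_nonneg_left key (Real.exp_pos _).le)

/-- The non-uniform randomized concentration inequality. -/
theorem concentration (h : IsStdSum ξ μ) {δ : ℝ} (hδ0 : 0 < δ)
    (hδ : lyapunov ξ μ ≤ δ) (hδ4 : δ ≤ 1 / 4) {Δ : Ω → ℝ} {Δ' : ι → Ω → ℝ}
    (mΔ : Measurable Δ) (mΔ' : ∀ i, Measurable (Δ' i)) (hΔ : MemLp Δ 2 μ)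
    (hΔ' : ∀ i, MemLp (Δ' i) 2 μ)
    (hind : ∀ i, IndepFun (ξ i) (fun ω => (truncSum ξ ω - trunc (ξ i ω), Δ' i ω)) μ) (x : ℝ) :
    μ.real {ω | |∑ i, ξ i ω - x| ≤ |Δ ω| ∧ |Δ ω| ≤ (|x| + 1) / 3}
      ≤ δ + 14 * Real.exp 2 * Real.exp (-|x| / 3) * (√(∫ ω, Δ ω ^ 2 ∂μ)
        + ∑ i, √(∫ ω, ξ i ω ^ 2 ∂μ) * √(∫ ω, (Δ ω - Δ' i ω) ^ 2 ∂μ) + δ) := by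
  rcases le_total 0 x with hx | hx
  · rw [abs_of_nonneg hx]
    exact h.one_sided_concentration hδ0 hδ hδ4 mΔ mΔ' hΔ hΔ' hind x
  · rw [abs_of_nonpos hx]
    -- Reflection: the sum changes sign, while `Δ` enters only through absolute values and squares
    -- and can be kept.
    have key := h.neg.one_sided_concentration hδ0 (by rwa [lyapunov_neg]) hδ4 mΔ mΔ' hΔ hΔ'
      (fun i => by
        have := (hind i).comp (φ := fun s => -s) (ψ := fun q : ℝ × ℝ => (-q.1, q.2))
          measurable_neg (by fun_prop)
        refine this.congr (Filter.EventuallyEq.rfl) (Filter.Eventually.of_forall fun ω => ?_)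
        simp only [Function.comp_def, truncSum_neg, trunc_neg]
        congr 1; ring) (-x)
    simp only [neg_sq] at key
    convert key using 6 with ω
    rw [← abs_neg, Finset.sum_neg_distrib, neg_sub, sub_eq_add_neg, add_comm, neg_add_eq_sub,
      sub_neg_eq_add, neg_add_eq_sub]

/-- A summand is independent of any function of the other summands. -/
lemma indepFun_comp_of_not_dep [DecidableEq ι] (h : IsStdSum ξ μ) (i : ι) {α : Type*}
    [MeasurableSpace α] {F : ({j // j ∈ Finset.univ.erase i} → ℝ) → α} (hF : Measurable F) :
    IndepFun (ξ i) (fun ω => F fun j => ξ j ω) μ := by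
  have := h.indep.indepFun_finset {i} (Finset.univ.erase i) (by simp) h.meas
  have m : Measurable fun q : {j // j ∈ ({i} : Finset ι)} → ℝ =>
      q ⟨i, Finset.mem_singleton_self i⟩ := measurable_pi_apply _
  exact this.comp m hF

lemma indepFun_truncSum_sub (h : IsStdSum ξ μ) (i : ι) (c : ℝ) :
    IndepFun (ξ i) (fun ω => (truncSum ξ ω - trunc (ξ i ω), c)) μ := by
  classical
  have := h.indepFun_comp_of_not_dep i (F := fun q => (∑ j, trunc (q j), c)) (by fun_prop)
  refine this.congr (Filter.EventuallyEq.rfl) (Filter.Eventually.of_forall fun ω => ?_)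
  simp only [truncSum]
  rw [← Finset.add_sum_erase _ _ (Finset.mem_univ i), add_sub_cancel_left,
    Finset.sum_coe_sort (Finset.univ.erase i) fun j => trunc (ξ j ω)]

lemma indepFun_sum_sub (h : IsStdSum ξ μ) (i : ι) :
    IndepFun (ξ i) (fun ω => ∑ j, ξ j ω - ξ i ω) μ := by
  classical
  have := h.indepFun_comp_of_not_dep i (F := fun q => ∑ j, q j) (by fun_prop)
  refine this.congr (Filter.EventuallyEq.rfl) (Filter.Eventually.of_forall fun ω => ?_)
  simp only
  rw [← Finset.add_sum_erase _ _ (Finset.mem_univ i), add_sub_cancel_left,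
    Finset.sum_coe_sort (Finset.univ.erase i) fun j => ξ j ω]

lemma exp_two_le : Real.exp 2 ≤ 15 / 2 := by
  have h := Real.exp_one_lt_d9
  have : Real.exp 2 = Real.exp 1 ^ 2 := by rw [← Real.exp_nat_mul]; norm_num
  rw [this]
  nlinarith [Real.exp_pos 1]

/-- The uniform concentration inequality. -/
theorem uniform_concentration (h : IsStdSum ξ μ) {δ : ℝ} (hδ0 : 0 < δ)
    (hδ : lyapunov ξ μ ≤ δ) (x : ℝ) {d : ℝ} (hd : 0 ≤ d) :
    μ.real {ω | |∑ i, ξ i ω - x| ≤ d} ≤ 110 * (d + δ) := by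
  have := h.isProbabilityMeasure
  -- For `δ > 1/4` or `d > 1/3` the right side exceeds one. Otherwise `d ≤ (|x| + 1) / 3` holds
  -- automatically, and with constant `Δ = Δ' i = d` the exchange terms vanish.
  by_cases hδ4 : δ ≤ 1 / 4
  swap
  · exact measureReal_le_one.trans (by linarith [not_le.1 hδ4])
  by_cases hd3 : d ≤ 1 / 3
  swap
  · exact measureReal_le_one.trans (by linarith [not_le.1 hd3])
  have key := h.concentration hδ0 hδ hδ4 (Δ := fun _ => d) (Δ' := fun _ _ => d)
    measurable_const (fun _ => measurable_const) (memLp_const d) (fun _ => memLp_const d)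
    (fun i => h.indepFun_truncSum_sub i d) x
  have e : {ω | |∑ i, ξ i ω - x| ≤ d}
      = {ω | |∑ i, ξ i ω - x| ≤ |d| ∧ |d| ≤ (|x| + 1) / 3} := by
    ext ω
    have : d ≤ (|x| + 1) / 3 := by linarith [abs_nonneg x]
    simp [abs_of_nonneg hd, this]
  rw [e]
  refine key.trans ?_
  simp only [sub_self, integral_const, probReal_univ, smul_eq_mul, one_mul, ne_eq,
    OfNat.ofNat_ne_zero, not_false_eq_true, zero_pow, Real.sqrt_zero, mul_zero,
    Finset.sum_const_zero, add_zero, Real.sqrt_sq hd]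
  have h1 : Real.exp (-|x| / 3) ≤ 1 := Real.exp_le_one_iff.2 (by linarith [abs_nonneg x])
  have h2 : 14 * Real.exp 2 * Real.exp (-|x| / 3) ≤ 105 := by
    nlinarith [exp_two_le, Real.exp_pos 2, Real.exp_pos (-|x| / 3)]
  nlinarith

/-- The uniform concentration inequality for the sum with one summand removed. -/
theorem uniform_concentration_sub (h : IsStdSum ξ μ) {δ : ℝ} (hδ0 : 0 < δ)
    (hδ : lyapunov ξ μ ≤ δ) {i : ι} (hi : ∫ ω, |ξ i ω| ∂μ ≤ δ) (x : ℝ) {d : ℝ} (hd : 0 ≤ d) :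
    μ.real {ω | |∑ j, ξ j ω - ξ i ω - x| ≤ d} ≤ 660 * (d + δ) := by
  have := h.isProbabilityMeasure
  have mξ := h.meas i
  have mW := h.measurable_sum
  -- By Markov's inequality `|ξ_i| ≤ 2δ` has probability at least `1/2`, and it is independent of `W
  -- - ξ_i`. Hence the probability sought is at most twice `P(|W - x| ≤ d + 2δ)`, that is at most
  -- `220 (d + 3δ)`.
  have hm : μ.real {ω | 2 * δ < |ξ i ω|} ≤ 1 / 2 := by
    refine (measureReal_le_integral (f := fun ω => (2 * δ)⁻¹ * |ξ i ω|)
      (measurableSet_lt (by fun_prop) (by fun_prop)) ((h.integrable i).abs.const_mul _)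
      (fun ω => by positivity) fun ω hω => ?_).trans ?_
    · rw [← div_eq_inv_mul, one_le_div (by positivity)]
      exact le_of_lt hω
    · rw [integral_const_mul, inv_mul_le_iff₀ (by positivity)]
      linarith
  have hc : 1 / 2 ≤ μ.real {ω | |ξ i ω| ≤ 2 * δ} := by
    have e : {ω | |ξ i ω| ≤ 2 * δ} = {ω | 2 * δ < |ξ i ω|}ᶜ := by ext; simp
    rw [e, probReal_compl_eq_one_sub (measurableSet_lt (by fun_prop) (by fun_prop))]
    linarith
  have hprod := (h.indepFun_sum_sub i).measure_inter_preimage_eq_mul {s | |s| ≤ 2 * δ}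
    {w | |w - x| ≤ d} (measurableSet_le (by fun_prop) (by fun_prop))
    (measurableSet_le (by fun_prop) (by fun_prop))
  have hprod' : μ.real (ξ i ⁻¹' {s | |s| ≤ 2 * δ}
      ∩ (fun ω => ∑ j, ξ j ω - ξ i ω) ⁻¹' {w | |w - x| ≤ d})
      = μ.real {ω | |ξ i ω| ≤ 2 * δ} * μ.real {ω | |∑ j, ξ j ω - ξ i ω - x| ≤ d} := by
    simp only [measureReal_def, hprod, ENNReal.toReal_mul]
    rfl
  have hsub : μ.real (ξ i ⁻¹' {s | |s| ≤ 2 * δ}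
      ∩ (fun ω => ∑ j, ξ j ω - ξ i ω) ⁻¹' {w | |w - x| ≤ d})
      ≤ μ.real {ω | |∑ j, ξ j ω - x| ≤ d + 2 * δ} := by
    refine measureReal_mono fun ω hω => ?_
    obtain ⟨h1, h2⟩ := hω
    simp only [Set.mem_preimage, Set.mem_ofPred_eq] at h1 h2 ⊢
    have := abs_add_le (∑ j, ξ j ω - ξ i ω - x) (ξ i ω)
    rw [show ∑ j, ξ j ω - ξ i ω - x + ξ i ω = ∑ j, ξ j ω - x by ring] at this
    linarith
  have hu := h.uniform_concentration hδ0 hδ x (d := d + 2 * δ) (by positivity)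
  have h0 : 0 ≤ μ.real {ω | |∑ j, ξ j ω - ξ i ω - x| ≤ d} := measureReal_nonneg
  nlinarith

end IsStdSum

end BerryEsseen

namespace BerryEsseen

/-! ### The Stein equation -/

/-- The unnormalized standard normal density. -/
noncomputable def bell (t : ℝ) : ℝ := Real.exp (-(1 / 2) * t ^ 2)

lemma bell_pos (t : ℝ) : 0 < bell t := Real.exp_pos _

@[fun_prop]
lemma continuous_bell : Continuous bell := by unfold bell; fun_prop

lemma integrable_bell : Integrable bell := integrable_exp_neg_mul_sq (by norm_num)

lemma integral_bell_le : ∫ t, bell t ≤ 3 := by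
  unfold bell
  rw [integral_gaussian, Real.sqrt_le_left (by norm_num)]
  nlinarith [Real.pi_le_four]

lemma bell_neg (t : ℝ) : bell (-t) = bell t := by simp [bell]

lemma hasDerivAt_bell (t : ℝ) : HasDerivAt bell (-(t * bell t)) t := by
  have h := ((hasDerivAt_pow 2 t).const_mul (-(1 / 2) : ℝ)).exp
  refine h.congr_deriv ?_
  simp only [bell]
  push_cast
  ring

lemma gaussianPDFReal_eq_bell (t : ℝ) : gaussianPDFReal 0 1 t = (√(2 * Real.pi))⁻¹ * bell t := by
  simp only [gaussianPDFReal, bell, NNReal.coe_one, mul_one, sub_zero]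
  congr 2
  ring

/-- For `t ≥ w ≥ 0` one has `t² ≥ w² + (t - w)²`, so the tail is dominated by `bell w` times a
shifted bell. -/
lemma setIntegral_Ioi_bell_le {w : ℝ} (hw : 0 ≤ w) : ∫ t in Set.Ioi w, bell t ≤ 3 * bell w := by
  have hi : Integrable fun t => bell w * bell (t - w) :=
    (integrable_bell.comp_sub_right w).const_mul _
  calc ∫ t in Set.Ioi w, bell t ≤ ∫ t in Set.Ioi w, bell w * bell (t - w) := by
        refine setIntegral_mono_on integrable_bell.integrableOn hi.integrableOn
          measurableSet_Ioi fun t ht => ?_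
        unfold bell
        rw [← Real.exp_add]
        refine Real.exp_le_exp.2 ?_
        nlinarith [mul_nonneg hw (sub_nonneg.2 (le_of_lt (Set.mem_Ioi.1 ht)))]
    _ ≤ ∫ t, bell w * bell (t - w) :=
        setIntegral_le_integral hi
          (Filter.Eventually.of_forall fun t => (mul_pos (bell_pos _) (bell_pos _)).le)
    _ = bell w * ∫ t, bell t := by rw [integral_const_mul, integral_sub_right_eq_self bell w]
    _ ≤ 3 * bell w := by nlinarith [bell_pos w, integral_bell_le]

/-- On the half-line `w ≤ t`, and `t * bell t` has primitive `-bell t`. -/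
lemma mul_setIntegral_Ioi_bell_le (w : ℝ) : w * ∫ t in Set.Ioi w, bell t ≤ bell w := by
  have hi : Integrable fun t => t * bell t := integrable_mul_exp_neg_mul_sq (by norm_num)
  have htend : Filter.Tendsto bell Filter.atTop (nhds 0) := by
    refine Real.tendsto_exp_atBot.comp ?_
    exact (Filter.tendsto_pow_atTop two_ne_zero).const_mul_atTop_of_neg (by norm_num)
  have h2 := integral_Ioi_of_hasDerivAt_of_tendsto' (a := w) (fun t _ => hasDerivAt_bell t)
    hi.neg.integrableOn htend
  rw [integral_neg, zero_sub, neg_inj] at h2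
  rw [← h2, ← integral_const_mul]
  exact setIntegral_mono_on (integrable_bell.const_mul w).integrableOn hi.integrableOn
    measurableSet_Ioi fun t ht =>
      mul_le_mul_of_nonneg_right (le_of_lt (Set.mem_Ioi.1 ht)) (bell_pos t).le

lemma setIntegral_Iic_bell (w : ℝ) : ∫ t in Set.Iic w, bell t = ∫ t in Set.Ioi (-w), bell t := by
  rw [← integral_comp_neg_Iic]; simp [bell_neg]

/-- Bounds for the solution of the Stein equation with a continuous right-hand side with values
in `[0, 1]`. -/
theorem exists_stein_solution {h : ℝ → ℝ} (hc : Continuous h) (h0 : ∀ t, 0 ≤ h t)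
    (h1 : ∀ t, h t ≤ 1) :
    ∃ f : ℝ → ℝ,
      (∀ w, HasDerivAt f (w * f w + (h w - ∫ t, h t ∂gaussianReal 0 1)) w) ∧
      (∀ w, |f w| ≤ 3) ∧ ∀ w, |w * f w| ≤ 1 := by
  set c := ∫ t, h t ∂gaussianReal 0 1 with hcdef
  have ih : Integrable h (gaussianReal 0 1) :=
    Integrable.of_bound hc.aestronglyMeasurable 1 (Filter.Eventually.of_forall fun t => by
      rw [Real.norm_of_nonneg (h0 t)]; exact h1 t)
  have c0 : 0 ≤ c := integral_nonneg h0
  have c1 : c ≤ 1 := by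
    refine (integral_mono ih (integrable_const 1) h1).trans ?_
    simp
  have hb : ∀ t, |h t - c| ≤ 1 := fun t => abs_le.2 ⟨by linarith [h0 t], by linarith [h1 t]⟩
  set k : ℝ → ℝ := fun t => (h t - c) * bell t with hk
  have kb : ∀ t, ‖k t‖ ≤ bell t := fun t => by
    rw [hk, norm_mul, Real.norm_of_nonneg (bell_pos t).le, Real.norm_eq_abs]
    exact mul_le_of_le_one_left (bell_pos t).le (hb t)
  have kc : Continuous k := by fun_prop
  have ki : Integrable k := integrable_bell.mono' kc.aestronglyMeasurable
    (Filter.Eventually.of_forall kb)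
  -- Because `k` integrates to zero, `F w` is a left-tail integral and also minus a right-tail
  -- integral. Using the tail that points away from the origin keeps `F w` comparable with `bell w`
  -- on both half-lines.
  have k0 : ∫ t, k t = 0 := by
    have e : ∫ t, (h t - c) ∂gaussianReal 0 1 = 0 := by
      rw [integral_sub ih (integrable_const c)]; simp [← hcdef]
    rw [integral_gaussianReal_eq_integral_smul one_ne_zero] at e
    simp only [gaussianPDFReal_eq_bell, smul_eq_mul, mul_assoc, integral_const_mul] at e
    rcases mul_eq_zero.1 e with e | e
    · exact absurd e (by positivity)
    · rw [← e]; exact integral_congr_ae (Filter.Eventually.of_forall fun t => mul_comm _ _)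
  set F : ℝ → ℝ := fun w => ∫ t in Set.Iic w, k t with hF
  have dF : ∀ w, HasDerivAt F (k w) w := by
    intro w
    have e : F = fun v => F 0 + ∫ t in (0 : ℝ)..v, k t := by
      ext v
      rw [← intervalIntegral.integral_Iic_sub_Iic ki.integrableOn ki.integrableOn]
      simp [hF]
    rw [e]
    exact (intervalIntegral.integral_hasDerivAt_right (kc.intervalIntegrable _ _)
      (kc.stronglyMeasurableAtFilter _ _) kc.continuousAt).const_add _
  have F1 : ∀ w, |F w| ≤ ∫ t in Set.Iic w, bell t := fun w =>
    norm_integral_le_of_norm_le integrable_bell.integrableOn (Filter.Eventually.of_forall kb)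
  have F2 : ∀ w, |F w| ≤ ∫ t in Set.Ioi w, bell t := fun w => by
    have e : F w = -∫ t in Set.Ioi w, k t := by
      rw [eq_neg_iff_add_eq_zero, ← k0]
      exact intervalIntegral.integral_Iic_add_Ioi ki.integrableOn ki.integrableOn
    rw [e, abs_neg]
    exact norm_integral_le_of_norm_le integrable_bell.integrableOn (Filter.Eventually.of_forall kb)
  have inv : ∀ w, (bell w)⁻¹ = Real.exp (w ^ 2 / 2) := fun w => by
    rw [bell, ← Real.exp_neg]; congr 1; ring
  have FB : ∀ w, |F w| ≤ 3 * bell w ∧ |w| * |F w| ≤ bell w := by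
    intro w
    rcases le_total 0 w with hw | hw
    · refine ⟨(F2 w).trans (setIntegral_Ioi_bell_le hw), ?_⟩
      rw [abs_of_nonneg hw]
      exact (mul_le_mul_of_nonneg_left (F2 w) hw).trans (mul_setIntegral_Ioi_bell_le w)
    · have hw' : 0 ≤ -w := neg_nonneg.2 hw
      have hF1 := F1 w
      rw [setIntegral_Iic_bell] at hF1
      rw [abs_of_nonpos hw, ← bell_neg w]
      exact ⟨hF1.trans (setIntegral_Ioi_bell_le hw'),
        (mul_le_mul_of_nonneg_left hF1 hw').trans (mul_setIntegral_Ioi_bell_le (-w))⟩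
  refine ⟨fun w => Real.exp (w ^ 2 / 2) * F w, fun w => ?_, fun w => ?_, fun w => ?_⟩
  · have hd := (((hasDerivAt_pow 2 w).div_const 2).exp).mul (dF w)
    refine hd.congr_deriv ?_
    have : Real.exp (w ^ 2 / 2) * k w = h w - c := by
      rw [← inv, hk]
      have := (bell_pos w).ne'
      field_simp
    rw [this]
    push_cast
    ring
  · simp only
    rw [← inv, abs_mul, abs_of_pos (inv_pos.2 (bell_pos w)), inv_mul_le_iff₀ (bell_pos w)]
    linarith [(FB w).1]
  · simp only
    rw [← inv, mul_left_comm, abs_mul, abs_of_pos (inv_pos.2 (bell_pos w)),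
      inv_mul_le_iff₀ (bell_pos w), abs_mul, mul_one]
    exact (FB w).2

/-! ### The smoothed indicator -/

/-- The function equal to `1` on `(-∞, z]`, to `0` on `[z + α, ∞)`, and linear in between. -/
noncomputable def ramp (z α w : ℝ) : ℝ := max 0 (min 1 ((z + α - w) / α))

lemma continuous_ramp (z α : ℝ) : Continuous (ramp z α) := by unfold ramp; fun_prop

lemma ramp_nonneg (z α w : ℝ) : 0 ≤ ramp z α w := le_max_left _ _

lemma ramp_le_one (z α w : ℝ) : ramp z α w ≤ 1 := max_le zero_le_one (min_le_left _ _)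

lemma ramp_of_le {z α w : ℝ} (hα : 0 < α) (h : w ≤ z) : ramp z α w = 1 := by
  unfold ramp
  rw [min_eq_left ((one_le_div hα).2 (by linarith)), max_eq_right zero_le_one]

lemma ramp_of_ge {z α w : ℝ} (hα : 0 < α) (h : z + α ≤ w) : ramp z α w = 0 := by
  unfold ramp
  exact max_eq_left ((min_le_right _ _).trans (div_nonpos_of_nonpos_of_nonneg (by linarith) hα.le))

/-- A bound for the increments of `ramp`. -/
noncomputable def rampIncr (z α u w : ℝ) : ℝ :=
  {v : ℝ × ℝ | |v.2 - (z + α / 2)| ≤ α / 2 + |v.1|}.indicator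
    (fun v => min 1 (|v.1| / α)) (u, w)

lemma measurable_rampIncr (z α : ℝ) : Measurable fun v : ℝ × ℝ => rampIncr z α v.1 v.2 := by
  unfold rampIncr
  exact Measurable.indicator (by fun_prop) (measurableSet_le (by fun_prop) (by fun_prop))

lemma rampIncr_nonneg {z α : ℝ} (hα : 0 < α) (u w : ℝ) : 0 ≤ rampIncr z α u w :=
  Set.indicator_nonneg (fun _ _ => le_min zero_le_one (by positivity)) _

lemma rampIncr_le_one {z α : ℝ} (u w : ℝ) : rampIncr z α u w ≤ 1 :=
  Set.indicator_le' (fun _ _ => min_le_left _ _) (fun _ _ => zero_le_one) _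

/-- The ramp takes values in `[0, 1]`, has slope at most `1 / α`, and is constant off `[z, z + α]`.
Increments therefore vanish unless `w` is within `|u|` of that interval; this localization lets
concentration be applied. -/
lemma abs_ramp_sub_le {z α : ℝ} (hα : 0 < α) {s u : ℝ} (hs : |s| ≤ |u|) (w : ℝ) :
    |ramp z α (w + s) - ramp z α w| ≤ rampIncr z α u w := by
  obtain ⟨hs1, hs2⟩ := abs_le.1 hs
  by_cases hm : |w - (z + α / 2)| ≤ α / 2 + |u|
  · have hmem : (u, w) ∈ {v : ℝ × ℝ | |v.2 - (z + α / 2)| ≤ α / 2 + |v.1|} := hm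
    rw [rampIncr, Set.indicator_of_mem hmem]
    refine le_min (abs_le.2 ⟨?_, ?_⟩) ?_
    · linarith [ramp_nonneg z α (w + s), ramp_le_one z α w]
    · linarith [ramp_nonneg z α w, ramp_le_one z α (w + s)]
    · unfold ramp
      refine (abs_max_sub_max_le_max _ _ _ _).trans (max_le (by simp; positivity) ?_)
      refine (abs_min_sub_min_le_max _ _ _ _).trans (max_le (by simp; positivity) ?_)
      rw [← sub_div, show z + α - (w + s) - (z + α - w) = -s by ring, abs_div, abs_neg,
        abs_of_pos hα]
      gcongr
  · have hnot : (u, w) ∉ {v : ℝ × ℝ | |v.2 - (z + α / 2)| ≤ α / 2 + |v.1|} := hm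
    rw [rampIncr, Set.indicator_of_notMem hnot]
    rcases lt_abs.1 (not_le.1 hm) with h | h
    · rw [ramp_of_ge hα (by linarith), ramp_of_ge hα (by linarith)]; simp
    · rw [ramp_of_le hα (by linarith), ramp_of_le hα (by linarith)]; simp

end BerryEsseen

namespace BerryEsseen

/-! ### The Berry–Esseen theorem -/

/-- Integrating out one of two independent variables. -/
lemma integral_le_of_indepFun {Ω : Type*} [MeasurableSpace Ω] {μ : Measure Ω}
    [IsProbabilityMeasure μ] {X Y : Ω → ℝ} (mX : Measurable X) (mY : Measurable Y)
    (hXY : IndepFun X Y μ) {Ψ : ℝ × ℝ → ℝ} (mΨ : Measurable Ψ) {B : ℝ → ℝ} (mB : Measurable B)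
    (hi : Integrable (fun ω => Ψ (X ω, Y ω)) μ) (hB : Integrable (fun ω => B (X ω)) μ)
    (hle : ∀ a, ∫ ω, Ψ (a, Y ω) ∂μ ≤ B a) :
    ∫ ω, Ψ (X ω, Y ω) ∂μ ≤ ∫ ω, B (X ω) ∂μ := by
  have := Measure.isProbabilityMeasure_map mX.aemeasurable (μ := μ)
  have := Measure.isProbabilityMeasure_map mY.aemeasurable (μ := μ)
  have hmap := hXY.map_prod_eq_prod_map_map mX.aemeasurable mY.aemeasurable
  have mXY : Measurable fun ω => (X ω, Y ω) := mX.prodMk mY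
  have hi' : Integrable Ψ ((μ.map X).prod (μ.map Y)) := by
    rw [← hmap, integrable_map_measure mΨ.aestronglyMeasurable mXY.aemeasurable]
    exact hi
  have e1 : ∫ ω, Ψ (X ω, Y ω) ∂μ = ∫ a, ∫ b, Ψ (a, b) ∂μ.map Y ∂μ.map X := by
    rw [← integral_prod _ hi', ← hmap,
      integral_map mXY.aemeasurable mΨ.aestronglyMeasurable]
  rw [e1, ← integral_map mX.aemeasurable mB.aestronglyMeasurable]
  refine integral_mono hi'.integral_prod_left
    ((integrable_map_measure mB.aestronglyMeasurable mX.aemeasurable).2 hB) fun a => ?_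
  simp only
  have hm := integral_map (μ := μ) mY.aemeasurable (mΨ.comp (by fun_prop : Measurable fun b : ℝ => (a, b))).aestronglyMeasurable
  simp only [Function.comp_def] at hm
  exact hm.trans_le (hle a)

/-- The first-order Taylor bound for a solution of the Stein equation. -/
lemma abs_taylor_le {f h : ℝ → ℝ} {c : ℝ}
    (hd : ∀ w, HasDerivAt f (w * f w + (h w - c)) w) (hf : ∀ w, |f w| ≤ 3)
    (hd2 : ∀ w, |w * f w + (h w - c)| ≤ 2) {u w H : ℝ}
    (hH : ∀ s, |s| ≤ |u| → |h (w + s) - h w| ≤ H) :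
    |((w + u) * f (w + u) + (h (w + u) - c)) - (w * f w + (h w - c))|
        ≤ (2 * |w| + 3) * |u| + H ∧
      |f (w + u) - f w - u * (w * f w + (h w - c))| ≤ |u| * ((2 * |w| + 3) * |u| + H) := by
  have lip : ∀ a b, |f b - f a| ≤ 2 * |b - a| := fun a b => by
    simpa using Convex.norm_image_sub_le_of_norm_hasDerivWithin_le (C := 2) (s := Set.univ)
      (fun x _ => (hd x).hasDerivWithinAt) (fun x _ => hd2 x) convex_univ
      (Set.mem_univ a) (Set.mem_univ b)
  have key : ∀ s, |s| ≤ |u| →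
      |((w + s) * f (w + s) + (h (w + s) - c)) - (w * f w + (h w - c))|
        ≤ (2 * |w| + 3) * |u| + H := by
    intro s hs
    have e : ((w + s) * f (w + s) + (h (w + s) - c)) - (w * f w + (h w - c))
        = w * (f (w + s) - f w) + s * f (w + s) + (h (w + s) - h w) := by ring
    rw [e]
    refine (abs_add_three _ _ _).trans ?_
    rw [abs_mul, abs_mul]
    have h1 := lip w (w + s)
    rw [add_sub_cancel_left] at h1
    have h2 : |w| * |f (w + s) - f w| ≤ |w| * (2 * |u|) :=
      mul_le_mul_of_nonneg_left (h1.trans (by linarith)) (abs_nonneg _)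
    have h3 : |s| * |f (w + s)| ≤ |u| * 3 := mul_le_mul hs (hf _) (abs_nonneg _) (abs_nonneg _)
    linarith [hH s hs]
  refine ⟨key u le_rfl, ?_⟩
  -- The mean value inequality is applied to `s ↦ f (w + s) - s f' w`, whose derivative `f' (w + s)
  -- - f' w` is controlled by `key`.
  have mv := Convex.norm_image_sub_le_of_norm_hasDerivWithin_le
    (f := fun s => f (w + s) - s * (w * f w + (h w - c)))
    (f' := fun s => ((w + s) * f (w + s) + (h (w + s) - c)) - (w * f w + (h w - c)))
    (C := (2 * |w| + 3) * |u| + H) (s := Set.Icc (-|u|) |u|)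
    (fun s _ => by
      have h1 := (hd (w + s)).comp_const_add w s
      have h2 := (hasDerivAt_id s).mul_const (w * f w + (h w - c))
      rw [one_mul] at h2
      exact (h1.sub h2).hasDerivWithinAt)
    (fun s hs => key s (abs_le.2 hs)) (convex_Icc _ _)
    (x := 0) (y := u) ⟨by simp, by simp⟩ ⟨neg_abs_le u, le_abs_self u⟩
  simp only [add_zero, zero_mul, sub_zero, Real.norm_eq_abs] at mv
  rw [sub_right_comm]
  exact mv.trans_eq (mul_comm _ _)

lemma gaussianReal_Ioc_le (a : ℝ) {d : ℝ} (hd : 0 ≤ d) :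
    (gaussianReal 0 1).real (Set.Ioc a (a + d)) ≤ d := by
  have hle : ∀ t, gaussianPDFReal 0 1 t ≤ 1 := fun t => by
    rw [gaussianPDFReal_eq_bell]
    have h1 : bell t ≤ 1 := Real.exp_le_one_iff.2 (by nlinarith [sq_nonneg t])
    have h2 : (√(2 * Real.pi))⁻¹ ≤ 1 := inv_le_one_of_one_le₀ (by
      rw [Real.one_le_sqrt]; nlinarith [Real.pi_gt_three])
    exact mul_le_one₀ h2 (bell_pos t).le h1
  rw [measureReal_def, gaussianReal_apply_eq_integral _ one_ne_zero,
    ENNReal.toReal_ofReal (integral_nonneg fun t => gaussianPDFReal_nonneg _ _ _)]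
  refine (setIntegral_mono_on (integrable_gaussianPDFReal 0 1).integrableOn
    (integrableOn_const (C := (1 : ℝ)) (by simp)) measurableSet_Ioc fun t _ => hle t).trans_eq ?_
  simp [hd]

lemma cdf_add_le (a : ℝ) {d : ℝ} (hd : 0 ≤ d) :
    cdf (gaussianReal 0 1) (a + d) ≤ cdf (gaussianReal 0 1) a + d := by
  rw [cdf_eq_real, cdf_eq_real, ← Set.Iic_union_Ioc_eq_Iic (by linarith : a ≤ a + d)]
  exact (measureReal_union_le _ _).trans (by linarith [gaussianReal_Ioc_le a hd])

lemma measureReal_Iic_le_integral_ramp {Ω : Type*} [MeasurableSpace Ω] {μ : Measure Ω}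
    [IsProbabilityMeasure μ] {W : Ω → ℝ} (mW : Measurable W) (z : ℝ) {α : ℝ} (hα : 0 < α) :
    μ.real {ω | W ω ≤ z} ≤ ∫ ω, ramp z α (W ω) ∂μ ∧
      ∫ ω, ramp z α (W ω) ∂μ ≤ μ.real {ω | W ω ≤ z + α} := by
  have mr : Measurable fun ω => ramp z α (W ω) := (continuous_ramp z α).measurable.comp mW
  have ir : Integrable (fun ω => ramp z α (W ω)) μ :=
    Integrable.of_bound mr.aestronglyMeasurable 1 (Filter.Eventually.of_forall fun ω => by
      rw [Real.norm_of_nonneg (ramp_nonneg _ _ _)]; exact ramp_le_one _ _ _)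
  constructor
  · exact measureReal_le_integral (measurableSet_le mW measurable_const) ir
      (fun ω => ramp_nonneg _ _ _) fun ω hω => (ramp_of_le hα hω).ge
  · have mA : MeasurableSet {ω | W ω ≤ z + α} := measurableSet_le mW measurable_const
    rw [← integral_indicator_one mA]
    refine integral_mono ir ((integrable_const 1).indicator mA) fun ω => ?_
    by_cases h : ω ∈ {ω | W ω ≤ z + α}
    · simpa [h] using ramp_le_one _ _ _
    · simp only [Set.indicator_of_notMem h]
      exact (ramp_of_ge hα (le_of_lt (not_le.1 h))).le

namespace IsStdSum

variable {Ω ι : Type*} [MeasurableSpace Ω] [Fintype ι] {μ : Measure Ω} {ξ : ι → Ω → ℝ}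

lemma integral_sum_sq (h : IsStdSum ξ μ) : ∫ ω, (∑ i, ξ i ω) ^ 2 ∂μ = 1 := by
  have := h.isProbabilityMeasure
  have hv := IndepFun.variance_sum (μ := μ) (s := Finset.univ) (X := ξ)
    (fun i _ => h.memLp_two i) fun i _ j _ hij => h.indep.indepFun hij
  have hm : ∫ ω, ∑ i, ξ i ω ∂μ = 0 := by
    rw [integral_finsetSum _ fun i _ => h.integrable i]
    exact Finset.sum_eq_zero fun i _ => h.mean i
  have e : (∑ i, ξ i) = fun ω => ∑ i, ξ i ω := by ext; simp
  rw [e, variance_of_integral_eq_zero h.measurable_sum.aemeasurable hm] at hv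
  rw [hv, ← h.var]
  exact Finset.sum_congr rfl fun i _ =>
    variance_of_integral_eq_zero (h.meas i).aemeasurable (h.mean i)

lemma sq_le_one (h : IsStdSum ξ μ) (i : ι) : ∫ ω, ξ i ω ^ 2 ∂μ ≤ 1 := by
  rw [← h.var]
  exact Finset.single_le_sum (f := fun i => ∫ ω, ξ i ω ^ 2 ∂μ) (fun _ _ => by positivity)
    (Finset.mem_univ i)

/-- With `a = |ξ_i|`, integrate `2a³ - 3σa² + σ³ = (a - σ)² (2a + σ) ≥ 0`. -/
lemma sqrt_cube_le (h : IsStdSum ξ μ) (i : ι) :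
    √(∫ ω, ξ i ω ^ 2 ∂μ) ^ 3 ≤ ∫ ω, |ξ i ω| ^ 3 ∂μ := by
  have := h.isProbabilityMeasure
  set σ := √(∫ ω, ξ i ω ^ 2 ∂μ) with hσ
  have hσ0 : 0 ≤ σ := Real.sqrt_nonneg _
  have hσ2 : σ ^ 2 = ∫ ω, ξ i ω ^ 2 ∂μ := Real.sq_sqrt (by positivity)
  have hle : ∫ ω, (3 / 2 * σ * ξ i ω ^ 2 - σ ^ 3 / 2) ∂μ ≤ ∫ ω, |ξ i ω| ^ 3 ∂μ := by
    refine integral_mono (((h.integrable_sq i).const_mul _).sub (integrable_const _))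
      (h.integrable_cube i) fun ω => ?_
    simp only
    rw [← sq_abs]
    nlinarith [mul_nonneg (sq_nonneg (|ξ i ω| - σ))
      (by positivity : 0 ≤ 2 * |ξ i ω| + σ)]
  rw [integral_sub ((h.integrable_sq i).const_mul _) (integrable_const _), integral_const_mul,
    ← hσ2] at hle
  simp only [integral_const, probReal_univ, smul_eq_mul, one_mul] at hle
  nlinarith

lemma integral_sq_mul_integral_abs_le (h : IsStdSum ξ μ) (i : ι) :
    (∫ ω, ξ i ω ^ 2 ∂μ) * ∫ ω, |ξ i ω| ∂μ ≤ ∫ ω, |ξ i ω| ^ 3 ∂μ := by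
  have := h.isProbabilityMeasure
  have h1 := integral_abs_le_sqrt (h.memLp_two i)
  refine (mul_le_mul_of_nonneg_left h1 (by positivity)).trans
    (le_trans (le_of_eq ?_) (h.sqrt_cube_le i))
  rw [pow_succ, Real.sq_sqrt (by positivity)]

lemma integral_abs_sum_sub_le (h : IsStdSum ξ μ) (i : ι) :
    ∫ ω, |∑ j, ξ j ω - ξ i ω| ∂μ ≤ 2 := by
  have := h.isProbabilityMeasure
  have LW : MemLp (fun ω => ∑ j, ξ j ω) 2 μ :=
    memLp_finsetSum Finset.univ fun i _ => h.memLp_two i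
  have h1 := integral_abs_le_sqrt LW
  rw [h.integral_sum_sq, Real.sqrt_one] at h1
  have h2 := (integral_abs_le_sqrt (h.memLp_two i)).trans
    (Real.sqrt_le_one.2 (h.sq_le_one i))
  have iW := LW.integrable (by norm_num)
  calc ∫ ω, |∑ j, ξ j ω - ξ i ω| ∂μ ≤ ∫ ω, (|∑ j, ξ j ω| + |ξ i ω|) ∂μ :=
        integral_mono (iW.sub (h.integrable i)).abs (iW.abs.add (h.integrable i).abs)
          fun ω => abs_sub _ _
    _ ≤ 2 := by rw [integral_add iW.abs (h.integrable i).abs]; linarith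

/-- Smoothed comparison with the normal law. -/
lemma abs_integral_ramp_sub_le (h : IsStdSum ξ μ) {δ : ℝ} (hδ0 : 0 < δ)
    (hδ : lyapunov ξ μ ≤ δ) (hi : ∀ i, ∫ ω, |ξ i ω| ∂μ ≤ δ) (z : ℝ) :
    |∫ ω, ramp z δ (∑ i, ξ i ω) ∂μ - ∫ t, ramp z δ t ∂gaussianReal 0 1| ≤ 3314 * δ := by
  have := h.isProbabilityMeasure
  have mW := h.measurable_sum
  have LW : MemLp (fun ω => ∑ j, ξ j ω) 2 μ :=
    memLp_finsetSum Finset.univ fun i _ => h.memLp_two i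
  have iW := LW.integrable (by norm_num)
  obtain ⟨f, hd, hf, hwf⟩ := exists_stein_solution (continuous_ramp z δ) (ramp_nonneg z δ)
    (ramp_le_one z δ)
  set c := ∫ t, ramp z δ t ∂gaussianReal 0 1 with hc
  have c01 : 0 ≤ c ∧ c ≤ 1 := by
    refine ⟨integral_nonneg (ramp_nonneg z δ), ?_⟩
    refine (integral_mono_of_nonneg (Filter.Eventually.of_forall (ramp_nonneg z δ))
      (integrable_const 1) (Filter.Eventually.of_forall (ramp_le_one z δ))).trans ?_
    simp
  set f' : ℝ → ℝ := fun w => w * f w + (ramp z δ w - c) with hf'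
  have cf : Continuous f := continuous_iff_continuousAt.2 fun w => (hd w).continuousAt
  have cf' : Continuous f' := by have := continuous_ramp z δ; fun_prop
  have mf : Measurable f := cf.measurable
  have mf' : Measurable f' := cf'.measurable
  have hf'2 : ∀ w, |f' w| ≤ 2 := fun w => by
    refine (abs_add_le _ _).trans ?_
    have : |ramp z δ w - c| ≤ 1 :=
      abs_le.2 ⟨by linarith [ramp_nonneg z δ w], by linarith [ramp_le_one z δ w]⟩
    linarith [hwf w]
  have if' : ∀ {V : Ω → ℝ}, Measurable V → Integrable (fun ω => f' (V ω)) μ := fun {V} mV =>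
    Integrable.of_bound (by fun_prop : Measurable _).aestronglyMeasurable 2
      (Filter.Eventually.of_forall fun ω => hf'2 _)
  have iff : ∀ {V Z : Ω → ℝ}, Measurable V → Integrable Z μ →
      Integrable (fun ω => Z ω * f (V ω)) μ := fun {V Z} mV hZ =>
    hZ.mul_bdd (c := 3) (by fun_prop : Measurable _).aestronglyMeasurable
      (Filter.Eventually.of_forall fun ω => hf _)
  have iff' : ∀ {V Z : Ω → ℝ}, Measurable V → Integrable Z μ →
      Integrable (fun ω => Z ω * f' (V ω)) μ := fun {V Z} mV hZ =>
    hZ.mul_bdd (c := 2) (by fun_prop : Measurable _).aestronglyMeasurable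
      (Filter.Eventually.of_forall fun ω => hf'2 _)
  set G : ℝ × ℝ → ℝ := fun v => (2 * |v.2| + 3) * |v.1| + rampIncr z δ v.1 v.2 with hG
  have mG : Measurable G := by have := measurable_rampIncr z δ; fun_prop
  have G0 : ∀ v, 0 ≤ G v := fun v => by
    have := rampIncr_nonneg (z := z) hδ0 v.1 v.2; positivity
  have taylor : ∀ u w, |f' (w + u) - f' w| ≤ G (u, w) ∧
      |f (w + u) - f w - u * f' w| ≤ |u| * G (u, w) := fun u w =>
    abs_taylor_le hd hf hf'2 fun s hs => abs_ramp_sub_le hδ0 hs w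
  -- With `V = W - ξ_i` independent of `ξ_i`, Taylor expansion gives `𝔼 ξ_i f(W) = 𝔼 ξ_i² 𝔼 f'(V)`
  -- up to `1657 𝔼|ξ_i|³`. Replacing `f'(V)` by `f'(W)` costs `1657 𝔼 ξ_i² 𝔼|ξ_i|`, again at most
  -- `1657 𝔼|ξ_i|³`.
  have term : ∀ i, |∫ ω, ξ i ω * f (∑ j, ξ j ω) ∂μ
      - (∫ ω, ξ i ω ^ 2 ∂μ) * ∫ ω, f' (∑ j, ξ j ω) ∂μ| ≤ 3314 * ∫ ω, |ξ i ω| ^ 3 ∂μ := by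
    intro i
    set V : Ω → ℝ := fun ω => ∑ j, ξ j ω - ξ i ω with hV
    have mξ := h.meas i
    have mV : Measurable V := by fun_prop
    have iV : Integrable V μ := iW.sub (h.integrable i)
    have ind : IndepFun (ξ i) V μ := h.indepFun_sum_sub i
    have eV : ∀ ω, ∑ j, ξ j ω = V ω + ξ i ω := fun ω => by simp [hV]
    -- The smooth part contributes `2 · 2 + 3 = 7` and the ramp increments `1650`.
    have mean_G : ∀ u, ∫ ω, G (u, V ω) ∂μ ≤ 1657 * |u| := by
      intro u
      have iR : Integrable (fun ω => rampIncr z δ u (V ω)) μ :=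
        Integrable.of_bound ((measurable_rampIncr z δ).comp
          (measurable_const.prodMk mV)).aestronglyMeasurable 1
          (Filter.Eventually.of_forall fun ω => by
            rw [Real.norm_of_nonneg (rampIncr_nonneg hδ0 _ _)]; exact rampIncr_le_one _ _)
      have i1 : Integrable (fun ω => (2 * |V ω| + 3) * |u|) μ :=
        ((iV.abs.const_mul 2).add (integrable_const 3)).mul_const _
      -- Concentration gives `660 (3δ/2 + |u|)` for the indicator. Multiplied by `min 1 (|u| / δ)`,
      -- both `δ` and `|u|` become at most `|u|`, whence `660 · 5/2 = 1650`.
      have hR : ∫ ω, rampIncr z δ u (V ω) ∂μ ≤ 1650 * |u| := by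
        have hcon := h.uniform_concentration_sub hδ0 hδ (hi i) (z + δ / 2)
          (d := δ / 2 + |u|) (by positivity)
        have mA : MeasurableSet {ω | |V ω - (z + δ / 2)| ≤ δ / 2 + |u|} :=
          measurableSet_le (by fun_prop) (by fun_prop)
        have e : ∀ ω, rampIncr z δ u (V ω)
            = {ω | |V ω - (z + δ / 2)| ≤ δ / 2 + |u|}.indicator
                (fun _ => min 1 (|u| / δ)) ω := fun ω => rfl
        simp only [e]
        rw [integral_indicator_const _ mA, smul_eq_mul]
        have h0 : 0 ≤ min 1 (|u| / δ) := le_min zero_le_one (by positivity)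
        refine (mul_le_mul_of_nonneg_right hcon h0).trans ?_
        have h1 : min 1 (|u| / δ) * |u| ≤ |u| :=
          mul_le_of_le_one_left (abs_nonneg _) (min_le_left _ _)
        have h2 : min 1 (|u| / δ) * δ ≤ |u| := by
          refine (mul_le_mul_of_nonneg_right (min_le_right _ _) hδ0.le).trans_eq ?_
          field_simp
        nlinarith
      have hV2 : ∫ ω, |V ω| ∂μ ≤ 2 := h.integral_abs_sum_sub_le i
      simp only [hG]
      rw [integral_add i1 iR, integral_mul_const, integral_add (iV.abs.const_mul 2)
        (integrable_const 3), integral_const_mul]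
      simp only [integral_const, probReal_univ, smul_eq_mul, one_mul]
      nlinarith [abs_nonneg u]
    have iPow : ∀ k : ℕ, k ≤ 2 → Integrable (fun ω => |ξ i ω| ^ (k + 1)) μ := by
      intro k hk
      interval_cases k
      · simpa using (h.integrable i).abs
      · simpa using h.integrable_sq i
      · exact h.integrable_cube i
    -- The case `k = 2` serves the Taylor remainder multiplied by `ξ_i`; the case `k = 0` serves the
    -- exchange of `f'(W)` and `f'(V)`.
    have iG : ∀ k : ℕ, k ≤ 2 → k = 0 ∨ k = 2 →
        Integrable (fun ω => |ξ i ω| ^ k * G (ξ i ω, V ω)) μ := by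
      intro k hk hk'
      have ind' : IndepFun (fun ω => |ξ i ω| ^ (k + 1)) (fun ω => 2 * |V ω| + 3) μ :=
        ind.comp (φ := fun s => |s| ^ (k + 1)) (ψ := fun s => 2 * |s| + 3) (by fun_prop)
          (by fun_prop)
      have j1 := ind'.integrable_mul (iPow k hk)
        ((iV.abs.const_mul 2).add (integrable_const 3))
      have j2 : Integrable (fun ω => |ξ i ω| ^ k) μ := by
        rcases hk' with rfl | rfl
        · simp
        · exact iPow 1 (by norm_num)
      have j3 : Integrable (fun ω => |ξ i ω| ^ k * rampIncr z δ (ξ i ω) (V ω)) μ :=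
        j2.mul_bdd (c := 1) ((measurable_rampIncr z δ).comp
          (mξ.prodMk mV)).aestronglyMeasurable (Filter.Eventually.of_forall fun ω => by
            rw [Real.norm_of_nonneg (rampIncr_nonneg hδ0 _ _)]; exact rampIncr_le_one _ _)
      refine (j1.add j3).congr (Filter.Eventually.of_forall fun ω => ?_)
      simp only [hG, Pi.add_apply, Pi.mul_apply]
      ring
    have bG : ∀ k : ℕ, k ≤ 2 → k = 0 ∨ k = 2 → ∫ ω, |ξ i ω| ^ k * G (ξ i ω, V ω) ∂μ
        ≤ 1657 * ∫ ω, |ξ i ω| ^ (k + 1) ∂μ := by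
      intro k hk hk'
      rw [← integral_const_mul]
      refine integral_le_of_indepFun (Ψ := fun v => |v.1| ^ k * G v)
        (B := fun s => 1657 * |s| ^ (k + 1)) mξ mV ind (by fun_prop) (by fun_prop)
        (iG k hk hk') ((iPow k hk).const_mul _) fun a => ?_
      simp only
      rw [integral_const_mul]
      have := mul_le_mul_of_nonneg_left (mean_G a) (by positivity : 0 ≤ |a| ^ k)
      refine this.trans_eq ?_
      ring
    have z1 : ∫ ω, ξ i ω * f (V ω) ∂μ = 0 := by
      have := (ind.comp (φ := id) (ψ := f) measurable_id mf).integral_fun_mul_eq_mul_integral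
        (h.integrable i).aestronglyMeasurable (mf.comp mV).aestronglyMeasurable
      simp only [Function.comp_def, id] at this
      rw [this, h.mean, zero_mul]
    have z2 : ∫ ω, ξ i ω ^ 2 * f' (V ω) ∂μ = (∫ ω, ξ i ω ^ 2 ∂μ) * ∫ ω, f' (V ω) ∂μ := by
      have := (ind.comp (φ := fun s => s ^ 2) (ψ := f') (by fun_prop)
        mf').integral_fun_mul_eq_mul_integral
        (h.integrable_sq i).aestronglyMeasurable (mf'.comp mV).aestronglyMeasurable
      simpa only [Function.comp_def] using this
    have b1 : |∫ ω, (ξ i ω * f (∑ j, ξ j ω) - ξ i ω * f (V ω) - ξ i ω ^ 2 * f' (V ω)) ∂μ|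
        ≤ 1657 * ∫ ω, |ξ i ω| ^ 3 ∂μ := by
      refine (abs_integral_le_integral_abs).trans ((integral_mono_of_nonneg
        (Filter.Eventually.of_forall fun _ => abs_nonneg _) (iG 2 le_rfl (Or.inr rfl))
        (Filter.Eventually.of_forall fun ω => ?_)).trans (bG 2 le_rfl (Or.inr rfl)))
      have ht := (taylor (ξ i ω) (V ω)).2
      simp only
      rw [eV ω, show ξ i ω * f (V ω + ξ i ω) - ξ i ω * f (V ω) - ξ i ω ^ 2 * f' (V ω)
        = ξ i ω * (f (V ω + ξ i ω) - f (V ω) - ξ i ω * f' (V ω)) by ring, abs_mul]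
      refine (mul_le_mul_of_nonneg_left ht (abs_nonneg _)).trans_eq ?_
      ring
    have b2 : |∫ ω, (f' (∑ j, ξ j ω) - f' (V ω)) ∂μ| ≤ 1657 * ∫ ω, |ξ i ω| ∂μ := by
      refine (abs_integral_le_integral_abs).trans ((integral_mono_of_nonneg
        (Filter.Eventually.of_forall fun _ => abs_nonneg _)
        (iG 0 (by norm_num) (Or.inl rfl))
        (Filter.Eventually.of_forall fun ω => ?_)).trans ?_)
      · have ht := (taylor (ξ i ω) (V ω)).1
        simp only [pow_zero, one_mul]
        rw [eV ω]
        exact ht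
      · simpa using bG 0 (by norm_num) (Or.inl rfl)
    have i12 : Integrable (fun ω => ξ i ω * f (∑ j, ξ j ω) - ξ i ω * f (V ω)) μ :=
      (iff mW (h.integrable i)).sub (iff mV (h.integrable i))
    rw [integral_sub i12
      (iff' mV (h.integrable_sq i)), integral_sub (iff mW (h.integrable i))
      (iff mV (h.integrable i)), z1, z2, sub_zero] at b1
    rw [integral_sub (if' mW) (if' mV)] at b2
    have s0 : 0 ≤ ∫ ω, ξ i ω ^ 2 ∂μ := by positivity
    have b3 := mul_le_mul_of_nonneg_left b2 s0
    have b4 := h.integral_sq_mul_integral_abs_le i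
    have b5 := abs_sub_le (∫ ω, ξ i ω * f (∑ j, ξ j ω) ∂μ)
      ((∫ ω, ξ i ω ^ 2 ∂μ) * ∫ ω, f' (V ω) ∂μ)
      ((∫ ω, ξ i ω ^ 2 ∂μ) * ∫ ω, f' (∑ j, ξ j ω) ∂μ)
    rw [← mul_sub, abs_mul, abs_of_nonneg s0, abs_sub_comm (∫ ω, f' (V ω) ∂μ)] at b5
    linarith
  -- The Stein equation is integrated at `W`. Since the variances sum to one, `𝔼 f'(W)` can be
  -- distributed over the summands.
  have e : ∫ ω, ramp z δ (∑ i, ξ i ω) ∂μ - c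
      = ∑ i, -(∫ ω, ξ i ω * f (∑ j, ξ j ω) ∂μ
        - (∫ ω, ξ i ω ^ 2 ∂μ) * ∫ ω, f' (∑ j, ξ j ω) ∂μ) := by
    have ir : Integrable (fun ω => ramp z δ (∑ i, ξ i ω)) μ :=
      Integrable.of_bound ((continuous_ramp z δ).measurable.comp mW).aestronglyMeasurable 1
        (Filter.Eventually.of_forall fun ω => by
          rw [Real.norm_of_nonneg (ramp_nonneg _ _ _)]; exact ramp_le_one _ _ _)
    have e1 : ∫ ω, f' (∑ j, ξ j ω) ∂μ = ∫ ω, (∑ j, ξ j ω) * f (∑ j, ξ j ω) ∂μ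
        + (∫ ω, ramp z δ (∑ i, ξ i ω) ∂μ - c) := by
      have irc : Integrable (fun ω => ramp z δ (∑ i, ξ i ω) - c) μ := ir.sub (integrable_const c)
      simp only [hf']
      rw [integral_add (iff mW iW) irc,
        integral_sub ir (integrable_const c)]
      simp
    have e2 : ∫ ω, (∑ j, ξ j ω) * f (∑ j, ξ j ω) ∂μ
        = ∑ i, ∫ ω, ξ i ω * f (∑ j, ξ j ω) ∂μ := by
      rw [← integral_finsetSum _ fun i _ => iff mW (h.integrable i)]
      simp only [Finset.sum_mul]
    rw [Finset.sum_neg_distrib, Finset.sum_sub_distrib, ← Finset.sum_mul, h.var, one_mul, e1,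
      e2]
    ring
  rw [e]
  refine (Finset.abs_sum_le_sum_abs _ _).trans ?_
  simp only [abs_neg]
  refine (Finset.sum_le_sum fun i _ => term i).trans ?_
  rw [← Finset.mul_sum]
  exact mul_le_mul_of_nonneg_left hδ (by norm_num)

/-- The Berry–Esseen bound. -/
theorem berry_esseen (h : IsStdSum ξ μ) {δ : ℝ} (hδ0 : 0 < δ)
    (hδ : lyapunov ξ μ ≤ δ) (hi : ∀ i, ∫ ω, |ξ i ω| ∂μ ≤ δ) (z : ℝ) :
    |μ.real {ω | ∑ i, ξ i ω ≤ z} - cdf (gaussianReal 0 1) z| ≤ 3315 * δ := by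
  have := h.isProbabilityMeasure
  have mW := h.measurable_sum
  have g : ∀ a, (gaussianReal 0 1).real {t | t ≤ a} = cdf (gaussianReal 0 1) a := fun a => by
    rw [cdf_eq_real]; rfl
  -- The indicator of `(-∞, z]` is sandwiched between the ramps starting at `z - δ` and at `z`. The
  -- normal mass of a window of width `δ` is at most `δ`, which raises `3314` to `3315`.
  have u1 := (measureReal_Iic_le_integral_ramp (μ := μ) mW z hδ0).1
  have u2 := (abs_le.1 (h.abs_integral_ramp_sub_le hδ0 hδ hi z)).2
  have u3 := (measureReal_Iic_le_integral_ramp (μ := gaussianReal 0 1) measurable_id z hδ0).2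
  have l1 := (measureReal_Iic_le_integral_ramp (μ := μ) mW (z - δ) hδ0).2
  have l2 := (abs_le.1 (h.abs_integral_ramp_sub_le hδ0 hδ hi (z - δ))).1
  have l3 := (measureReal_Iic_le_integral_ramp (μ := gaussianReal 0 1) measurable_id
    (z - δ) hδ0).1
  have c1 := cdf_add_le z hδ0.le
  have c2 := cdf_add_le (z - δ) hδ0.le
  simp only [id, g, sub_add_cancel] at u3 l1 l3 c2
  rw [abs_le]
  constructor <;> linarith

end IsStdSum

end BerryEsseen

namespace BerryEsseen

/-! ### Nonlinear statistics -/

/-- A Berry–Esseen bound for a perturbation `W + Δ` of a standardized sum `W`. -/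
theorem IsStdSum.nonlinear_berry_esseen {Ω ι : Type*} [MeasurableSpace Ω] [Fintype ι]
    {μ : Measure Ω} {ξ : ι → Ω → ℝ} (h : IsStdSum ξ μ) {δ : ℝ} (hδ0 : 0 < δ)
    (hδ : lyapunov ξ μ ≤ δ) (hi : ∀ i, ∫ ω, |ξ i ω| ∂μ ≤ δ) {Δ : Ω → ℝ} {Δ' : ι → Ω → ℝ}
    (mΔ : Measurable Δ) (mΔ' : ∀ i, Measurable (Δ' i)) (hΔ : MemLp Δ 2 μ)
    (hΔ' : ∀ i, MemLp (Δ' i) 2 μ)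
    (hind : ∀ i, IndepFun (ξ i) (fun ω => (truncSum ξ ω - trunc (ξ i ω), Δ' i ω)) μ) (x : ℝ) :
    |μ.real {ω | ∑ i, ξ i ω + Δ ω ≤ x} - cdf (gaussianReal 0 1) x|
      ≤ 3500 * δ + μ.real {ω | (|x| + 1) / 3 < |Δ ω|}
        + 14 * Real.exp 2 * Real.exp (-|x| / 3) * (√(∫ ω, Δ ω ^ 2 ∂μ)
          + ∑ i, √(∫ ω, ξ i ω ^ 2 ∂μ) * √(∫ ω, (Δ ω - Δ' i ω) ^ 2 ∂μ)) := by
  have := h.isProbabilityMeasure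
  set τ := √(∫ ω, Δ ω ^ 2 ∂μ)
    + ∑ i, √(∫ ω, ξ i ω ^ 2 ∂μ) * √(∫ ω, (Δ ω - Δ' i ω) ^ 2 ∂μ) with hτ
  have hτ0 : 0 ≤ τ := by positivity
  have hE0 : 0 ≤ 14 * Real.exp 2 * Real.exp (-|x| / 3) * τ := by positivity
  have hP0 : 0 ≤ μ.real {ω | (|x| + 1) / 3 < |Δ ω|} := measureReal_nonneg
  have hc0 := cdf_nonneg (gaussianReal 0 1) x
  have hc1 := cdf_le_one (gaussianReal 0 1) x
  by_cases hδ4 : δ ≤ 1 / 4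
  swap
  -- For `δ > 1/4` the term `3500 δ` alone exceeds one.
  · have h1 : μ.real {ω | ∑ i, ξ i ω + Δ ω ≤ x} ≤ 1 := measureReal_le_one
    have h2 : 0 ≤ μ.real {ω | ∑ i, ξ i ω + Δ ω ≤ x} := measureReal_nonneg
    have h3 := not_le.1 hδ4
    rw [abs_le]
    constructor <;> linarith
  have hBE := h.berry_esseen hδ0 hδ hi x
  have hcon := h.concentration hδ0 hδ hδ4 mΔ mΔ' hΔ hΔ' hind x
  rw [← hτ] at hcon
  have hnear : μ.real {ω | |∑ i, ξ i ω - x| ≤ |Δ ω|}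
      ≤ μ.real {ω | (|x| + 1) / 3 < |Δ ω|}
        + μ.real {ω | |∑ i, ξ i ω - x| ≤ |Δ ω| ∧ |Δ ω| ≤ (|x| + 1) / 3} := by
    refine (measureReal_mono fun ω hω => ?_).trans (measureReal_union_le _ _)
    rcases lt_or_ge ((|x| + 1) / 3) |Δ ω| with h1 | h1
    · exact Or.inl h1
    · exact Or.inr ⟨hω, h1⟩
  have up : μ.real {ω | ∑ i, ξ i ω + Δ ω ≤ x}
      ≤ μ.real {ω | ∑ i, ξ i ω ≤ x} + μ.real {ω | |∑ i, ξ i ω - x| ≤ |Δ ω|} := by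
    refine (measureReal_mono fun ω hω => ?_).trans (measureReal_union_le _ _)
    have hω' : ∑ i, ξ i ω + Δ ω ≤ x := hω
    rcases le_or_gt (∑ i, ξ i ω) x with h1 | h1
    · exact Or.inl h1
    · refine Or.inr (show |∑ i, ξ i ω - x| ≤ |Δ ω| from abs_le.2 ⟨?_, ?_⟩)
      · linarith [abs_nonneg (Δ ω)]
      · linarith [neg_abs_le (Δ ω)]
  have lo : μ.real {ω | ∑ i, ξ i ω ≤ x}
      ≤ μ.real {ω | ∑ i, ξ i ω + Δ ω ≤ x} + μ.real {ω | |∑ i, ξ i ω - x| ≤ |Δ ω|} := by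
    refine (measureReal_mono fun ω hω => ?_).trans (measureReal_union_le _ _)
    have hω' : ∑ i, ξ i ω ≤ x := hω
    rcases le_or_gt (∑ i, ξ i ω + Δ ω) x with h1 | h1
    · exact Or.inl h1
    · refine Or.inr (show |∑ i, ξ i ω - x| ≤ |Δ ω| from abs_le.2 ⟨?_, ?_⟩)
      · linarith [le_abs_self (Δ ω)]
      · linarith [abs_nonneg (Δ ω)]
  -- The total multiple of `δ` is `3315 + 1 + 105`, below `3500`.
  have hK : 14 * Real.exp 2 * Real.exp (-|x| / 3) * δ ≤ 105 * δ := by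
    have h1 : Real.exp (-|x| / 3) ≤ 1 := Real.exp_le_one_iff.2 (by linarith [abs_nonneg x])
    refine mul_le_mul_of_nonneg_right ?_ hδ0.le
    nlinarith [IsStdSum.exp_two_le, Real.exp_pos 2, Real.exp_pos (-|x| / 3)]
  rw [mul_add] at hcon
  obtain ⟨h1, h2⟩ := abs_le.1 hBE
  rw [abs_le]
  constructor <;> linarith

end BerryEsseen

namespace GaussUStat

/-! ### The Hoeffding decomposition of a symmetric kernel -/

section Hoeffding

variable {E : Type*} [MeasurableSpace E] {P : Measure E}

/-- Selecting distinct coordinates preserves product measures with equal factors. -/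
lemma measurePreserving_comp_injective [IsProbabilityMeasure P]
    {ι κ : Type*} [Fintype ι] [Fintype κ] {e : κ → ι}
    (he : Function.Injective e) :
    MeasurePreserving (fun (x : ι → E) k => x (e k)) (Measure.pi fun _ => P)
      (Measure.pi fun _ => P) := by
  refine ⟨by fun_prop, ?_⟩
  have h := (iIndepFun_pi (μ := fun _ : ι => P) (X := fun _ => id)
    fun _ => aemeasurable_id).precomp he
  have hm := h.map_fun_eq_pi_map fun k =>
    (measurable_pi_apply (X := fun _ : ι => E) (e k)).aemeasurable
  refine hm.trans ?_
  congr 1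
  ext1 k
  exact (measurePreserving_eval (fun _ : ι => P) (e k)).map_eq

variable {m : ℕ} {h : (Fin m → E) → ℝ}

/-- The mean of `h` given the variables in `S`. -/
noncomputable def partialMean (P : Measure E) (h : (Fin m → E) → ℝ) (S : Finset (Fin m))
    (x : Fin m → E) : ℝ :=
  ∫ y, h (S.piecewise x y) ∂Measure.pi fun _ => P

/-- The component of `h` belonging to the set `A` of variables. -/
noncomputable def component (P : Measure E) (h : (Fin m → E) → ℝ) (A : Finset (Fin m))
    (x : Fin m → E) : ℝ :=
  ∑ B ∈ A.powerset, (-1 : ℝ) ^ (A.card - B.card) * partialMean P h B x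

lemma sum_powerset_map {α β M : Type*} [AddCommMonoid M] (e : α ↪ β) (A : Finset α)
    (F : Finset β → M) : ∑ B ∈ (A.map e).powerset, F B = ∑ B ∈ A.powerset, F (B.map e) := by
  symm
  refine Finset.sum_bij (fun B _ => B.map e) ?_ ?_ ?_ fun _ _ => rfl
  · intro B hB
    rw [Finset.mem_powerset] at hB ⊢
    exact Finset.map_subset_map.2 hB
  · intro B _ B' _ hBB
    exact Finset.map_injective e hBB
  · intro C hC
    obtain ⟨B, hB, rfl⟩ := Finset.subset_map_iff.1 (Finset.mem_powerset.1 hC)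
    exact ⟨B, Finset.mem_powerset.2 hB, rfl⟩

/-- The integration variables are permuted along with `x`, which preserves the product measure;
symmetry of `h` then undoes the permutation. The change of variables is a measurable equivalence, so
no measurability of `h` is needed. -/
lemma partialMean_comp_perm [IsProbabilityMeasure P]
    (hsym : ∀ (σ : Equiv.Perm (Fin m)) x, h (fun i => x (σ i)) = h x)
    (S : Finset (Fin m)) (σ : Equiv.Perm (Fin m)) (x : Fin m → E) :
    partialMean P h S (fun i => x (σ i)) = partialMean P h (S.map σ.toEmbedding) x := by
  unfold partialMean
  have hmp := measurePreserving_comp_injective (P := P) σ.injective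
  have he : MeasurableEmbedding fun (y : Fin m → E) k => y (σ k) := by
    let e : (Fin m → E) ≃ᵐ (Fin m → E) :=
      { toFun := fun y k => y (σ k)
        invFun := fun y k => y (σ.symm k)
        left_inv := fun y => by simp
        right_inv := fun y => by simp
        measurable_toFun := by dsimp; fun_prop
        measurable_invFun := by dsimp; fun_prop }
    exact e.measurableEmbedding
  rw [← hmp.integral_comp he]
  refine integral_congr_ae (Filter.Eventually.of_forall fun y => ?_)
  simp only
  rw [← hsym σ ((S.map σ.toEmbedding).piecewise x y)]
  congr 1
  ext1 k
  by_cases hk : k ∈ S <;> simp [Finset.piecewise, hk]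

lemma component_comp_perm [IsProbabilityMeasure P]
    (hsym : ∀ (σ : Equiv.Perm (Fin m)) x, h (fun i => x (σ i)) = h x)
    (A : Finset (Fin m)) (σ : Equiv.Perm (Fin m)) (x : Fin m → E) :
    component P h A (fun i => x (σ i)) = component P h (A.map σ.toEmbedding) x := by
  unfold component
  rw [sum_powerset_map]
  simp only [Finset.card_map, partialMean_comp_perm hsym]

/-- Möbius inversion on subsets. -/
lemma sum_alternating_powerset {α : Type*} [Fintype α] [DecidableEq α] (a : Finset α → ℝ) :
    ∑ A : Finset α, ∑ B ∈ A.powerset, (-1 : ℝ) ^ (A.card - B.card) * a B = a Finset.univ := by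
  have hcomm : ∑ A : Finset α, ∑ B ∈ A.powerset, (-1 : ℝ) ^ (A.card - B.card) * a B
      = ∑ B : Finset α, ∑ A ∈ Finset.univ.filter (B ⊆ ·),
          (-1 : ℝ) ^ (A.card - B.card) * a B :=
    Finset.sum_comm' fun A B => by simp
  rw [hcomm, Finset.sum_eq_single Finset.univ]
  · have : Finset.univ.filter (fun A : Finset α => Finset.univ ⊆ A) = {Finset.univ} := by
      ext A; simp [Finset.univ_subset_iff]
    rw [this, Finset.sum_singleton]
    simp
  · intro B _ hB
    rw [← Finset.sum_mul]
    have e : ∑ A ∈ Finset.univ.filter (B ⊆ ·), (-1 : ℝ) ^ (A.card - B.card)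
        = ∑ C ∈ (Bᶜ).powerset, (-1 : ℝ) ^ C.card := by
      refine Finset.sum_bij (fun A _ => A \ B) ?_ ?_ ?_ ?_
      · intro A _
        rw [Finset.mem_powerset]
        intro t ht
        simpa using (Finset.mem_sdiff.1 ht).2
      · intro A hA A' hA' hAA
        rw [← Finset.sdiff_union_of_subset (Finset.mem_filter.1 hA).2,
          ← Finset.sdiff_union_of_subset (Finset.mem_filter.1 hA').2, hAA]
      · intro C hC
        have hd : Disjoint C B :=
          Finset.subset_compl_iff_disjoint_right.1 (Finset.mem_powerset.1 hC)
        exact ⟨C ∪ B, by simp, by rw [Finset.union_sdiff_cancel_right hd]⟩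
      · intro A hA
        rw [Finset.card_sdiff_of_subset (Finset.mem_filter.1 hA).2]
    have h0 : ∑ C ∈ (Bᶜ).powerset, (-1 : ℝ) ^ C.card = 0 := by
      have := Finset.sum_powerset_neg_one_pow_card (x := Bᶜ)
      rw [if_neg (by simpa using hB)] at this
      exact_mod_cast this
    rw [e, h0, zero_mul]
  · simp

lemma sum_component [IsProbabilityMeasure P] (x : Fin m → E) : ∑ A, component P h A x = h x := by
  unfold component
  rw [sum_alternating_powerset fun B => partialMean P h B x]
  simp [partialMean]

/-- `mixedMean` fixes variables among the first `r`, so the projection of order `r` is the component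
of an initial segment. Symmetry carries it to any other set of size `r`. -/
lemma hoeffdingProj_eq_component {r : ℕ} (hr : r ≤ m) (x : Fin m → E) :
    hoeffdingProj P h r (fun j => x (Fin.castLE hr j))
      = component P h (Finset.univ.map (Fin.castLEEmb hr)) x := by
  unfold component hoeffdingProj
  rw [sum_powerset_map, Finset.powerset_univ]
  refine Finset.sum_congr rfl fun A _ => ?_
  simp only [Finset.card_map, Finset.card_univ, Fintype.card_fin]
  congr 1
  unfold mixedMean partialMean
  congr 1
  ext y
  congr 1
  ext1 i
  by_cases hi : i.val < r
  · have e : i = Fin.castLEEmb hr ⟨i.val, hi⟩ := rfl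
    by_cases hA : (⟨i.val, hi⟩ : Fin r) ∈ A
    · have : i ∈ A.map (Fin.castLEEmb hr) := by rw [e]; exact Finset.mem_map_of_mem _ hA
      simp [hi, hA, Finset.piecewise, this]
    · have : i ∉ A.map (Fin.castLEEmb hr) := by
        rw [e, Finset.mem_map']; exact hA
      simp [hi, hA, Finset.piecewise, this]
  · have : i ∉ A.map (Fin.castLEEmb hr) := by
      intro hmem
      obtain ⟨j, _, rfl⟩ := Finset.mem_map.1 hmem
      exact hi j.isLt
    simp [hi, Finset.piecewise, this]

/-- A component of a symmetric kernel is the Hoeffding projection evaluated at the variables it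
belongs to. -/
lemma component_map_eq [IsProbabilityMeasure P]
    (hsym : ∀ (σ : Equiv.Perm (Fin m)) x, h (fun i => x (σ i)) = h x) {r : ℕ}
    (i : Fin r ↪ Fin m) (x : Fin m → E) :
    component P h (Finset.univ.map i) x = hoeffdingProj P h r (fun j => x (i j)) := by
  have hr : r ≤ m := by simpa using Fintype.card_le_of_embedding i
  obtain ⟨σ, hσ⟩ := Equiv.Perm.exists_extending_pair (Fin.castLEEmb hr) i
    (Fin.castLEEmb hr).injective i.injective
  have e : Finset.univ.map i = (Finset.univ.map (Fin.castLEEmb hr)).map σ.toEmbedding := by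
    rw [Finset.map_map]
    congr 1
    ext1 a
    exact (hσ a).symm
  rw [e, ← component_comp_perm hsym, ← hoeffdingProj_eq_component hr]
  congr 1
  ext1 j
  exact congrArg x (hσ j)

variable {n : ℕ}

/-- The term of the Hoeffding decomposition belonging to a set of observations. -/
noncomputable def hoeffdingTerm (P : Measure E) (h : (Fin m → E) → ℝ) (A : Finset (Fin n))
    (x : Fin n → E) : ℝ :=
  hoeffdingProj P h A.card (fun j => x (A.orderEmbOfFin rfl j))

lemma hoeffdingTerm_image {r : ℕ} {i : Fin r → Fin n} (hi : StrictMono i) (x : Fin n → E) :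
    hoeffdingTerm P h (Finset.univ.image i) x = hoeffdingProj P h r (fun j => x (i j)) := by
  have hc : (Finset.univ.image i).card = r := by
    rw [Finset.card_image_of_injective _ hi.injective]; simp
  unfold hoeffdingTerm
  generalize hA : Finset.univ.image i = A at hc
  subst hc
  rw [← Finset.orderEmbOfFin_unique rfl (fun j => hA ▸ Finset.mem_image_of_mem i
    (Finset.mem_univ j)) hi]

lemma component_eq_hoeffdingTerm [IsProbabilityMeasure P]
    (hsym : ∀ (σ : Equiv.Perm (Fin m)) x, h (fun i => x (σ i)) = h x) {i : Fin m → Fin n}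
    (hi : StrictMono i) (B : Finset (Fin m)) (x : Fin n → E) :
    component P h B (fun j => x (i j)) = hoeffdingTerm P h (B.map ⟨i, hi.injective⟩) x := by
  have e : B = Finset.univ.map (B.orderEmbOfFin rfl).toEmbedding := by
    rw [← Finset.coe_inj]; simp
  have e2 : B.map ⟨i, hi.injective⟩
      = Finset.univ.image fun j => i (B.orderEmbOfFin rfl j) := by
    conv_lhs => rw [e]
    rw [Finset.map_map, Finset.map_eq_image]
    rfl
  rw [e2, hoeffdingTerm_image (i := fun j => i (B.orderEmbOfFin rfl j))
    (hi.comp (B.orderEmbOfFin rfl).strictMono)]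
  conv_lhs => rw [e]
  rw [component_map_eq hsym]
  rfl

lemma kernel_eq_sum_hoeffdingTerm [IsProbabilityMeasure P]
    (hsym : ∀ (σ : Equiv.Perm (Fin m)) x, h (fun i => x (σ i)) = h x) {i : Fin m → Fin n}
    (hi : StrictMono i) (x : Fin n → E) :
    h (fun j => x (i j)) = ∑ A ∈ (Finset.univ.image i).powerset, hoeffdingTerm P h A x := by
  have e : Finset.univ.image i = Finset.univ.map ⟨i, hi.injective⟩ := by
    rw [Finset.map_eq_image]; rfl
  rw [e, sum_powerset_map, Finset.powerset_univ, ← sum_component (P := P) (h := h)]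
  simp only [component_eq_hoeffdingTerm hsym hi]

/-- Increasing tuples correspond to subsets. -/
lemma sum_indexSet (n r : ℕ) (F : Finset (Fin n) → ℝ) :
    ∑ i ∈ indexSet n r, F (Finset.univ.image i)
      = ∑ S ∈ Finset.powersetCard r Finset.univ, F S := by
  classical
  refine Finset.sum_bij (fun i _ => Finset.univ.image i) ?_ ?_ ?_ fun _ _ => rfl
  · intro i hi
    have hi' : StrictMono i := (Finset.mem_filter.1 hi).2
    rw [Finset.mem_powersetCard]
    exact ⟨Finset.subset_univ _, by rw [Finset.card_image_of_injective _ hi'.injective]; simp⟩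
  · intro i hi j hj hij
    have hi' : StrictMono i := (Finset.mem_filter.1 hi).2
    have hj' : StrictMono j := (Finset.mem_filter.1 hj).2
    have hc : (Finset.univ.image i).card = r := by
      rw [Finset.card_image_of_injective _ hi'.injective]; simp
    have h1 := Finset.orderEmbOfFin_unique hc
      (fun a => Finset.mem_image_of_mem i (Finset.mem_univ a)) hi'
    have h2 := Finset.orderEmbOfFin_unique hc (f := j) (fun a => by
      rw [show Finset.univ.image i = Finset.univ.image j from hij]
      exact Finset.mem_image_of_mem j (Finset.mem_univ a)) hj'
    exact h1.trans h2.symm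
  · intro S hS
    have hc := (Finset.mem_powersetCard.1 hS).2
    refine ⟨S.orderEmbOfFin hc, ?_, ?_⟩
    · exact Finset.mem_filter.2 ⟨Finset.mem_univ _, (S.orderEmbOfFin hc).strictMono⟩
    · rw [← Finset.coe_inj]; simp

/-- The weight of a Hoeffding term of order `r`. -/
noncomputable def weight (n m r : ℕ) : ℝ := m.choose r / n.choose r

/-- The Hoeffding decomposition of a U-statistic. -/
lemma uStat_eq_sum [IsProbabilityMeasure P]
    (hsym : ∀ (σ : Equiv.Perm (Fin m)) x, h (fun i => x (σ i)) = h x)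
    (hmn : m ≤ n) (x : Fin n → E) :
    uStat h (fun i (y : Fin n → E) => y i) x
      = ∑ A : Finset (Fin n), weight n m A.card * hoeffdingTerm P h A x := by
  classical
  unfold uStat
  have e1 : ∑ i ∈ indexSet n m, h (fun j => x (i j))
      = ∑ i ∈ indexSet n m, ∑ A ∈ (Finset.univ.image i).powerset, hoeffdingTerm P h A x :=
    Finset.sum_congr rfl fun i hi =>
      kernel_eq_sum_hoeffdingTerm hsym (Finset.mem_filter.1 hi).2 x
  rw [e1, sum_indexSet n m fun S => ∑ A ∈ S.powerset, hoeffdingTerm P h A x]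
  have hcomm : ∑ S ∈ Finset.powersetCard m Finset.univ, ∑ A ∈ S.powerset, hoeffdingTerm P h A x
      = ∑ A : Finset (Fin n), ∑ S ∈ (Finset.powersetCard m Finset.univ).filter (A ⊆ ·),
          hoeffdingTerm P h A x :=
    Finset.sum_comm' fun S A => by simp
  rw [hcomm, Finset.mul_sum]
  refine Finset.sum_congr rfl fun A _ => ?_
  rw [Finset.sum_const, nsmul_eq_mul, ← mul_assoc]
  congr 1
  have hAn : A.card ≤ n := by simpa using Finset.card_le_univ A
  have p1 : (0 : ℝ) < n.choose m := by exact_mod_cast Nat.choose_pos hmn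
  have p2 : (0 : ℝ) < n.choose A.card := by exact_mod_cast Nat.choose_pos hAn
  unfold weight
  -- A set `A` of size `r ≤ m` lies in `(n - r choose m - r)` sets of size `m`, and `(n choose m)(m
  -- choose r) = (n choose r)(n - r choose m - r)`. For `r > m` no such set exists and the weight is
  -- zero as well.
  rcases le_or_gt A.card m with hA | hA
  · rw [Finset.card_filter_powersetCard_subset _ _ _ (Finset.subset_univ A) hA,
      inv_mul_eq_div, div_eq_div_iff p1.ne' p2.ne']
    have := Nat.choose_mul (n := n) hA
    simp only [Finset.card_univ, Fintype.card_fin]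
    rw [mul_comm, mul_comm (m.choose A.card : ℝ)]
    exact_mod_cast this.symm
  · have : (Finset.powersetCard m Finset.univ).filter (A ⊆ ·) = ∅ := by
      refine Finset.filter_eq_empty_iff.2 fun S hS hAS => ?_
      have := Finset.card_le_card hAS
      rw [(Finset.mem_powersetCard.1 hS).2] at this
      omega
    rw [this, Nat.choose_eq_zero_of_lt hA]
    simp

lemma uStat_hoeffdingProj (r : ℕ) (x : Fin n → E) :
    uStat (hoeffdingProj P h r) (fun i (y : Fin n → E) => y i) x
      = ((n.choose r : ℝ))⁻¹ * ∑ A ∈ Finset.powersetCard r Finset.univ, hoeffdingTerm P h A x := by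
  unfold uStat
  rw [← sum_indexSet]
  congr 1
  exact Finset.sum_congr rfl fun i hi => (hoeffdingTerm_image (Finset.mem_filter.1 hi).2 x).symm

lemma hoeffdingRemainder_eq_sum (x : Fin n → E) :
    hoeffdingRemainder P h (fun i (y : Fin n → E) => y i) x
      = ∑ A ∈ Finset.univ.filter (fun A : Finset (Fin n) => 2 ≤ A.card ∧ A.card ≤ m),
        weight n m A.card * hoeffdingTerm P h A x := by
  unfold hoeffdingRemainder
  simp only [uStat_hoeffdingProj]
  have e : ∀ r, (m.choose r : ℝ) * ((n.choose r : ℝ)⁻¹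
      * ∑ A ∈ Finset.powersetCard r Finset.univ, hoeffdingTerm P h A x)
      = ∑ A ∈ Finset.powersetCard r (Finset.univ : Finset (Fin n)),
        weight n m A.card * hoeffdingTerm P h A x := by
    intro r
    rw [Finset.mul_sum, Finset.mul_sum]
    refine Finset.sum_congr rfl fun A hA => ?_
    rw [(Finset.mem_powersetCard.1 hA).2, weight]
    ring
  simp only [e]
  have hcomm : ∑ r ∈ Finset.Icc 2 m, ∑ A ∈ Finset.powersetCard r (Finset.univ : Finset (Fin n)),
        weight n m A.card * hoeffdingTerm P h A x
      = ∑ A ∈ Finset.univ.filter (fun A : Finset (Fin n) => 2 ≤ A.card ∧ A.card ≤ m),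
        ∑ r ∈ {A.card}, weight n m A.card * hoeffdingTerm P h A x :=
    Finset.sum_comm' fun r A => by
      simp only [Finset.mem_Icc, Finset.mem_powersetCard, Finset.subset_univ, true_and,
        Finset.mem_singleton, Finset.mem_filter, Finset.mem_univ]
      constructor
      · rintro ⟨h1, rfl⟩; exact ⟨rfl, h1⟩
      · rintro ⟨rfl, h1⟩; exact ⟨h1, rfl⟩
  rw [hcomm]
  simp only [Finset.sum_singleton]

lemma hoeffdingProj_zero (z : Fin 0 → E) :
    hoeffdingProj P h 0 z = ∫ y, h y ∂Measure.pi fun _ => P := by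
  simp [hoeffdingProj, mixedMean]

lemma hoeffdingProj_one (z : Fin 1 → E) :
    hoeffdingProj P h 1 z = projKernel P h (z 0) - ∫ y, h y ∂Measure.pi fun _ => P := by
  have e : (Finset.univ : Finset (Finset (Fin 1))) = {∅, {0}} := by decide
  have e2 : mixedMean P h {0} z = projKernel P h (z 0) := by
    unfold mixedMean projKernel
    congr 1
    ext y
    congr 1
    ext1 i
    by_cases hi : i.val = 0 <;> simp [hi]
  unfold hoeffdingProj
  rw [e, Finset.sum_pair (by decide), e2]
  simp [mixedMean]
  ring

lemma hoeffdingTerm_singleton (t : Fin n) (x : Fin n → E) :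
    hoeffdingTerm P h {t} x = projKernel P h (x t) - ∫ y, h y ∂Measure.pi fun _ => P := by
  have e : ({t} : Finset (Fin n)) = Finset.univ.image fun _ : Fin 1 => t := by simp
  rw [e, hoeffdingTerm_image (Subsingleton.strictMono _), hoeffdingProj_one]

/-- The Hoeffding decomposition of a U-statistic, by order. -/
lemma uStat_eq_linear_add_remainder [IsProbabilityMeasure P]
    (hsym : ∀ (σ : Equiv.Perm (Fin m)) x, h (fun i => x (σ i)) = h x)
    (hmn : m ≤ n) (h0 : ∫ y, h y ∂(Measure.pi fun _ => P) = 0) (x : Fin n → E) :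
    uStat h (fun i (y : Fin n → E) => y i) x
      = m / n * ∑ t, projKernel P h (x t)
        + hoeffdingRemainder P h (fun i (y : Fin n → E) => y i) x := by
  rw [uStat_eq_sum (P := P) hsym hmn, hoeffdingRemainder_eq_sum,
    ← Finset.sum_filter_add_sum_filter_not Finset.univ
      fun A : Finset (Fin n) => 2 ≤ A.card ∧ A.card ≤ m, add_comm]
  congr 1
  -- Outside the remainder only singletons survive: order zero is `𝔼 h = 0`, and orders above `m`
  -- have weight zero.
  have hz : ∀ A : Finset (Fin n), A.card ≠ 1 → ¬(2 ≤ A.card ∧ A.card ≤ m) →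
      weight n m A.card * hoeffdingTerm P h A x = 0 := by
    intro A h1 h2
    rcases Nat.eq_zero_or_pos A.card with hc | hc
    · rw [Finset.card_eq_zero.1 hc]
      have : hoeffdingTerm P h (∅ : Finset (Fin n)) x = 0 :=
        (hoeffdingProj_zero _).trans h0
      rw [this, mul_zero]
    · rw [weight, Nat.choose_eq_zero_of_lt (by omega : m < A.card)]
      simp
  have hs : ∑ A ∈ Finset.univ.filter (fun A : Finset (Fin n) => ¬(2 ≤ A.card ∧ A.card ≤ m)),
      weight n m A.card * hoeffdingTerm P h A x
      = ∑ A ∈ Finset.powersetCard 1 (Finset.univ : Finset (Fin n)),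
        weight n m A.card * hoeffdingTerm P h A x := by
    symm
    refine Finset.sum_subset (fun A hA => ?_) fun A hA hA' => ?_
    · have := (Finset.mem_powersetCard.1 hA).2
      simp [this]
    · refine hz A (fun hc => hA' ?_) (Finset.mem_filter.1 hA).2
      exact Finset.mem_powersetCard.2 ⟨Finset.subset_univ _, hc⟩
  rw [hs, Finset.powersetCard_one, Finset.sum_map, Finset.mul_sum]
  refine Finset.sum_congr rfl fun t _ => ?_
  simp only [Function.Embedding.coeFn_mk, Finset.card_singleton, hoeffdingTerm_singleton, h0,
    sub_zero, weight, Nat.choose_one_right]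

end Hoeffding

end GaussUStat

namespace GaussUStat

/-! ### Sums of products of functions of one variable -/

section ProdSpan

variable {E : Type*}

/-- The linear span of the products `∏ φ_i(x_i)` with factors in `Q`. -/
noncomputable def prodSpan (Q : Set (E → ℝ)) (ι : Type*) [Fintype ι] :
    Submodule ℝ ((ι → E) → ℝ) :=
  Submodule.span ℝ {F | ∃ φ : ι → E → ℝ, (∀ i, φ i ∈ Q) ∧ F = fun x => ∏ i, φ i (x i)}

lemma prodSpan_mono {Q Q' : Set (E → ℝ)} (hQ : Q ⊆ Q') (ι : Type*) [Fintype ι] :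
    prodSpan Q ι ≤ prodSpan Q' ι :=
  Submodule.span_mono fun _ ⟨φ, hφ, e⟩ => ⟨φ, fun i => hQ (hφ i), e⟩

lemma prod_mem_prodSpan {Q : Set (E → ℝ)} {ι : Type*} [Fintype ι] {φ : ι → E → ℝ}
    (hφ : ∀ i, φ i ∈ Q) : (fun x => ∏ i, φ i (x i)) ∈ prodSpan Q ι :=
  Submodule.subset_span ⟨φ, hφ, rfl⟩

lemma one_mem_prodSpan {Q : Set (E → ℝ)} : (fun _ => 1) ∈ prodSpan Q (Fin 0) := by
  have : (fun x : Fin 0 → E => ∏ i, (Fin.elim0 i : E → ℝ) (x i)) ∈ prodSpan Q (Fin 0) :=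
    prod_mem_prodSpan fun i => i.elim0
  simpa using this

/-- Variables that are not selected receive the factor one. This brings products over different sets
of variables to a common index set, where integrals factor. -/
lemma prod_comp_eq_prod_extend {ι κ : Type*} [Fintype ι] [Fintype κ] {i : κ → ι}
    (hi : Function.Injective i) (φ : κ → E → ℝ) (x : ι → E) :
    ∏ a, φ a (x (i a)) = ∏ t, Function.extend i φ (fun _ _ => 1) t (x t) := by
  refine Fintype.prod_of_injective i hi _ _ (fun t ht => ?_) fun a => ?_
  · rw [Function.extend_apply' _ _ _ (fun ⟨a, ha⟩ => ht ⟨a, ha⟩)]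
  · rw [hi.extend_apply]

lemma exists_extension [Nonempty E] {m r : ℕ} (hr : r ≤ m) :
    ∃ ext : (Fin r → E) → Fin m → E, ∀ z j, ext z (Fin.castLE hr j) = z j := by
  exact ⟨fun z j => if hj : j.val < r then z ⟨j, hj⟩ else Classical.arbitrary E, fun z j => by simp⟩

variable [MeasurableSpace E] {P : Measure E}

lemma integral_prod_pi [SigmaFinite P] {ι : Type*} [Fintype ι] (f : ι → E → ℝ) :
    ∫ x : ι → E, ∏ i, f i (x i) ∂(Measure.pi fun _ => P) = ∏ i, ∫ y, f i y ∂P :=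
  integral_fintype_prod_eq_prod (𝕜 := ℝ) f

lemma component_smul {m : ℕ} (c : ℝ) (F : (Fin m → E) → ℝ) (A : Finset (Fin m)) (x : Fin m → E) :
    component P (c • F) A x = c * component P F A x := by
  unfold component partialMean
  rw [Finset.mul_sum]
  refine Finset.sum_congr rfl fun B _ => ?_
  simp only [Pi.smul_apply, smul_eq_mul]
  rw [integral_const_mul]
  ring

/-- Measurable functions with a finite third moment. -/
def cubeIntegrable (P : Measure E) : Set (E → ℝ) := {φ | Measurable φ ∧ MemLp φ 3 P}

/-- Centred measurable functions with a finite third moment. -/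
def centredCubeIntegrable (P : Measure E) : Set (E → ℝ) :=
  {φ | φ ∈ cubeIntegrable P ∧ ∫ x, φ x ∂P = 0}

lemma centredCubeIntegrable_subset : centredCubeIntegrable P ⊆ cubeIntegrable P :=
  fun _ h => h.1

section

variable {ι : Type*} [Fintype ι] {F : (ι → E) → ℝ}

lemma measurable_of_mem_prodSpan (hF : F ∈ prodSpan (cubeIntegrable P) ι) : Measurable F := by
  induction hF using Submodule.span_induction with
  | mem F hF =>
    obtain ⟨φ, hφ, rfl⟩ := hF
    exact Finset.measurable_fun_prod _ fun i _ => (hφ i).1.comp (measurable_pi_apply i)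
  | zero => exact measurable_const
  | add F G _ _ hF hG => exact hF.add hG
  | smul c F _ hF => exact hF.const_smul c

variable [IsProbabilityMeasure P]

lemma memLp_of_mem_prodSpan (hF : F ∈ prodSpan (cubeIntegrable P) ι) :
    MemLp F 3 (Measure.pi fun _ => P) := by
  induction hF using Submodule.span_induction with
  | mem F hF =>
    obtain ⟨φ, hφ, rfl⟩ := hF
    have hm := measurable_of_mem_prodSpan (prod_mem_prodSpan hφ)
    rw [← integrable_norm_rpow_iff hm.aestronglyMeasurable (by norm_num) (by norm_num)]
    have hi : ∀ i, Integrable (fun x => ‖φ i x‖ ^ 3) P := fun i =>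
      (hφ i).2.integrable_norm_pow (by norm_num : (3 : ℕ) ≠ 0)
    refine (Integrable.fintype_prod hi).congr (Filter.Eventually.of_forall fun x => ?_)
    simp only [norm_prod, Finset.prod_pow, ENNReal.toReal_ofNat]
    norm_cast
  | zero => exact MemLp.zero
  | add F G _ _ hF hG => exact hF.add hG
  | smul c F _ hF => exact hF.const_smul c

lemma memLp_two_of_mem_prodSpan (hF : F ∈ prodSpan (cubeIntegrable P) ι) :
    MemLp F 2 (Measure.pi fun _ => P) :=
  (memLp_of_mem_prodSpan hF).mono_exponent (by norm_num)

lemma integrable_of_mem_cubeIntegrable {φ : E → ℝ} (hφ : φ ∈ cubeIntegrable P) :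
    Integrable φ P :=
  hφ.2.integrable (by norm_num)

end

/-! ### Hoeffding components of sums of products. -/

section Component

variable {m : ℕ} [IsProbabilityMeasure P]

lemma integrable_piecewise {h : (Fin m → E) → ℝ} (hh : h ∈ prodSpan (cubeIntegrable P) (Fin m))
    (S : Finset (Fin m)) (x : Fin m → E) :
    Integrable (fun y => h (S.piecewise x y)) (Measure.pi fun _ => P) := by
  induction hh using Submodule.span_induction with
  | mem F hF =>
    obtain ⟨φ, hφ, rfl⟩ := hF
    have hi : ∀ i, Integrable (fun y => if i ∈ S then φ i (x i) else φ i y) P := by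
      intro i
      split_ifs
      · exact integrable_const _
      · exact integrable_of_mem_cubeIntegrable (hφ i)
    refine (Integrable.fintype_prod hi).congr (Filter.Eventually.of_forall fun y => ?_)
    refine Finset.prod_congr rfl fun i _ => ?_
    by_cases hS : i ∈ S <;> simp [hS]
  | zero => simp
  | add F G _ _ hF hG => exact hF.add hG
  | smul c F _ hF => exact hF.smul c

lemma component_add {F G : (Fin m → E) → ℝ} (hF : F ∈ prodSpan (cubeIntegrable P) (Fin m))
    (hG : G ∈ prodSpan (cubeIntegrable P) (Fin m)) (A : Finset (Fin m)) (x : Fin m → E) :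
    component P (F + G) A x = component P F A x + component P G A x := by
  unfold component partialMean
  rw [← Finset.sum_add_distrib]
  refine Finset.sum_congr rfl fun B _ => ?_
  simp only [Pi.add_apply]
  rw [integral_add (integrable_piecewise hF B x) (integrable_piecewise hG B x), mul_add]

/-- A partial mean replaces each averaged factor by its integral. The alternating sum over `B ⊆ A`
is then the expansion of the product of the centred factors over `A`. -/
lemma component_prod (φ : Fin m → E → ℝ) (A : Finset (Fin m)) (x : Fin m → E) :
    component P (fun x => ∏ i, φ i (x i)) A x
      = (∏ i ∈ A, (φ i (x i) - ∫ y, φ i y ∂P)) * ∏ i ∈ Aᶜ, ∫ y, φ i y ∂P := by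
  have hpm : ∀ B, partialMean P (fun x => ∏ i, φ i (x i)) B x
      = (∏ i ∈ B, φ i (x i)) * ∏ i ∈ Bᶜ, ∫ y, φ i y ∂P := by
    intro B
    unfold partialMean
    have e : ∀ y : Fin m → E, ∏ i, φ i (B.piecewise x y i)
        = ∏ i, (fun i y => if i ∈ B then φ i (x i) else φ i y : Fin m → E → ℝ) i (y i) := by
      intro y
      refine Finset.prod_congr rfl fun i _ => ?_
      by_cases hS : i ∈ B <;> simp [hS]
    refine (integral_congr_ae (Filter.Eventually.of_forall e)).trans
      ((integral_prod_pi (P := P) (fun i y => if i ∈ B then φ i (x i) else φ i y)).trans ?_)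
    rw [← Finset.prod_mul_prod_compl B]
    congr 1
    · exact Finset.prod_congr rfl fun i hi => by simp [hi]
    · exact Finset.prod_congr rfl fun i hi => by simp [Finset.mem_compl.1 hi]
  unfold component
  simp only [hpm, sub_eq_add_neg]
  rw [Finset.prod_add, Finset.sum_mul]
  refine Finset.sum_congr rfl fun B hB => ?_
  have hBA := Finset.mem_powerset.1 hB
  have e1 : ∏ i ∈ Bᶜ, ∫ y, φ i y ∂P
      = (∏ i ∈ A \ B, ∫ y, φ i y ∂P) * ∏ i ∈ Aᶜ, ∫ y, φ i y ∂P := by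
    rw [← Finset.prod_sdiff (Finset.compl_subset_compl.2 hBA)]
    congr 2
    ext i; simp; tauto
  rw [e1, Finset.prod_neg, Finset.card_sdiff_of_subset hBA]
  ring

/-- The Hoeffding projections of a sum of products are sums of products of centred functions. -/
lemma hoeffdingProj_mem_prodSpan {h : (Fin m → E) → ℝ}
    (hh : h ∈ prodSpan (cubeIntegrable P) (Fin m)) {r : ℕ} (hr : r ≤ m) :
    hoeffdingProj P h r ∈ prodSpan (centredCubeIntegrable P) (Fin r) := by
  have : Nonempty E := nonempty_of_isProbabilityMeasure P
  obtain ⟨ext, hext⟩ := exists_extension (E := E) hr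
  have key : ∀ F : (Fin m → E) → ℝ, hoeffdingProj P F r
      = fun z => component P F (Finset.univ.map (Fin.castLEEmb hr)) (ext z) := by
    intro F
    ext z
    rw [← hoeffdingProj_eq_component hr]
    simp only [hext]
  induction hh using Submodule.span_induction with
  | mem F hF =>
    obtain ⟨φ, hφ, rfl⟩ := hF
    rw [key]
    simp only [component_prod, Finset.prod_map, Fin.castLEEmb_apply, hext]
    set c := ∏ i ∈ (Finset.univ.map (Fin.castLEEmb hr))ᶜ, ∫ y, φ i y ∂P
    have hp : (fun z : Fin r → E => ∏ j : Fin r,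
        (fun x => φ (Fin.castLE hr j) x - ∫ y, φ (Fin.castLE hr j) y ∂P) (z j))
        ∈ prodSpan (centredCubeIntegrable P) (Fin r) := by
      refine prod_mem_prodSpan (φ := fun j x => φ (Fin.castLE hr j) x
        - ∫ y, φ (Fin.castLE hr j) y ∂P) fun j => ⟨⟨(hφ _).1.sub_const _,
        (hφ _).2.sub (memLp_const _)⟩, ?_⟩
      rw [integral_sub (integrable_of_mem_cubeIntegrable (hφ _)) (integrable_const _)]
      simp
    have := Submodule.smul_mem _ c hp
    convert this using 1
    ext z
    simp [mul_comm]
  | zero =>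
    have : hoeffdingProj P (0 : (Fin m → E) → ℝ) r = 0 := by
      ext z; simp [hoeffdingProj, mixedMean]
    rw [this]
    exact Submodule.zero_mem _
  | add F G hF hG ihF ihG =>
    have : hoeffdingProj P (F + G) r = hoeffdingProj P F r + hoeffdingProj P G r := by
      rw [key, key, key]; ext z; exact component_add hF hG _ _
    rw [this]
    exact Submodule.add_mem _ ihF ihG
  | smul c F _ ihF =>
    have : hoeffdingProj P (c • F) r = c • hoeffdingProj P F r := by
      rw [key, key]; ext z; exact component_smul c F _ _
    rw [this]
    exact Submodule.smul_mem _ c ihF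

end Component

/-! ### Orthogonality -/

section Orthogonality

variable [IsProbabilityMeasure P] {ι κ κ' : Type*} [Fintype ι] [Fintype κ] [Fintype κ']

lemma memLp_two_comp_injective {i : κ → ι} (hi : Function.Injective i) {k : (κ → E) → ℝ}
    (hk : k ∈ prodSpan (cubeIntegrable P) κ) :
    MemLp (fun x : ι → E => k fun a => x (i a)) 2 (Measure.pi fun _ => P) :=
  (memLp_two_of_mem_prodSpan hk).comp_measurePreserving (measurePreserving_comp_injective hi)

/-- Completely degenerate functions are orthogonal to functions which do not involve all of their
variables. -/
lemma integral_mul_eq_zero {i : κ → ι} (hi : Function.Injective i) {j : κ' → ι}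
    (hj : Function.Injective j) {a : κ} (ha : i a ∉ Set.range j) {k : (κ → E) → ℝ}
    (hk : k ∈ prodSpan (centredCubeIntegrable P) κ) {l : (κ' → E) → ℝ}
    (hl : l ∈ prodSpan (cubeIntegrable P) κ') :
    ∫ x : ι → E, (k fun b => x (i b)) * (l fun b => x (j b)) ∂(Measure.pi fun _ => P) = 0 := by
  have sub := prodSpan_mono (centredCubeIntegrable_subset (P := P)) κ
  have int : ∀ {k l}, k ∈ prodSpan (centredCubeIntegrable P) κ →
      l ∈ prodSpan (cubeIntegrable P) κ' → Integrable (fun x : ι → E =>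
        (k fun b => x (i b)) * (l fun b => x (j b))) (Measure.pi fun _ => P) := fun hk hl =>
    BerryEsseen.integrable_fun_mul (memLp_two_comp_injective hi (sub hk))
      (memLp_two_comp_injective hj hl)
  induction hk using Submodule.span_induction with
  | zero => simp
  | add k k' hk hk' ih ih' =>
    simp only [Pi.add_apply, add_mul]
    rw [integral_add (int hk hl) (int hk' hl), ih, ih', add_zero]
  | smul c k hk ih =>
    simp only [Pi.smul_apply, smul_eq_mul, mul_assoc]
    rw [integral_const_mul, ih, mul_zero]
  | mem k hk =>
    obtain ⟨φ, hφ, rfl⟩ := hk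
    have hk : (fun x => ∏ i, φ i (x i)) ∈ prodSpan (centredCubeIntegrable P) κ :=
      prod_mem_prodSpan hφ
    induction hl using Submodule.span_induction with
    | zero => simp
    | add l l' hl hl' ih ih' =>
      simp only [Pi.add_apply, mul_add]
      rw [integral_add (int hk hl) (int hk hl'), ih, ih', add_zero]
    | smul c l hl ih =>
      simp only [Pi.smul_apply, smul_eq_mul, mul_left_comm _ c]
      rw [integral_const_mul, ih, mul_zero]
    | mem l hl =>
      obtain ⟨ψ, hψ, rfl⟩ := hl
      have e : ∀ x : ι → E, (∏ b, φ b (x (i b))) * (∏ b, ψ b (x (j b)))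
          = ∏ t, (fun t y => Function.extend i φ (fun _ _ => 1) t y
            * Function.extend j ψ (fun _ _ => 1) t y : ι → E → ℝ) t (x t) := by
        intro x
        rw [prod_comp_eq_prod_extend hi, prod_comp_eq_prod_extend hj, Finset.prod_mul_distrib]
      refine (integral_congr_ae (Filter.Eventually.of_forall e)).trans
        ((integral_prod_pi (P := P) fun t y => Function.extend i φ (fun _ _ => 1) t y
          * Function.extend j ψ (fun _ _ => 1) t y).trans ?_)
      -- The variable `i a` occurs only in the centred factor `φ a`, so its one-dimensional integral
      -- vanishes.
      refine Finset.prod_eq_zero (Finset.mem_univ (i a)) ?_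
      rw [hi.extend_apply, Function.extend_apply' _ _ _ (fun ⟨b, hb⟩ => ha ⟨b, hb⟩)]
      simpa using (hφ a).2

/-- This is orthogonality to the constant one, viewed as a function of no variables. -/
lemma integral_eq_zero_of_mem {i : κ → ι} (hi : Function.Injective i) [Nonempty κ]
    {k : (κ → E) → ℝ} (hk : k ∈ prodSpan (centredCubeIntegrable P) κ) :
    ∫ x : ι → E, (k fun b => x (i b)) ∂(Measure.pi fun _ => P) = 0 := by
  have := integral_mul_eq_zero (P := P) hi (j := (Fin.elim0 : Fin 0 → ι))
    (fun a => a.elim0) (a := Classical.arbitrary κ) (by simp) hk one_mem_prodSpan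
  simpa using this

end Orthogonality

end ProdSpan

end GaussUStat

namespace GaussUStat

/-! ### Variances in the Hoeffding decomposition -/

section Variance

variable {E : Type*} [MeasurableSpace E] {P : Measure E} {m n : ℕ} {h : (Fin m → E) → ℝ}

/-- The second moment of the Hoeffding projection of order `r`. -/
noncomputable def projVar (P : Measure E) (h : (Fin m → E) → ℝ) (r : ℕ) : ℝ :=
  ∫ z, hoeffdingProj P h r z ^ 2 ∂Measure.pi fun _ => P

lemma projVar_nonneg (P : Measure E) (h : (Fin m → E) → ℝ) (r : ℕ) : 0 ≤ projVar P h r :=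
  integral_nonneg fun _ => sq_nonneg _

lemma hoeffdingTerm_update {A : Finset (Fin n)} {t : Fin n} (ht : t ∉ A) (x : Fin n → E) (e : E) :
    hoeffdingTerm P h A (Function.update x t e) = hoeffdingTerm P h A x := by
  unfold hoeffdingTerm
  congr 1
  ext1 j
  rw [Function.update_of_ne]
  rintro rfl
  exact ht (A.orderEmbOfFin_mem rfl j)

variable [IsProbabilityMeasure P]

lemma hoeffdingProj_mem (hh : h ∈ prodSpan (cubeIntegrable P) (Fin m)) {r : ℕ} (hr : r ≤ m) :
    hoeffdingProj P h r ∈ prodSpan (cubeIntegrable P) (Fin r) :=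
  prodSpan_mono centredCubeIntegrable_subset _ (hoeffdingProj_mem_prodSpan hh hr)

lemma measurable_hoeffdingTerm (hh : h ∈ prodSpan (cubeIntegrable P) (Fin m))
    {A : Finset (Fin n)} (hA : A.card ≤ m) : Measurable (hoeffdingTerm P h A) :=
  (measurable_of_mem_prodSpan (hoeffdingProj_mem hh hA)).comp (by fun_prop)

lemma memLp_hoeffdingTerm (hh : h ∈ prodSpan (cubeIntegrable P) (Fin m))
    {A : Finset (Fin n)} (hA : A.card ≤ m) :
    MemLp (hoeffdingTerm P h A) 2 (Measure.pi fun _ => P) :=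
  memLp_two_comp_injective (A.orderEmbOfFin rfl).injective (hoeffdingProj_mem hh hA)

lemma integral_hoeffdingTerm_mul_of_not_subset (hh : h ∈ prodSpan (cubeIntegrable P) (Fin m))
    {A B : Finset (Fin n)} (hA : A.card ≤ m) (hB : B.card ≤ m) (hAB : ¬A ⊆ B) :
    ∫ x, hoeffdingTerm P h A x * hoeffdingTerm P h B x ∂(Measure.pi fun _ => P) = 0 := by
  obtain ⟨t, htA, htB⟩ := Finset.not_subset.1 hAB
  have hr : t ∈ Set.range (A.orderEmbOfFin rfl) := by simpa using htA
  obtain ⟨a, rfl⟩ := hr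
  exact integral_mul_eq_zero (a := a) (A.orderEmbOfFin rfl).injective
    (B.orderEmbOfFin rfl).injective (by simpa using htB) (hoeffdingProj_mem_prodSpan hh hA)
    (hoeffdingProj_mem hh hB)

lemma integral_hoeffdingTerm_mul (hh : h ∈ prodSpan (cubeIntegrable P) (Fin m))
    {A B : Finset (Fin n)} (hA : A.card ≤ m) (hB : B.card ≤ m) (hAB : A ≠ B) :
    ∫ x, hoeffdingTerm P h A x * hoeffdingTerm P h B x ∂(Measure.pi fun _ => P) = 0 := by
  by_cases h1 : A ⊆ B
  · have h2 : ¬B ⊆ A := fun h2 => hAB (h1.antisymm h2)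
    simp only [mul_comm (hoeffdingTerm P h A _)]
    exact integral_hoeffdingTerm_mul_of_not_subset hh hB hA h2
  · exact integral_hoeffdingTerm_mul_of_not_subset hh hA hB h1

lemma integral_hoeffdingTerm_sq (hh : h ∈ prodSpan (cubeIntegrable P) (Fin m))
    {A : Finset (Fin n)} (hA : A.card ≤ m) :
    ∫ x, hoeffdingTerm P h A x * hoeffdingTerm P h A x ∂(Measure.pi fun _ => P)
      = projVar P h A.card := by
  have hmp := measurePreserving_comp_injective (P := P) (A.orderEmbOfFin rfl).injective
  have hm := (measurable_of_mem_prodSpan (hoeffdingProj_mem hh hA)).pow_const 2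
  unfold projVar
  rw [← hmp.map_eq, integral_map hmp.measurable.aemeasurable hm.aestronglyMeasurable]
  simp only [hoeffdingTerm, sq]

/-- The terms of the Hoeffding decomposition are orthogonal. -/
lemma integral_sum_hoeffdingTerm_sq (hh : h ∈ prodSpan (cubeIntegrable P) (Fin m))
    {J : Finset (Finset (Fin n))} (hJ : ∀ A ∈ J, A.card ≤ m) (c : Finset (Fin n) → ℝ) :
    ∫ x, (∑ A ∈ J, c A * hoeffdingTerm P h A x) ^ 2 ∂(Measure.pi fun _ => P)
      = ∑ A ∈ J, c A ^ 2 * projVar P h A.card := by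
  have hint : ∀ A ∈ J, ∀ B ∈ J, Integrable (fun x => c A * c B *
      (hoeffdingTerm P h A x * hoeffdingTerm P h B x)) (Measure.pi fun _ => P) :=
    fun A hA B hB => (BerryEsseen.integrable_fun_mul (memLp_hoeffdingTerm hh (hJ A hA))
      (memLp_hoeffdingTerm hh (hJ B hB))).const_mul _
  have e : ∀ x, (∑ A ∈ J, c A * hoeffdingTerm P h A x) ^ 2
      = ∑ A ∈ J, ∑ B ∈ J, c A * c B * (hoeffdingTerm P h A x * hoeffdingTerm P h B x) := by
    intro x
    rw [sq, Finset.sum_mul_sum]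
    exact Finset.sum_congr rfl fun A _ => Finset.sum_congr rfl fun B _ => by ring
  simp only [e]
  rw [integral_finsetSum _ fun A hA => integrable_finsetSum _ fun B hB => hint A hA B hB]
  refine Finset.sum_congr rfl fun A hA => ?_
  rw [integral_finsetSum _ fun B hB => hint A hA B hB, Finset.sum_eq_single_of_mem A hA]
  · rw [integral_const_mul, integral_hoeffdingTerm_sq hh (hJ A hA), sq]
  · intro B hB hBA
    rw [integral_const_mul, integral_hoeffdingTerm_mul hh (hJ A hA) (hJ B hB) hBA.symm, mul_zero]

/-- With `n = m` and the identity as index tuple, the orthogonal decomposition is that of `h`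
itself. Its terms are grouped by cardinality. -/
lemma sigmaH_sq (hsym : ∀ (σ : Equiv.Perm (Fin m)) x, h (fun i => x (σ i)) = h x)
    (hh : h ∈ prodSpan (cubeIntegrable P) (Fin m))
    (h0 : ∫ y, h y ∂(Measure.pi fun _ => P) = 0) :
    sigmaH P h ^ 2 = ∑ r ∈ Finset.range (m + 1), m.choose r * projVar P h r := by
  have e : ∀ x, ∑ A : Finset (Fin m), hoeffdingTerm P h A x = h x := by
    intro x
    have := kernel_eq_sum_hoeffdingTerm (P := P) hsym (i := id) strictMono_id x
    simpa using this.symm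
  have hv := integral_sum_hoeffdingTerm_sq (n := m) hh (J := Finset.univ)
    (fun A _ => by simpa using Finset.card_le_univ A) fun _ => 1
  simp only [one_pow, one_mul, e] at hv
  rw [sigmaH, Real.sq_sqrt (variance_nonneg _ _), variance_of_integral_eq_zero
    (measurable_of_mem_prodSpan hh).aemeasurable h0, hv, ← Finset.powerset_univ,
    Finset.sum_powerset_apply_card]
  simp

end Variance

/-- Equality holds at `r = 2`, and `r * weight n m r` decreases afterwards: consecutive values have
ratio `(r + 1)(m - r) / (r (n - r))`. This is at most one because `2m < n` gives `n - r ≥ 2 (m -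
r)`, and `r + 1 ≤ 2r`. -/
lemma mul_weight_le {m n r : ℕ} (hmn : 2 * m < n) (hr2 : 2 ≤ r) (hrm : r ≤ m) :
    r * weight n m r ≤ 2 * (m * ((m : ℝ) - 1) / (n * ((n : ℝ) - 1))) := by
  have hn1 : (1 : ℝ) < n := by exact_mod_cast (by omega : 1 < n)
  have key : ∀ r : ℕ, 2 ≤ r → r ≤ m →
      (r : ℝ) * m.choose r * (n * ((n : ℝ) - 1)) ≤ 2 * (m * ((m : ℝ) - 1)) * n.choose r := by
    intro r hr2
    induction r, hr2 using Nat.le_induction with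
    | base =>
      intro _
      rw [Nat.cast_choose_two, Nat.cast_choose_two]
      push_cast
      apply le_of_eq
      ring
    | succ r hr2 ih =>
      intro hrm
      have ih' := ih (by omega)
      have c1 : (m.choose (r + 1) : ℝ) * (r + 1) = m.choose r * (m - r) := by
        have := Nat.choose_succ_right_eq m r
        rw [← Nat.cast_sub (by omega : r ≤ m)]
        exact_mod_cast this
      have c2 : (n.choose (r + 1) : ℝ) * (r + 1) = n.choose r * (n - r) := by
        have := Nat.choose_succ_right_eq n r
        rw [← Nat.cast_sub (by omega : r ≤ n)]
        exact_mod_cast this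
      have hr0 : (2 : ℝ) ≤ r := by exact_mod_cast hr2
      have hmr : (0 : ℝ) ≤ m - r := sub_nonneg.2 (by exact_mod_cast (by omega : r ≤ m))
      have hnr : 2 * ((m : ℝ) - r) ≤ n - r := by
        have : (2 * m : ℝ) < n := by exact_mod_cast hmn
        linarith
      have hr1 : (0 : ℝ) < r + 1 := by linarith
      have hN : (0 : ℝ) ≤ n * ((n : ℝ) - 1) := by
        have : (0 : ℝ) ≤ (n : ℝ) - 1 := by linarith
        positivity
      refine le_of_mul_le_mul_right ?_ hr1
      push_cast
      calc ((r : ℝ) + 1) * m.choose (r + 1) * (n * ((n : ℝ) - 1)) * (r + 1)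
          = (r + 1) * (m - r) * (m.choose r * (n * ((n : ℝ) - 1))) := by
            rw [show ((r : ℝ) + 1) * m.choose (r + 1) * (n * ((n : ℝ) - 1)) * (r + 1)
              = (m.choose (r + 1) * ((r : ℝ) + 1)) * (r + 1) * (n * ((n : ℝ) - 1)) by ring, c1]
            ring
        _ ≤ r * (n - r) * (m.choose r * (n * ((n : ℝ) - 1))) := by
            refine mul_le_mul_of_nonneg_right ?_ (by positivity)
            nlinarith
        _ = (r * m.choose r * (n * ((n : ℝ) - 1))) * (n - r) := by ring
        _ ≤ (2 * (m * ((m : ℝ) - 1)) * n.choose r) * (n - r) :=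
            mul_le_mul_of_nonneg_right ih' (by linarith)
        _ = 2 * (m * ((m : ℝ) - 1)) * n.choose (r + 1) * (r + 1) := by
            rw [mul_assoc, ← c2]; ring
  have p : (0 : ℝ) < n.choose r := by exact_mod_cast Nat.choose_pos (by omega : r ≤ n)
  have hN : (0 : ℝ) < n * ((n : ℝ) - 1) := mul_pos (by linarith) (by linarith)
  rw [weight, ← mul_div_assoc, ← mul_div_assoc, div_le_div_iff₀ p hN]
  exact key r hr2 hrm

/-! ### Second moments of the remainder and of its dependence on one observation. -/

section Remainder

variable {E : Type*} [MeasurableSpace E] {P : Measure E} {m n : ℕ} {h : (Fin m → E) → ℝ}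

/-- The sets of observations which enter the remainder of the Hoeffding decomposition. -/
def higherSets (n m : ℕ) : Finset (Finset (Fin n)) :=
  Finset.univ.filter fun A => 2 ≤ A.card ∧ A.card ≤ m

lemma card_le_of_mem_higherSets {A : Finset (Fin n)} (hA : A ∈ higherSets n m) : A.card ≤ m :=
  (Finset.mem_filter.1 hA).2.2

/-- The part of the remainder which does not involve the observation `t`. -/
noncomputable def remainderWithout (P : Measure E) (h : (Fin m → E) → ℝ) (t : Fin n)
    (x : Fin n → E) : ℝ :=
  ∑ A ∈ (higherSets n m).filter (t ∉ ·), weight n m A.card * hoeffdingTerm P h A x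

/-- The remainder of the Hoeffding decomposition on the canonical space. -/
noncomputable def remainder (P : Measure E) (h : (Fin m → E) → ℝ) (x : Fin n → E) : ℝ :=
  ∑ A ∈ higherSets n m, weight n m A.card * hoeffdingTerm P h A x

lemma remainder_sub_remainderWithout (t : Fin n) (x : Fin n → E) :
    remainder P h x - remainderWithout P h t x
      = ∑ A ∈ (higherSets n m).filter (t ∈ ·), weight n m A.card * hoeffdingTerm P h A x := by
  unfold remainder remainderWithout
  rw [← Finset.sum_filter_add_sum_filter_not (higherSets n m) (t ∈ ·), add_sub_cancel_right]

lemma remainderWithout_update (t : Fin n) (x : Fin n → E) (e : E) :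
    remainderWithout P h t (Function.update x t e) = remainderWithout P h t x := by
  unfold remainderWithout
  refine Finset.sum_congr rfl fun A hA => ?_
  rw [hoeffdingTerm_update (Finset.mem_filter.1 hA).2]

variable [IsProbabilityMeasure P]

lemma measurable_sum_hoeffdingTerm (hh : h ∈ prodSpan (cubeIntegrable P) (Fin m))
    {J : Finset (Finset (Fin n))} (hJ : J ⊆ higherSets n m) :
    Measurable fun x => ∑ A ∈ J, weight n m A.card * hoeffdingTerm P h A x :=
  Finset.measurable_fun_sum _ fun _ hA =>
    (measurable_hoeffdingTerm hh (card_le_of_mem_higherSets (hJ hA))).const_mul _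

lemma memLp_sum_hoeffdingTerm (hh : h ∈ prodSpan (cubeIntegrable P) (Fin m))
    {J : Finset (Finset (Fin n))} (hJ : J ⊆ higherSets n m) :
    MemLp (fun x => ∑ A ∈ J, weight n m A.card * hoeffdingTerm P h A x) 2
      (Measure.pi fun _ => P) :=
  memLp_finsetSum _ fun _ hA =>
    (memLp_hoeffdingTerm hh (card_le_of_mem_higherSets (hJ hA))).const_mul _

/-- Since `(n choose r) * weight² = (m choose r) * weight`, the sets of size `r` contribute `r *
weight` times the order-`r` part of `σ_h²`. The factor `r * weight` is bounded uniformly in `r`. The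
factor `A.card` is present because of the sum over single observations in
`sum_integral_remainder_sub_sq_le`. -/
lemma sum_card_mul_le (hm1 : 1 ≤ m) (hmn : 2 * m < n)
    (hsym : ∀ (σ : Equiv.Perm (Fin m)) x, h (fun i => x (σ i)) = h x)
    (hh : h ∈ prodSpan (cubeIntegrable P) (Fin m))
    (h0 : ∫ y, h y ∂(Measure.pi fun _ => P) = 0) :
    ∑ A ∈ higherSets n m, (A.card : ℝ) * (weight n m A.card ^ 2 * projVar P h A.card)
      ≤ 2 * (m * ((m : ℝ) - 1) / (n * ((n : ℝ) - 1))) * sigmaH P h ^ 2 := by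
  set q := 2 * (m * ((m : ℝ) - 1) / (n * ((n : ℝ) - 1))) with hq
  unfold higherSets
  rw [Finset.sum_filter, ← Finset.powerset_univ,
    Finset.sum_powerset_apply_card (fun r => if 2 ≤ r ∧ r ≤ m then
      (r : ℝ) * (weight n m r ^ 2 * projVar P h r) else 0), sigmaH_sq hsym hh h0, Finset.mul_sum]
  simp only [Finset.card_univ, Fintype.card_fin, smul_ite, smul_zero]
  rw [← Finset.sum_filter]
  have hsub : (Finset.range (n + 1)).filter (fun r => 2 ≤ r ∧ r ≤ m) ⊆ Finset.range (m + 1) := by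
    intro r hr
    simp only [Finset.mem_filter, Finset.mem_range] at hr ⊢
    omega
  have hle : ∀ r, 2 ≤ r → r ≤ m → n.choose r • ((r : ℝ) * (weight n m r ^ 2 * projVar P h r))
      ≤ q * (m.choose r * projVar P h r) := by
    intro r h2 hm
    have p : (0 : ℝ) < n.choose r := by exact_mod_cast Nat.choose_pos (by omega : r ≤ n)
    have e : n.choose r • ((r : ℝ) * (weight n m r ^ 2 * projVar P h r))
        = (r * weight n m r) * (m.choose r * projVar P h r) := by
      rw [nsmul_eq_mul, weight]
      field_simp
    rw [e]
    exact mul_le_mul_of_nonneg_right (mul_weight_le hmn h2 hm)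
      (mul_nonneg (Nat.cast_nonneg _) (projVar_nonneg _ _ _))
  have hq0 : 0 ≤ q := by
    have h1 : (0 : ℝ) ≤ m - 1 := sub_nonneg.2 (by exact_mod_cast hm1)
    have h2 : (0 : ℝ) ≤ n - 1 := sub_nonneg.2 (by exact_mod_cast (by omega : 1 ≤ n))
    positivity
  refine (Finset.sum_le_sum fun r hr => ?_).trans
    (Finset.sum_le_sum_of_subset_of_nonneg hsub fun r _ _ => ?_)
  · exact hle r (Finset.mem_filter.1 hr).2.1 (Finset.mem_filter.1 hr).2.2
  · exact mul_nonneg hq0 (mul_nonneg (Nat.cast_nonneg _) (projVar_nonneg _ _ _))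

lemma integral_remainder_sq_le (hm1 : 1 ≤ m) (hmn : 2 * m < n)
    (hsym : ∀ (σ : Equiv.Perm (Fin m)) x, h (fun i => x (σ i)) = h x)
    (hh : h ∈ prodSpan (cubeIntegrable P) (Fin m))
    (h0 : ∫ y, h y ∂(Measure.pi fun _ => P) = 0) :
    ∫ x : Fin n → E, remainder P h x ^ 2 ∂(Measure.pi fun _ => P)
      ≤ 2 * (m * ((m : ℝ) - 1) / (n * ((n : ℝ) - 1))) * sigmaH P h ^ 2 := by
  unfold remainder
  rw [integral_sum_hoeffdingTerm_sq hh fun A hA => card_le_of_mem_higherSets hA]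
  refine (Finset.sum_le_sum fun A hA => ?_).trans (sum_card_mul_le hm1 hmn hsym hh h0)
  refine le_mul_of_one_le_left (mul_nonneg (sq_nonneg _) (projVar_nonneg _ _ _)) ?_
  have := (Finset.mem_filter.1 hA).2.1
  exact_mod_cast (by omega : 1 ≤ A.card)

/-- The difference retains exactly the sets containing `t`. Summing over `t` counts every set `A`
with multiplicity `A.card`. -/
lemma sum_integral_remainder_sub_sq_le (hm1 : 1 ≤ m) (hmn : 2 * m < n)
    (hsym : ∀ (σ : Equiv.Perm (Fin m)) x, h (fun i => x (σ i)) = h x)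
    (hh : h ∈ prodSpan (cubeIntegrable P) (Fin m))
    (h0 : ∫ y, h y ∂(Measure.pi fun _ => P) = 0) :
    ∑ t, ∫ x : Fin n → E, (remainder P h x - remainderWithout P h t x) ^ 2 ∂(Measure.pi fun _ => P)
      ≤ 2 * (m * ((m : ℝ) - 1) / (n * ((n : ℝ) - 1))) * sigmaH P h ^ 2 := by
  simp only [remainder_sub_remainderWithout]
  refine le_of_eq_of_le ?_ (sum_card_mul_le hm1 hmn hsym hh h0)
  have e : ∀ t : Fin n, ∫ x : Fin n → E, (∑ A ∈ (higherSets n m).filter (t ∈ ·),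
      weight n m A.card * hoeffdingTerm P h A x) ^ 2 ∂(Measure.pi fun _ => P)
      = ∑ A ∈ higherSets n m, if t ∈ A then weight n m A.card ^ 2 * projVar P h A.card else 0 := by
    intro t
    rw [integral_sum_hoeffdingTerm_sq hh fun A hA =>
      card_le_of_mem_higherSets (Finset.mem_filter.1 hA).1, Finset.sum_filter]
  simp only [e]
  rw [Finset.sum_comm]
  refine Finset.sum_congr rfl fun A _ => ?_
  rw [← Finset.sum_filter, Finset.sum_const, nsmul_eq_mul]
  simp

end Remainder

end GaussUStat

namespace GaussUStat

/-! ### The Berry–Esseen bound on the canonical space -/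

section Canonical

variable {E : Type*} [MeasurableSpace E] {P : Measure E} [IsProbabilityMeasure P] {m n : ℕ}
  {h : (Fin m → E) → ℝ}

/-- A coordinate is independent of a function of the other coordinates. -/
lemma indepFun_eval_of_update {β : Type*} [MeasurableSpace β] {F : (Fin n → E) → β}
    (hF : Measurable F) (t : Fin n) (hu : ∀ x e, F (Function.update x t e) = F x) :
    IndepFun (fun x => x t) F (Measure.pi fun _ => P) := by
  have : Nonempty E := nonempty_of_isProbabilityMeasure P
  have hi := iIndepFun_pi (μ := fun _ : Fin n => P) (X := fun _ => id) fun _ => aemeasurable_id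
  have h2 := hi.indepFun_finset {t} (Finset.univ.erase t) (by simp) fun i => measurable_pi_apply i
  let R : ({i // i ∈ (Finset.univ : Finset (Fin n)).erase t} → E) → Fin n → E := fun z i =>
    if hi : i ∈ Finset.univ.erase t then z ⟨i, hi⟩ else Classical.arbitrary E
  have hR : Measurable R := by
    refine measurable_pi_lambda _ fun i => ?_
    by_cases hi : i ∈ Finset.univ.erase t
    · simp only [R, hi, dif_pos]; fun_prop
    · simp only [R, hi, dif_neg, not_false_eq_true]; fun_prop
  have ht : t ∈ ({t} : Finset (Fin n)) := Finset.mem_singleton_self t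
  have hφ : Measurable fun z : {i // i ∈ ({t} : Finset (Fin n))} → E => z ⟨t, ht⟩ := by fun_prop
  have h3 : IndepFun (fun x => x t) (fun x => F (R fun i => x i)) (Measure.pi fun _ => P) :=
    h2.comp hφ (hF.comp hR)
  have e : ∀ x, F (R fun i => x i) = F x := by
    intro x
    rw [← hu x (Classical.arbitrary E)]
    congr 1
    ext1 i
    by_cases hi : i = t
    · subst hi; simp [R]
    · simp [R, hi]
  simpa only [e] using h3

/-- For a centred kernel `g` is the first projection, so measurability, the third moment and
centring of `g` follow from the general facts on projections. -/
lemma projKernel_eq_hoeffdingProj {P : Measure E} (h0 : ∫ y, h y ∂(Measure.pi fun _ => P) = 0) :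
    projKernel P h = fun e => hoeffdingProj P h 1 fun _ => e := by
  ext1 e
  rw [hoeffdingProj_one, h0, sub_zero]

lemma measurePreserving_const (P : Measure E) [IsProbabilityMeasure P] :
    MeasurePreserving (fun e (_ : Fin 1) => e) P (Measure.pi fun _ => P) :=
  (measurePreserving_funUnique P (Fin 1)).symm

lemma measurable_projKernel (hm1 : 1 ≤ m) (hh : h ∈ prodSpan (cubeIntegrable P) (Fin m))
    (h0 : ∫ y, h y ∂(Measure.pi fun _ => P) = 0) : Measurable (projKernel P h) := by
  rw [projKernel_eq_hoeffdingProj h0]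
  exact (measurable_of_mem_prodSpan (hoeffdingProj_mem hh hm1)).comp
    (measurePreserving_const P).measurable

lemma memLp_projKernel (hm1 : 1 ≤ m) (hh : h ∈ prodSpan (cubeIntegrable P) (Fin m))
    (h0 : ∫ y, h y ∂(Measure.pi fun _ => P) = 0) : MemLp (projKernel P h) 3 P := by
  rw [projKernel_eq_hoeffdingProj h0]
  exact (memLp_of_mem_prodSpan (hoeffdingProj_mem hh hm1)).comp_measurePreserving
    (measurePreserving_const P)

lemma integral_projKernel (hm1 : 1 ≤ m) (hh : h ∈ prodSpan (cubeIntegrable P) (Fin m))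
    (h0 : ∫ y, h y ∂(Measure.pi fun _ => P) = 0) : ∫ e, projKernel P h e ∂P = 0 := by
  have hm := measurable_of_mem_prodSpan (hoeffdingProj_mem hh hm1)
  have hz := integral_eq_zero_of_mem (P := P) (i := (id : Fin 1 → Fin 1)) Function.injective_id
    (hoeffdingProj_mem_prodSpan hh hm1)
  simp only [id] at hz
  rw [← (measurePreserving_const P).map_eq, integral_map
    (measurePreserving_const P).measurable.aemeasurable hm.aestronglyMeasurable] at hz
  rw [projKernel_eq_hoeffdingProj h0]
  exact hz

lemma sigmaG_sq (hm1 : 1 ≤ m) (hh : h ∈ prodSpan (cubeIntegrable P) (Fin m))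
    (h0 : ∫ y, h y ∂(Measure.pi fun _ => P) = 0) :
    sigmaG P h ^ 2 = ∫ e, projKernel P h e ^ 2 ∂P := by
  rw [sigmaG, Real.sq_sqrt (variance_nonneg _ _), variance_of_integral_eq_zero
    (measurable_projKernel hm1 hh h0).aemeasurable (integral_projKernel hm1 hh h0)]

lemma integral_pi_eval {F : E → ℝ} (hF : Measurable F) (t : Fin n) :
    ∫ y : Fin n → E, F (y t) ∂(Measure.pi fun _ => P) = ∫ e, F e ∂P := by
  have hmp := measurePreserving_eval (fun _ : Fin n => P) t
  have := integral_map (μ := Measure.pi fun _ : Fin n => P) (f := F) hmp.measurable.aemeasurable hF.aestronglyMeasurable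
  rw [hmp.map_eq] at this
  exact this.symm

/-- The standardized linear part of a U-statistic. -/
noncomputable def linearPart (P : Measure E) (h : (Fin m → E) → ℝ) (n : ℕ) (t : Fin n)
    (y : Fin n → E) : ℝ :=
  projKernel P h (y t) / (√n * sigmaG P h)

lemma integral_linearPart_sq (hm1 : 1 ≤ m) (hh : h ∈ prodSpan (cubeIntegrable P) (Fin m))
    (h0 : ∫ y, h y ∂(Measure.pi fun _ => P) = 0) (hσ : 0 < sigmaG P h) (t : Fin n) :
    ∫ y, linearPart P h n t y ^ 2 ∂(Measure.pi fun _ => P) = 1 / n := by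
  unfold linearPart
  rw [integral_pi_eval (F := fun e => (projKernel P h e / (√n * sigmaG P h)) ^ 2)
    (((measurable_projKernel hm1 hh h0).div_const _).pow_const 2)]
  simp only [div_pow, mul_pow, Real.sq_sqrt (Nat.cast_nonneg n)]
  rw [integral_div, ← sigmaG_sq hm1 hh h0]
  have : (0 : ℝ) < n := by exact_mod_cast t.pos
  field_simp

lemma isStdSum_linearPart (hm1 : 1 ≤ m) (hn : 0 < n)
    (hh : h ∈ prodSpan (cubeIntegrable P) (Fin m))
    (h0 : ∫ y, h y ∂(Measure.pi fun _ => P) = 0) (hσ : 0 < sigmaG P h) :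
    BerryEsseen.IsStdSum (linearPart P h n) (Measure.pi fun _ => P) where
  meas t := ((measurable_projKernel hm1 hh h0).comp (measurable_pi_apply t)).div_const _
  indep := iIndepFun_pi (μ := fun _ : Fin n => P)
    (X := fun _ e => projKernel P h e / (√n * sigmaG P h))
    fun _ => ((measurable_projKernel hm1 hh h0).div_const _).aemeasurable
  memLp t := by
    have := (memLp_projKernel hm1 hh h0).comp_measurePreserving
      (measurePreserving_eval (fun _ : Fin n => P) t)
    unfold linearPart
    simp only [div_eq_inv_mul]
    exact this.const_mul (√n * sigmaG P h)⁻¹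
  mean t := by
    unfold linearPart
    rw [integral_div, integral_pi_eval (measurable_projKernel hm1 hh h0),
      integral_projKernel hm1 hh h0, zero_div]
  var := by
    have : (0 : ℝ) < n := by exact_mod_cast hn
    simp only [integral_linearPart_sq hm1 hh h0 hσ]
    simp
    field_simp

lemma lyapunov_linearPart (hm1 : 1 ≤ m) (hn : 0 < n)
    (hh : h ∈ prodSpan (cubeIntegrable P) (Fin m))
    (h0 : ∫ y, h y ∂(Measure.pi fun _ => P) = 0) (hσ : 0 < sigmaG P h) :
    BerryEsseen.lyapunov (linearPart P h n) (Measure.pi fun _ => P)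
      = absThirdMomentG P h / (√n * sigmaG P h ^ 3) := by
  have hn' : (0 : ℝ) < n := by exact_mod_cast hn
  have hs : 0 < √(n : ℝ) := Real.sqrt_pos.2 hn'
  have e : ∀ t : Fin n, ∫ y, |linearPart P h n t y| ^ 3 ∂(Measure.pi fun _ => P)
      = absThirdMomentG P h / (√n * sigmaG P h) ^ 3 := by
    intro t
    unfold linearPart absThirdMomentG
    rw [integral_pi_eval (F := fun e => |projKernel P h e / (√n * sigmaG P h)| ^ 3)
      (((measurable_projKernel hm1 hh h0).div_const _).abs.pow_const 3)]
    simp only [abs_div, div_pow, abs_of_pos (mul_pos hs hσ)]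
    rw [integral_div]
  unfold BerryEsseen.lyapunov
  simp only [e]
  rw [Finset.sum_const, Finset.card_univ, Fintype.card_fin, nsmul_eq_mul]
  nth_rewrite 1 [← Real.mul_self_sqrt hn'.le]
  field_simp

/-- After squaring, the claim is `2(m - 1)/(n - 1) ≤ (√2 + 2)² (m - 1)²/(n - m + 1)`. Both sides
vanish for `m = 1`. For `m ≥ 2` it follows from `4 ≤ (√2 + 2)²`, `m - 1 ≥ 1` and `n - m + 1 ≤ n -
1`. -/
lemma sqrt_remainder_bound_le {m n : ℕ} (hm1 : 1 ≤ m) (hmn : 2 * m < n) {σg σh : ℝ} (hg : 0 < σg)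
    (hh : 0 ≤ σh) :
    √((√n / (m * σg)) ^ 2 * (2 * (m * ((m : ℝ) - 1) / (n * ((n : ℝ) - 1))) * σh ^ 2))
      ≤ (√2 + 2) * ((m : ℝ) - 1) * σh / (√(m * ((n : ℝ) - m + 1)) * σg) := by
  have hm : (1 : ℝ) ≤ m := by exact_mod_cast hm1
  have hn : 2 * (m : ℝ) + 1 ≤ n := by exact_mod_cast hmn
  have h1 : (0 : ℝ) ≤ m - 1 := by linarith
  have h2 : (0 : ℝ) < n - m + 1 := by linarith
  have h3 : (0 : ℝ) < n - 1 := by linarith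
  have h4 : (0 : ℝ) < n := by linarith
  have h5 : (0 : ℝ) < m := by linarith
  rw [Real.sqrt_le_iff]
  refine ⟨by positivity, ?_⟩
  have hk : 4 ≤ (√2 + 2) ^ 2 := by nlinarith [Real.sqrt_nonneg 2]
  have e1 : (√n / (m * σg)) ^ 2 * (2 * (m * ((m : ℝ) - 1) / (n * ((n : ℝ) - 1))) * σh ^ 2)
      = 2 * ((m : ℝ) - 1) / (n - 1) * (σh ^ 2 / (m * σg ^ 2)) := by
    rw [div_pow, Real.sq_sqrt h4.le]
    field_simp
  have e2 : ((√2 + 2) * ((m : ℝ) - 1) * σh / (√(m * ((n : ℝ) - m + 1)) * σg)) ^ 2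
      = (√2 + 2) ^ 2 * ((m : ℝ) - 1) ^ 2 / (n - m + 1) * (σh ^ 2 / (m * σg ^ 2)) := by
    rw [div_pow, mul_pow, mul_pow, mul_pow, Real.sq_sqrt (by positivity)]
    field_simp
  rw [e1, e2]
  refine mul_le_mul_of_nonneg_right ?_ (by positivity)
  rcases hm1.eq_or_lt with rfl | hm2
  · simp
  · have hm2' : (2 : ℝ) ≤ m := by exact_mod_cast hm2
    refine div_le_div₀ (by positivity) ?_ h2 (by linarith)
    nlinarith [mul_le_mul_of_nonneg_right hk (sq_nonneg ((m : ℝ) - 1))]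

/-- The Berry–Esseen bound for a non-degenerate U-statistic whose kernel is a sum of products. -/
theorem uStat_berry_esseen (hm1 : 1 ≤ m) (hmn : 2 * m < n)
    (hsym : ∀ (σ : Equiv.Perm (Fin m)) x, h (fun i => x (σ i)) = h x)
    (hh : h ∈ prodSpan (cubeIntegrable P) (Fin m))
    (h0 : ∫ y, h y ∂(Measure.pi fun _ => P) = 0) (hσ : 0 < sigmaG P h) (x : ℝ) :
    |(Measure.pi fun _ : Fin n => P).real {y | √n / (m * sigmaG P h) *
          uStat h (fun i (y : Fin n → E) => y i) y ≤ x} - cdf (gaussianReal 0 1) x|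
      ≤ 3500 * (absThirdMomentG P h / (√n * sigmaG P h ^ 3))
        + (Measure.pi fun _ : Fin n => P).real {y | (|x| + 1) / 3 < |√n / (m * sigmaG P h) *
            hoeffdingRemainder P h (fun i (y : Fin n → E) => y i) y|}
        + 28 * Real.exp 2 * Real.exp (-|x| / 6) *
          ((√2 + 2) * ((m : ℝ) - 1) * sigmaH P h / (√(m * ((n : ℝ) - m + 1)) * sigmaG P h)) := by
  have hn : 0 < n := by omega
  have hn' : (0 : ℝ) < n := by exact_mod_cast hn
  have hm' : (0 : ℝ) < m := by exact_mod_cast hm1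
  have hs : 0 < √(n : ℝ) := Real.sqrt_pos.2 hn'
  set K := √n / (m * sigmaG P h) with hK
  set τ := (√2 + 2) * ((m : ℝ) - 1) * sigmaH P h / (√(m * ((n : ℝ) - m + 1)) * sigmaG P h) with hτ
  set δ := absThirdMomentG P h / (√n * sigmaG P h ^ 3) with hδ
  have std := isStdSum_linearPart hm1 hn hh h0 hσ
  have hly : BerryEsseen.lyapunov (linearPart P h n) (Measure.pi fun _ => P) = δ :=
    lyapunov_linearPart hm1 hn hh h0 hσ
  have hv := fun t : Fin n => integral_linearPart_sq hm1 hh h0 hσ t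
  -- Each of the `n` third moments is at least `n^{-3/2}`, so `δ ≥ n^{-1/2} = ‖ξ_t‖₂ ≥ 𝔼|ξ_t|`. This
  -- supplies the first-moment hypothesis and the positivity of `δ`.
  have hδ1 : √(1 / (n : ℝ)) ≤ δ := by
    have hc : ∀ t : Fin n, √(1 / (n : ℝ)) ^ 3
        ≤ ∫ y, |linearPart P h n t y| ^ 3 ∂(Measure.pi fun _ => P) := by
      intro t
      have := std.sqrt_cube_le t
      rwa [hv] at this
    have := Finset.sum_le_sum fun t (_ : t ∈ Finset.univ) => hc t
    rw [Finset.sum_const, Finset.card_univ, Fintype.card_fin, nsmul_eq_mul] at this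
    refine le_of_eq_of_le ?_ (this.trans hly.le)
    rw [pow_succ, Real.sq_sqrt (by positivity)]
    field_simp
  have hδ0 : 0 < δ := lt_of_lt_of_le (by positivity) hδ1
  have hrem : ∀ y : Fin n → E, hoeffdingRemainder P h (fun i (y : Fin n → E) => y i) y
      = remainder P h y := hoeffdingRemainder_eq_sum
  have mW : ∀ t, Measurable (remainderWithout P h t : (Fin n → E) → ℝ) := fun t =>
    measurable_sum_hoeffdingTerm hh (Finset.filter_subset _ _)
  have key := std.nonlinear_berry_esseen hδ0 hly.le
    (fun t => (BerryEsseen.integral_abs_le_sqrt (std.memLp_two t)).trans (by rwa [hv]))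
    (Δ := fun y => K * remainder P h y) (Δ' := fun t y => K * remainderWithout P h t y)
    ((measurable_sum_hoeffdingTerm hh subset_rfl).const_mul _) (fun t => (mW t).const_mul _)
    ((memLp_sum_hoeffdingTerm hh subset_rfl).const_mul _)
    (fun t => (memLp_sum_hoeffdingTerm hh (Finset.filter_subset _ _)).const_mul _)
    -- Neither the truncated sum without its `t`-th term nor the remainder without `t` changes when
    -- coordinate `t` is altered, so the pair is independent of `ξ_t`.
    (fun t => by
      have hF : Measurable fun y : Fin n → E =>
          (BerryEsseen.truncSum (linearPart P h n) y - BerryEsseen.trunc (linearPart P h n t y),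
            K * remainderWithout P h t y) := by
        have := std.measurable_truncSum
        have := BerryEsseen.measurable_trunc.comp (std.meas t)
        have := mW t
        fun_prop
      exact (indepFun_eval_of_update hF t fun y e => by
        unfold BerryEsseen.truncSum
        rw [← Finset.sum_erase_eq_sub (Finset.mem_univ t), ← Finset.sum_erase_eq_sub
          (Finset.mem_univ t), remainderWithout_update]
        congr 1
        refine Finset.sum_congr rfl fun s hs => ?_
        rw [linearPart, Function.update_of_ne (Finset.ne_of_mem_erase hs), linearPart]).comp (φ := fun e => projKernel P h e / (√n * sigmaG P h)) (ψ := id)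
          ((measurable_projKernel hm1 hh h0).div_const _) measurable_id) x
  have hsum : ∀ y : Fin n → E, ∑ t, linearPart P h n t y + K * remainder P h y
      = K * uStat h (fun i (y : Fin n → E) => y i) y := by
    intro y
    rw [uStat_eq_linear_add_remainder hsym (by omega) h0, hrem, mul_add]
    congr 1
    unfold linearPart
    rw [← Finset.sum_div, hK, ← mul_assoc]
    have : √(n : ℝ) * √n = n := Real.mul_self_sqrt hn'.le
    field_simp
    rw [sq, this]
  have hτ0 : √(K ^ 2 * (2 * (m * ((m : ℝ) - 1) / (n * ((n : ℝ) - 1))) * sigmaH P h ^ 2)) ≤ τ :=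
    sqrt_remainder_bound_le hm1 hmn hσ (Real.sqrt_nonneg _)
  have t1 : √(∫ y : Fin n → E, (K * remainder P h y) ^ 2 ∂(Measure.pi fun _ => P)) ≤ τ := by
    refine (Real.sqrt_le_sqrt ?_).trans hτ0
    simp only [mul_pow]
    rw [integral_const_mul]
    exact mul_le_mul_of_nonneg_left (integral_remainder_sq_le hm1 hmn hsym hh h0) (sq_nonneg K)
  -- Cauchy–Schwarz over `t` with `∑ ‖ξ_t‖₂² = 1` reduces the sum to the root of `∑ 𝔼 (Δ - Δ_t)²`.
  have t2 : ∑ t, √(∫ y, linearPart P h n t y ^ 2 ∂(Measure.pi fun _ => P))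
      * √(∫ y : Fin n → E, (K * remainder P h y - K * remainderWithout P h t y) ^ 2
        ∂(Measure.pi fun _ => P)) ≤ τ := by
    refine (Real.sum_sqrt_mul_sqrt_le _ (fun t => by positivity) fun t => by positivity).trans ?_
    rw [std.var, Real.sqrt_one, one_mul]
    refine (Real.sqrt_le_sqrt ?_).trans hτ0
    simp only [← mul_sub, mul_pow, integral_const_mul]
    rw [← Finset.mul_sum]
    exact mul_le_mul_of_nonneg_left (sum_integral_remainder_sub_sq_le hm1 hmn hsym hh h0)
      (sq_nonneg K)
  simp only [hsum] at key
  simp only [hrem]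
  refine key.trans (add_le_add_right ?_ _)
  -- Both `L²` quantities are at most `τ`, hence `14 · 2 = 28`. The decay rate `1/3` is stronger
  -- than the required `1/6`.
  have hexp : Real.exp (-|x| / 3) ≤ Real.exp (-|x| / 6) :=
    Real.exp_le_exp.2 (by linarith [abs_nonneg x])
  have hτn : 0 ≤ τ := (Real.sqrt_nonneg _).trans hτ0
  calc _ ≤ 14 * Real.exp 2 * Real.exp (-|x| / 6) * (τ + τ) := by
        gcongr
    _ = _ := by ring

end Canonical

end GaussUStat

namespace GaussUStat

/-! ### Kernels of polynomials in a covariance matrix -/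

section CovKernel

variable {p m n : ℕ}

lemma kernel_comp_perm (f : CovPoly p m) (σ : Equiv.Perm (Fin m))
    (x : Fin m → EuclideanSpace ℝ (Fin p)) : f.kernel (fun i => x (σ i)) = f.kernel x := by
  unfold CovPoly.kernel
  congr 1
  exact Fintype.sum_equiv (Equiv.mulLeft σ) _ _ fun π => rfl

variable {E : Type*} [MeasurableSpace E] {P : Measure E} [IsProbabilityMeasure P]

lemma one_mem_cubeIntegrable : (fun _ => 1) ∈ cubeIntegrable P :=
  ⟨measurable_const, memLp_const 1⟩

lemma prod_comp_mem_prodSpan {κ ι : Type*} [Fintype κ] [Fintype ι] {i : κ → ι}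
    (hi : Function.Injective i) {φ : κ → E → ℝ} (hφ : ∀ a, φ a ∈ cubeIntegrable P) :
    (fun x : ι → E => ∏ a, φ a (x (i a))) ∈ prodSpan (cubeIntegrable P) ι := by
  simp only [prod_comp_eq_prod_extend hi]
  refine prod_mem_prodSpan fun t => ?_
  by_cases ht : ∃ a, i a = t
  · obtain ⟨a, rfl⟩ := ht
    rw [hi.extend_apply]
    exact hφ a
  · rw [Function.extend_apply' _ _ _ ht]
    exact one_mem_cubeIntegrable

lemma integral_prod_comp {κ ι : Type*} [Fintype κ] [Fintype ι] {i : κ → ι}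
    (hi : Function.Injective i) {φ : κ → E → ℝ} (hφ : ∀ a, φ a ∈ cubeIntegrable P) :
    ∫ x : ι → E, ∏ a, φ a (x (i a)) ∂(Measure.pi fun _ => P) = ∏ a, ∫ e, φ a e ∂P := by
  have hmp := measurePreserving_comp_injective (P := P) hi
  have hm := measurable_of_mem_prodSpan (prod_mem_prodSpan hφ)
  rw [← integral_prod_pi, ← hmp.map_eq,
    integral_map hmp.measurable.aemeasurable hm.aestronglyMeasurable]

lemma memLp_eval_multivariateGaussian {Θ : Matrix (Fin p) (Fin p) ℝ} {q : ENNReal} (hq : q ≠ ⊤)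
    (u : Fin p) : MemLp (fun x : EuclideanSpace ℝ (Fin p) => x u) q (multivariateGaussian 0 Θ) :=
  (EuclideanSpace.proj u : EuclideanSpace ℝ (Fin p) →L[ℝ] ℝ).comp_memLp'
    (IsGaussian.memLp_id (multivariateGaussian 0 Θ) q hq)

/-- Gaussian coordinates have finite sixth moments, and `1/6 + 1/6 = 1/3` in Hölder's inequality. -/
lemma thetaHat_mem_cubeIntegrable (Θ : Matrix (Fin p) (Fin p) ℝ) (q : UpperPair p) :
    thetaHat q ∈ cubeIntegrable (multivariateGaussian 0 Θ) := by
  have : ENNReal.HolderTriple 6 6 3 := ⟨by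
    rw [← ENNReal.toReal_eq_toReal_iff' (by simp) (by simp)]
    norm_num [ENNReal.toReal_add]⟩
  refine ⟨by unfold thetaHat; fun_prop, ?_⟩
  exact MemLp.mul (p := 6) (q := 6) (memLp_eval_multivariateGaussian (by norm_num) q.val.2)
    (memLp_eval_multivariateGaussian (by norm_num) q.val.1)

lemma integral_thetaHat {Θ : Matrix (Fin p) (Fin p) ℝ} (hΘ : Θ.PosSemidef) (q : UpperPair p) :
    ∫ x, thetaHat q x ∂multivariateGaussian 0 Θ = Θ q.val.1 q.val.2 := by
  have hz : ∀ u : Fin p, ∫ x : EuclideanSpace ℝ (Fin p), x u ∂multivariateGaussian 0 Θ = 0 := by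
    intro u
    have := (EuclideanSpace.proj u : EuclideanSpace ℝ (Fin p) →L[ℝ] ℝ).integral_comp_comm
      (IsGaussian.integrable_id (μ := multivariateGaussian 0 Θ))
    simpa using this
  have hc := covariance_eval_multivariateGaussian (μ := 0) hΘ q.val.1 q.val.2
  rw [covariance_eq_sub (memLp_eval_multivariateGaussian (by norm_num) _)
    (memLp_eval_multivariateGaussian (by norm_num) _), hz, zero_mul, sub_zero] at hc
  exact hc

lemma preKernel_comp_mem (f : CovPoly p m) (Θ : Matrix (Fin p) (Fin p) ℝ)
    (π : Equiv.Perm (Fin m)) :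
    (fun x => f.preKernel fun i => x (π i))
      ∈ prodSpan (cubeIntegrable (multivariateGaussian 0 Θ)) (Fin m) := by
  have e : (fun x => f.preKernel fun i => x (π i))
      = f.a₀ • (fun x : Fin m → EuclideanSpace ℝ (Fin p) => ∏ i : Fin m, (fun _ => (1 : ℝ)) (x i))
        + ∑ r : Fin m, ∑ w : Fin (r.val + 1) → UpperPair p, f.a r w •
          fun x => ∏ i, thetaHat (w i) (x (π (Fin.castLE r.isLt i))) := by
    ext x
    simp [CovPoly.preKernel, Finset.sum_apply]
  rw [e]
  exact add_mem (Submodule.smul_mem _ _ (prod_mem_prodSpan fun _ => one_mem_cubeIntegrable))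
    (sum_mem fun r _ => sum_mem fun w _ => Submodule.smul_mem _ _
      (prod_comp_mem_prodSpan (π.injective.comp (Fin.castLE_injective r.isLt))
        fun i => thetaHat_mem_cubeIntegrable Θ (w i)))

/-- The factors of each monomial use different independent observations, so the expectation factors
into the corresponding entries of `Θ`. -/
lemma integral_preKernel_comp (f : CovPoly p m) {Θ : Matrix (Fin p) (Fin p) ℝ}
    (hΘ : Θ.PosSemidef) (π : Equiv.Perm (Fin m)) :
    ∫ x, f.preKernel (fun i => x (π i)) ∂(Measure.pi fun _ => multivariateGaussian 0 Θ)
      = f.eval Θ := by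
  have hinj : ∀ r : Fin m, Function.Injective fun i : Fin (r.val + 1) => π (Fin.castLE r.isLt i) :=
    fun r => π.injective.comp (Fin.castLE_injective r.isLt)
  have hint : ∀ (r : Fin m) (w : Fin (r.val + 1) → UpperPair p), Integrable
      (fun x : Fin m → EuclideanSpace ℝ (Fin p) =>
        f.a r w * ∏ i, thetaHat (w i) (x (π (Fin.castLE r.isLt i))))
      (Measure.pi fun _ => multivariateGaussian 0 Θ) := fun r w =>
    ((memLp_of_mem_prodSpan (prod_comp_mem_prodSpan (hinj r) fun i =>
      thetaHat_mem_cubeIntegrable Θ (w i))).integrable (by norm_num)).const_mul _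
  unfold CovPoly.preKernel CovPoly.eval
  rw [integral_add (integrable_const _) (integrable_finsetSum _ fun r _ =>
    integrable_finsetSum _ fun w _ => hint r w), integral_finsetSum _ fun r _ =>
    integrable_finsetSum _ fun w _ => hint r w]
  congr 1
  · simp
  refine Finset.sum_congr rfl fun r _ => ?_
  rw [integral_finsetSum _ fun w _ => hint r w]
  refine Finset.sum_congr rfl fun w _ => ?_
  rw [integral_const_mul, integral_prod_comp (hinj r) fun i =>
    thetaHat_mem_cubeIntegrable Θ (w i)]
  simp only [integral_thetaHat hΘ]

lemma kernel_mem_prodSpan (f : CovPoly p m) (Θ : Matrix (Fin p) (Fin p) ℝ) :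
    f.kernel ∈ prodSpan (cubeIntegrable (multivariateGaussian 0 Θ)) (Fin m) := by
  have e : f.kernel = ((m.factorial : ℝ))⁻¹ •
      ∑ π : Equiv.Perm (Fin m), fun x => f.preKernel fun i => x (π i) := by
    ext x
    simp [CovPoly.kernel]
  rw [e]
  exact Submodule.smul_mem _ _ (sum_mem fun π _ => preKernel_comp_mem f Θ π)

lemma integral_kernel (f : CovPoly p m) {Θ : Matrix (Fin p) (Fin p) ℝ} (hΘ : Θ.PosSemidef) :
    ∫ x, f.kernel x ∂(Measure.pi fun _ => multivariateGaussian 0 Θ) = f.eval Θ := by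
  unfold CovPoly.kernel
  rw [integral_const_mul, integral_finsetSum _ fun π _ =>
    (memLp_of_mem_prodSpan (preKernel_comp_mem f Θ π)).integrable (by norm_num)]
  simp only [integral_preKernel_comp f hΘ]
  rw [Finset.sum_const, Finset.card_univ, Fintype.card_perm, Fintype.card_fin, nsmul_eq_mul,
    inv_mul_cancel_left₀ (by exact_mod_cast m.factorial_ne_zero)]

/-! ### Transfer from the canonical space -/

lemma measurable_uStat {r : ℕ} {k : (Fin r → E) → ℝ} (hk : Measurable k) :
    Measurable (uStat k fun i (y : Fin n → E) => y i) := by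
  unfold uStat
  exact (Finset.measurable_fun_sum _ fun i _ => hk.comp (by fun_prop)).const_mul _

lemma measurable_hoeffdingRemainder {h : (Fin m → E) → ℝ}
    (hh : h ∈ prodSpan (cubeIntegrable P) (Fin m)) :
    Measurable (hoeffdingRemainder P h fun i (y : Fin n → E) => y i) := by
  unfold hoeffdingRemainder
  exact Finset.measurable_fun_sum _ fun r hr => (measurable_uStat (measurable_of_mem_prodSpan
    (hoeffdingProj_mem hh (Finset.mem_Icc.1 hr).2))).const_mul _

end CovKernel

end GaussUStat

theorem lemma5 :
    ∃ C₁ C₂ : ℝ, 0 < C₁ ∧ 0 < C₂ ∧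
      ∀ (p m n : ℕ), 1 ≤ m → 2 * m < n →
      ∀ (f : GaussUStat.CovPoly p m) (Θ : Matrix (Fin p) (Fin p) ℝ), Θ.PosDef → f.eval Θ = 0 →
      ∀ (P : Measure (EuclideanSpace ℝ (Fin p))), P = multivariateGaussian 0 Θ →
      ∀ (σg σh : ℝ), σg = GaussUStat.sigmaG P f.kernel → σh = GaussUStat.sigmaH P f.kernel →
        0 < σg →
      ∀ (Ω : Type*) [MeasurableSpace Ω] (μ : Measure Ω) [IsProbabilityMeasure μ]
        (X : Fin n → Ω → EuclideanSpace ℝ (Fin p)),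
        iIndepFun X μ → (∀ i, HasLaw (X i) P μ) →
      ∀ x : ℝ,
        |μ.real {ω | √n / (m * σg) * GaussUStat.uStat f.kernel X ω ≤ x}
            - cdf (gaussianReal 0 1) x|
          ≤ C₁ * (GaussUStat.absThirdMomentG P f.kernel / (√n * σg ^ 3))
            + μ.real {ω | (|x| + 1) / 3 <
                |√n / (m * σg) * GaussUStat.hoeffdingRemainder P f.kernel X ω|}
            + C₂ * Real.exp (-|x| / 6) *
                ((√2 + 2) * ((m : ℝ) - 1) * σh / (√(m * ((n : ℝ) - m + 1)) * σg)) := by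
  refine ⟨3500, 28 * Real.exp 2, by norm_num, by positivity, ?_⟩
  rintro p m n hm hmn f Θ hΘ hf P rfl σg σh rfl rfl hσ Ω _ μ _ X hX hlaw x
  have hh := GaussUStat.kernel_mem_prodSpan f Θ
  have key := GaussUStat.uStat_berry_esseen hm hmn (GaussUStat.kernel_comp_perm f) hh
    ((GaussUStat.integral_kernel f hΘ.posSemidef).trans hf) hσ x
  have hl := hX.hasLaw_pi hlaw
  -- The sample has the product law, and every event in the bound is the preimage of a measurable
  -- set under the sample.
  have tr : ∀ s : Set (Fin n → EuclideanSpace ℝ (Fin p)), MeasurableSet s →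
      (Measure.pi fun _ => multivariateGaussian 0 Θ).real s
        = μ.real ((fun ω i => X i ω) ⁻¹' s) := by
    intro s hs
    rw [← hl.map_eq, map_measureReal_apply_of_aemeasurable hl.aemeasurable hs]
  rw [tr _ (measurableSet_le ((GaussUStat.measurable_uStat
      (GaussUStat.measurable_of_mem_prodSpan hh)).const_mul _) measurable_const),
    tr _ (measurableSet_lt measurable_const
      ((GaussUStat.measurable_hoeffdingRemainder hh).const_mul _).abs)] at key
  exact key
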